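/- Let $\mathfrak g$ be the $N=1$ BMS superalgebra: the complex Lie superalgebra with even basis $L_n, M_n$ ($n\in\mathbb Z$), $\mathbf c_1,\mathbf c_2$, odd basis $Q_r$ ($r\in\mathbb Z+\frac12$), and brackets $$[L_m,L_n]=(m-n)L_{m+n}+\tfrac1{12}\delta_{m+n,0}(m^3-m)\mathbf c_1,\qquad [L_m,M_n]=(m-n)M_{m+n}+\tfrac1{12}\delta_{m+n,0}(m^3-m)\mathbf c_2,$$ $$[Q_r,Q_s]=2M_{r+s}+\tfrac13\delta_{r+s,0}\left(r^2-\tfrac14\right)\mathbf c_2,\qquad [L_m,Q_r]=\left(\tfrac m2-r\right)Q_{m+r},$$ $$[M_m,M_n]=[M_n,Q_r]=0,\qquad [\mathbf c_1,\mathfrak g]=[\mathbf c_2,\mathfrak g]=0 .$$ All modules are $\mathbb Z_2$-graded, and a module is simple if it is nonzero and has no ($\mathbb Z_2$-graded) submodules other than $0$ and itself. A module has central charge $(c_1,c_2)\in\mathbb C^2$ if $\mathbf c_1,\mathbf c_2$ act on it as the scalars $c_1,c_2$. A $\mathfrak g$-module $W$ is smooth if for every $w\in W$ one has $L_iw=M_iw=Q_{i-\frac12}w=0$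 for all sufficiently large $i$. For $q\in\mathbb N=\{0,1,2,\dots\}$ let $$\mathfrak g^{(0,-q)}=\bigoplus_{i\ge 0}\mathbb C L_i\oplus\bigoplus_{j\ge -q}\mathbb C M_j\oplus\bigoplus_{k\ge 1}\mathbb C Q_{k-\frac12}\oplus\mathbb C\mathbf c_1\oplus\mathbb C\mathbf c_2,$$ a subalgebra of $\mathfrak g$, and for a $\mathfrak g^{(0,-q)}$-module $V$ let $\mathrm{Ind}_q(V)=U(\mathfrak g)\otimes_{U(\mathfrak g^{(0,-q)})}V$. **Theorem 4.1.** Let $q\in\mathbb N$, $c_1,c_2\in\mathbb C$, and let $V$ be a simple $\mathfrak g^{(0,-q)}$-module of central charge $(c_1,c_2)$. Assume that there exists $t\in\mathbb N$ such that (a) if $t>0$, then $M_t$ acts injectively on $V$; if $t=0$, then $M_0+\frac1{24}(n^2-1)\mathbf c_2$ acts injectively on $V$ for every nonzero integer $n$; (b) $M_iV=0$ for all $i>t$ and $L_jV=0$ for all $j>t+q$. Then (i) $Q_{i-\frac12}V=0$ for all $i>t$; (ii) $\mathrm{Ind}_q(V)$ is a simple smooth $\mathfrak g$-module of central charge $(c_1,c_2)$.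 -/

import Mathlib

open scoped TensorProduct

/-! ### Lie superalgebras over `ℂ` and their modules -/

/-- The Koszul sign `(-1)^{ab}` for parities `a, b ∈ ℤ/2`. -/
def koszulSign (a b : ZMod 2) : ℂ := if a = 1 ∧ b = 1 then -1 else 1

/-- A (complex) Lie superalgebra: a `ℤ/2`-graded vector space `L = L₀ ⊕ L₁` with an even bilinear
bracket that is super skew-symmetric and satisfies the super Jacobi identity. -/
class LieSuperalgebra (L : Type*) [AddCommGroup L] [Module ℂ L] where
  part : ZMod 2 → Submodule ℂ L
  isCompl_part : IsCompl (part 0) (part 1)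
  bracket : L →ₗ[ℂ] L →ₗ[ℂ] L
  bracket_mem : ∀ {a b : ZMod 2} {x y : L}, x ∈ part a → y ∈ part b →
    bracket x y ∈ part (a + b)
  bracket_skew : ∀ {a b : ZMod 2} {x y : L}, x ∈ part a → y ∈ part b →
    bracket x y = -(koszulSign a b • bracket y x)
  bracket_jacobi : ∀ {a b c : ZMod 2} {x y z : L}, x ∈ part a → y ∈ part b → z ∈ part c →
    bracket x (bracket y z) =
      bracket (bracket x y) z + koszulSign a b • bracket y (bracket x z)

/-- A (graded) subalgebra of a Lie superalgebra: a `ℤ/2`-graded subspace closed under the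
bracket. -/
structure LieSuperSubalgebra (L : Type*) [AddCommGroup L] [Module ℂ L] [LieSuperalgebra L] where
  carrier : Submodule ℂ L
  graded : carrier ≤
    (carrier ⊓ LieSuperalgebra.part 0) ⊔ (carrier ⊓ LieSuperalgebra.part 1)
  bracket_mem : ∀ {x y : L}, x ∈ carrier → y ∈ carrier →
    LieSuperalgebra.bracket x y ∈ carrier

/-- A graded subalgebra is a Lie superalgebra, with the restricted grading and bracket. -/
instance LieSuperSubalgebra.instLieSuperalgebra {L : Type*} [AddCommGroup L] [Module ℂ L]
    [LieSuperalgebra L] (h : LieSuperSubalgebra L) : LieSuperalgebra h.carrier where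
  part a := (LieSuperalgebra.part (L := L) a).comap h.carrier.subtype
  isCompl_part := by
    constructor
    · rw [Submodule.disjoint_def]
      intro x h0 h1
      exact Subtype.ext
        (Submodule.disjoint_def.1 LieSuperalgebra.isCompl_part.disjoint x.1 h0 h1)
    · rw [codisjoint_iff, eq_top_iff]
      rintro ⟨x, hx⟩ -
      obtain ⟨y, hy, z, hz, hyz⟩ := Submodule.mem_sup.1 (h.graded hx)
      exact Submodule.mem_sup.2 ⟨⟨y, hy.1⟩, hy.2, ⟨z, hz.1⟩, hz.2, Subtype.ext hyz⟩
  bracket := LinearMap.mk₂ ℂ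
    (fun x y => ⟨LieSuperalgebra.bracket x.1 y.1, h.bracket_mem x.2 y.2⟩)
    (fun x y z => Subtype.ext (by simp))
    (fun c x y => Subtype.ext (by simp))
    (fun x y z => Subtype.ext (by simp))
    (fun c x y => Subtype.ext (by simp))
  bracket_mem hx hy := LieSuperalgebra.bracket_mem (L := L) hx hy
  bracket_skew hx hy := Subtype.ext (LieSuperalgebra.bracket_skew (L := L) hx hy)
  bracket_jacobi hx hy hz := Subtype.ext (LieSuperalgebra.bracket_jacobi (L := L) hx hy hz)

/-- A module structure on `V` over the Lie superalgebra `L`: a `ℤ/2`-grading `V = V₀ ⊕ V₁` and a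
linear action compatible with the gradings and with the bracket. -/
structure LieSupermodule (L : Type*) [AddCommGroup L] [Module ℂ L] [LieSuperalgebra L]
    (V : Type*) [AddCommGroup V] [Module ℂ V] where
  part : ZMod 2 → Submodule ℂ V
  isCompl_part : IsCompl (part 0) (part 1)
  act : L →ₗ[ℂ] V →ₗ[ℂ] V
  act_mem : ∀ {a b : ZMod 2} {x : L} {v : V}, x ∈ LieSuperalgebra.part a → v ∈ part b →
    act x v ∈ part (a + b)
  act_bracket : ∀ {a b : ZMod 2} {x y : L}, x ∈ LieSuperalgebra.part a →
    y ∈ LieSuperalgebra.part b → ∀ v : V,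
    act (LieSuperalgebra.bracket x y) v = act x (act y v) - koszulSign a b • act y (act x v)

namespace LieSupermodule

variable {L : Type*} [AddCommGroup L] [Module ℂ L] [LieSuperalgebra L]
  {V : Type*} [AddCommGroup V] [Module ℂ V]

/-- `W` is a submodule: a `ℤ/2`-graded subspace stable under the action. -/
structure IsSubmodule (ρ : LieSupermodule L V) (W : Submodule ℂ V) : Prop where
  graded : W ≤ (W ⊓ ρ.part 0) ⊔ (W ⊓ ρ.part 1)
  act_mem : ∀ (x : L) {w : V}, w ∈ W → ρ.act x w ∈ W

/-- A simple module: nonzero, with no submodules other than zero and the whole module. -/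
structure IsSimple (ρ : LieSupermodule L V) : Prop where
  nontrivial : Nontrivial V
  eq_bot_or_eq_top : ∀ W : Submodule ℂ V, ρ.IsSubmodule W → W = ⊥ ∨ W = ⊤

end LieSupermodule

/-! ### Universal enveloping superalgebras and induced modules -/

/-- The relations `x y - (-1)^{|x||y|} y x = [x, y]` (for homogeneous `x, y`) of the enveloping
algebra. -/
inductive EnvelopingRel (L : Type*) [AddCommGroup L] [Module ℂ L] [LieSuperalgebra L] :
    TensorAlgebra ℂ L → TensorAlgebra ℂ L → Prop
  | of {a b : ZMod 2} {x y : L} (hx : x ∈ LieSuperalgebra.part a)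
      (hy : y ∈ LieSuperalgebra.part b) :
      EnvelopingRel L
        (TensorAlgebra.ι ℂ x * TensorAlgebra.ι ℂ y
          - koszulSign a b • (TensorAlgebra.ι ℂ y * TensorAlgebra.ι ℂ x))
        (TensorAlgebra.ι ℂ (LieSuperalgebra.bracket x y))

/-- The universal enveloping algebra `U(L)` of a Lie superalgebra. -/
def Enveloping (L : Type*) [AddCommGroup L] [Module ℂ L] [LieSuperalgebra L] : Type _ :=
  RingQuot (EnvelopingRel L)

noncomputable instance Enveloping.instRing (L : Type*) [AddCommGroup L] [Module ℂ L]
    [LieSuperalgebra L] : Ring (Enveloping L) :=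
  inferInstanceAs (Ring (RingQuot (EnvelopingRel L)))

noncomputable instance Enveloping.instAlgebra (L : Type*) [AddCommGroup L] [Module ℂ L]
    [LieSuperalgebra L] : Algebra ℂ (Enveloping L) :=
  inferInstanceAs (Algebra ℂ (RingQuot (EnvelopingRel L)))

/-- The quotient map from the tensor algebra of `L` onto `U(L)`. -/
noncomputable def Enveloping.mk (L : Type*) [AddCommGroup L] [Module ℂ L] [LieSuperalgebra L] :
    TensorAlgebra ℂ L →ₐ[ℂ] Enveloping L :=
  RingQuot.mkAlgHom ℂ (EnvelopingRel L)

namespace Enveloping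

variable {L : Type*} [AddCommGroup L] [Module ℂ L] [LieSuperalgebra L]

/-- The canonical map `L → U(L)`. -/
noncomputable def ι : L →ₗ[ℂ] Enveloping L :=
  (mk L).toLinearMap ∘ₗ TensorAlgebra.ι ℂ

theorem ι_bracket {a b : ZMod 2} {x y : L} (hx : x ∈ LieSuperalgebra.part a)
    (hy : y ∈ LieSuperalgebra.part b) :
    ι (LieSuperalgebra.bracket x y) = ι x * ι y - koszulSign a b • (ι y * ι x) := by
  have h : mk L _ = mk L _ := RingQuot.mkAlgHom_rel ℂ (EnvelopingRel.of hx hy)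
  simpa [ι] using h.symm

/-- `IsMonomial a u`: the element `u` is a product `x₁ ⋯ xₙ` of homogeneous elements of `L`, with
`|x₁| + ⋯ + |xₙ| = a`. -/
inductive IsMonomial : ZMod 2 → Enveloping L → Prop
  | one : IsMonomial 0 1
  | ι_mul {a b : ZMod 2} {x : L} {u : Enveloping L} (hx : x ∈ LieSuperalgebra.part a)
      (hu : IsMonomial b u) : IsMonomial (a + b) (ι x * u)

theorem exists_part_add (x : L) : ∃ y ∈ LieSuperalgebra.part (L := L) 0,
    ∃ z ∈ LieSuperalgebra.part (L := L) 1, y + z = x :=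
  Submodule.mem_sup.1 (by rw [LieSuperalgebra.isCompl_part.sup_eq_top]; trivial)

theorem span_isMonomial :
    Submodule.span ℂ {u : Enveloping L | ∃ a, IsMonomial a u} = ⊤ := by
  set S := Submodule.span ℂ {u : Enveloping L | ∃ a, IsMonomial a u} with hS
  have key : ∀ t : TensorAlgebra ℂ L, ∀ u ∈ S, mk L t * u ∈ S := by
    intro t
    induction t using TensorAlgebra.induction with
    | algebraMap r =>
      intro u hu
      rw [AlgHom.commutes, ← Algebra.smul_def]
      exact S.smul_mem r hu
    | ι x =>
      intro u hu
      change ι x * u ∈ S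
      induction hu using Submodule.span_induction with
      | mem u hu =>
        obtain ⟨b, hb⟩ := hu
        obtain ⟨y, hy, z, hz, rfl⟩ := exists_part_add x
        rw [map_add, add_mul]
        exact S.add_mem (Submodule.subset_span ⟨_, .ι_mul hy hb⟩)
          (Submodule.subset_span ⟨_, .ι_mul hz hb⟩)
      | zero => simp
      | add u v _ _ hu hv => rw [mul_add]; exact S.add_mem hu hv
      | smul c u _ hu => rw [mul_smul_comm]; exact S.smul_mem c hu
    | mul s t hs ht =>
      intro u hu
      rw [map_mul, mul_assoc]
      exact hs _ (ht _ hu)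
    | add s t hs ht =>
      intro u hu
      rw [map_add, add_mul]
      exact S.add_mem (hs _ hu) (ht _ hu)
  rw [eq_top_iff]
  intro u _
  obtain ⟨t, rfl⟩ : ∃ t, mk L t = u := RingQuot.mkAlgHom_surjective ℂ (EnvelopingRel L) u
  simpa using key t 1 (Submodule.subset_span ⟨0, .one⟩)

end Enveloping

/-- The parity operator of a decomposition `V = V₀ ⊕ V₁`: it is `1` on `V₀` and `-1` on `V₁`. -/
noncomputable def parityMap {V : Type*} [AddCommGroup V] [Module ℂ V]
    {p : ZMod 2 → Submodule ℂ V} (hp : IsCompl (p 0) (p 1)) : V →ₗ[ℂ] V :=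
  LinearMap.ofIsCompl hp (p 0).subtype (-(p 1).subtype)

theorem parityMap_apply {V : Type*} [AddCommGroup V] [Module ℂ V]
    {p : ZMod 2 → Submodule ℂ V} (hp : IsCompl (p 0) (p 1)) {a : ZMod 2} {v : V} (hv : v ∈ p a) :
    parityMap hp v = (-1 : ℂ) ^ a.val • v := by
  fin_cases a
  · have := LinearMap.ofIsCompl_apply_left hp (φ := (p 0).subtype) (ψ := -(p 1).subtype) ⟨v, hv⟩
    simpa [parityMap, ZMod.val] using this
  · have := LinearMap.ofIsCompl_apply_right hp (φ := (p 0).subtype) (ψ := -(p 1).subtype) ⟨v, hv⟩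
    simpa [parityMap, ZMod.val] using this

theorem neg_one_pow_val_add (a b : ZMod 2) :
    (-1 : ℂ) ^ (a + b).val = (-1) ^ a.val * (-1) ^ b.val := by
  have h : (1 + 1 : ZMod 2) = 0 := rfl
  have h' : ∀ c : ZMod 2, c = 0 ∨ c = 1 := by decide
  rcases h' a with rfl | rfl <;> rcases h' b with rfl | rfl <;> simp [h, ZMod.val_one]

namespace Enveloping

variable {L : Type*} [AddCommGroup L] [Module ℂ L] [LieSuperalgebra L]

/-- The parity automorphism of `U(L)`. -/
noncomputable def parityHom : Enveloping L →ₐ[ℂ] Enveloping L :=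
  RingQuot.liftAlgHom ℂ ⟨TensorAlgebra.lift ℂ
    (ι ∘ₗ parityMap (LieSuperalgebra.isCompl_part (L := L))), by
      rintro _ _ ⟨hx, hy⟩
      simp [parityMap_apply _ hx, parityMap_apply _ hy,
        parityMap_apply _ (LieSuperalgebra.bracket_mem hx hy), ι_bracket hx hy,
        neg_one_pow_val_add, smul_sub, smul_smul]
      ring_nf⟩

theorem parityHom_ι (x : L) :
    parityHom (ι x) = ι (parityMap (LieSuperalgebra.isCompl_part (L := L)) x) := by
  have h := RingQuot.liftAlgHom_mkAlgHom_apply ℂ (A := TensorAlgebra ℂ L)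
    (s := EnvelopingRel L) (B := Enveloping L)
  refine (h _ _ _).trans ?_
  simp

theorem IsMonomial.parityHom_eq {a : ZMod 2} {u : Enveloping L} (hu : IsMonomial a u) :
    parityHom u = (-1 : ℂ) ^ a.val • u := by
  induction hu with
  | one => simp
  | ι_mul hx _ ih =>
    rw [map_mul, ih, parityHom_ι, parityMap_apply _ hx, neg_one_pow_val_add]
    simp [smul_smul, mul_comm]

end Enveloping

namespace LieSupermodule

variable {L : Type*} [AddCommGroup L] [Module ℂ L] [LieSuperalgebra L]
  {h : LieSuperSubalgebra L} {V : Type*} [AddCommGroup V] [Module ℂ V]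

/-- The subspace of `U(L) ⊗ V` spanned by all `u x ⊗ v - u ⊗ x v` with `u ∈ U(L)`, `x ∈ h` and
`v ∈ V`. -/
noncomputable def indRel (ρ : LieSupermodule h.carrier V) :
    Submodule ℂ (Enveloping L ⊗[ℂ] V) :=
  Submodule.span ℂ {z | ∃ (u : Enveloping L) (x : h.carrier) (v : V),
    z = (u * Enveloping.ι x.1) ⊗ₜ[ℂ] v - u ⊗ₜ[ℂ] ρ.act x v}

/-- The underlying space `U(L) ⊗_{U(h)} V` of the induced module. (The subalgebra `h` generates
`U(h)`, so it is enough to move elements of `h` across the tensor sign.) -/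
abbrev IndSpace (ρ : LieSupermodule h.carrier V) : Type _ :=
  (Enveloping L ⊗[ℂ] V) ⧸ ρ.indRel

/-- The class of `u ⊗ v` in `U(L) ⊗_{U(h)} V`. -/
noncomputable def indMk (ρ : LieSupermodule h.carrier V) (u : Enveloping L) (v : V) :
    ρ.IndSpace :=
  Submodule.Quotient.mk (u ⊗ₜ[ℂ] v)

theorem ind_hom_ext (ρ : LieSupermodule h.carrier V) {W : Type*} [AddCommGroup W] [Module ℂ W]
    {f g : ρ.IndSpace →ₗ[ℂ] W} (H : ∀ u v, f (ρ.indMk u v) = g (ρ.indMk u v)) : f = g := by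
  apply Submodule.linearMap_qext
  apply TensorProduct.ext'
  exact H

/-- Left multiplication by `a ∈ U(L)` on `U(L) ⊗_{U(h)} V`. -/
noncomputable def indMul (ρ : LieSupermodule h.carrier V) (a : Enveloping L) :
    ρ.IndSpace →ₗ[ℂ] ρ.IndSpace :=
  Submodule.mapQ _ _ (LinearMap.rTensor V (LinearMap.mulLeft ℂ a)) (by
    rw [indRel, Submodule.span_le]
    rintro _ ⟨u, x, v, rfl⟩
    refine Submodule.subset_span ⟨a * u, x, v, ?_⟩
    simp [mul_assoc])

@[simp] theorem indMul_indMk (ρ : LieSupermodule h.carrier V) (a u : Enveloping L) (v : V) :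
    ρ.indMul a (ρ.indMk u v) = ρ.indMk (a * u) v := by
  simp [indMul, indMk]

theorem indMk_add_left (ρ : LieSupermodule h.carrier V) (u u' : Enveloping L) (v : V) :
    ρ.indMk (u + u') v = ρ.indMk u v + ρ.indMk u' v := by
  simp [indMk, TensorProduct.add_tmul]

theorem indMk_sub_left (ρ : LieSupermodule h.carrier V) (u u' : Enveloping L) (v : V) :
    ρ.indMk (u - u') v = ρ.indMk u v - ρ.indMk u' v := by
  simp [indMk, TensorProduct.sub_tmul]

theorem indMk_add_right (ρ : LieSupermodule h.carrier V) (u : Enveloping L) (v v' : V) :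
    ρ.indMk u (v + v') = ρ.indMk u v + ρ.indMk u v' := by
  simp [indMk, TensorProduct.tmul_add]

theorem indMk_smul_left (ρ : LieSupermodule h.carrier V) (c : ℂ) (u : Enveloping L) (v : V) :
    ρ.indMk (c • u) v = c • ρ.indMk u v := by
  rw [indMk, ← TensorProduct.smul_tmul']
  rfl

theorem indMk_smul_right (ρ : LieSupermodule h.carrier V) (c : ℂ) (u : Enveloping L) (v : V) :
    ρ.indMk u (c • v) = c • ρ.indMk u v := by
  simp [indMk]

/-- The homogeneous parts of the induced module: `x₁ ⋯ xₙ ⊗ v`, with `x₁, …, xₙ, v` homogeneous,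
has parity `|x₁| + ⋯ + |xₙ| + |v|`. -/
noncomputable def indPart (ρ : LieSupermodule h.carrier V) (a : ZMod 2) :
    Submodule ℂ ρ.IndSpace :=
  Submodule.span ℂ {z | ∃ (b c : ZMod 2) (u : Enveloping L) (v : V),
    Enveloping.IsMonomial b u ∧ v ∈ ρ.part c ∧ b + c = a ∧ z = ρ.indMk u v}

/-- The parity operator of the induced module. -/
noncomputable def indParity (ρ : LieSupermodule h.carrier V) :
    ρ.IndSpace →ₗ[ℂ] ρ.IndSpace :=
  Submodule.mapQ _ _
    (TensorProduct.map Enveloping.parityHom.toLinearMap (parityMap ρ.isCompl_part)) (by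
    rw [indRel, Submodule.span_le]
    rintro _ ⟨u, x, v, rfl⟩
    refine Submodule.subset_span
      ⟨Enveloping.parityHom u, parityMap LieSuperalgebra.isCompl_part x,
        parityMap ρ.isCompl_part v, ?_⟩
    obtain ⟨y, hy, z, hz, rfl⟩ := Enveloping.exists_part_add x
    obtain ⟨v, hv, w, hw, rfl⟩ : ∃ v' ∈ ρ.part 0, ∃ w ∈ ρ.part 1, v' + w = v :=
      Submodule.mem_sup.1 (by rw [ρ.isCompl_part.sup_eq_top]; trivial)
    have e : ∀ {a : ZMod 2} {y : h.carrier}, y ∈ LieSuperalgebra.part a →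
        parityMap (LieSuperalgebra.isCompl_part (L := L)) y.1 = (-1 : ℂ) ^ a.val • y.1 :=
      fun hy => parityMap_apply _ hy
    simp only [TensorProduct.map_tmul, AlgHom.toLinearMap_apply, map_mul, map_sub, map_add,
      Enveloping.parityHom_ι, Submodule.coe_add, LinearMap.add_apply, e hy, e hz,
      parityMap_apply _ hy, parityMap_apply _ hz, parityMap_apply ρ.isCompl_part hv,
      parityMap_apply ρ.isCompl_part hw, parityMap_apply ρ.isCompl_part (ρ.act_mem hy hv),
      parityMap_apply ρ.isCompl_part (ρ.act_mem hz hv),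
      parityMap_apply ρ.isCompl_part (ρ.act_mem hy hw),
      parityMap_apply ρ.isCompl_part (ρ.act_mem hz hw), neg_one_pow_val_add, map_smul,
      LinearMap.smul_apply, Submodule.coe_smul]
    simp only [smul_add, smul_smul,
      mul_comm ((-1 : ℂ) ^ (1 : ZMod 2).val) ((-1 : ℂ) ^ (0 : ZMod 2).val)])

theorem indParity_apply (ρ : LieSupermodule h.carrier V) {a : ZMod 2} {z : ρ.IndSpace}
    (hz : z ∈ ρ.indPart a) : ρ.indParity z = (-1 : ℂ) ^ a.val • z := by
  induction hz using Submodule.span_induction with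
  | mem z hz =>
    obtain ⟨b, c, u, v, hu, hv, rfl, rfl⟩ := hz
    have : ρ.indParity (ρ.indMk u v) =
        ρ.indMk (Enveloping.parityHom u) (parityMap ρ.isCompl_part v) := by
      simp [indParity, indMk]
    rw [this, hu.parityHom_eq, parityMap_apply _ hv, indMk_smul_left, indMk_smul_right,
      smul_smul, neg_one_pow_val_add]
  | zero => simp
  | add u v _ _ hu hv => rw [map_add, hu, hv, smul_add]
  | smul c u _ hu => rw [map_smul, hu, smul_comm]

theorem isCompl_indPart (ρ : LieSupermodule h.carrier V) :
    IsCompl (ρ.indPart 0) (ρ.indPart 1) := by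
  constructor
  · rw [Submodule.disjoint_def]
    intro z h0 h1
    have e0 := ρ.indParity_apply h0
    have e1 := ρ.indParity_apply h1
    rw [e0] at e1
    simp [ZMod.val_one] at e1
    have e2 : (2 : ℂ) • z = 0 := by rw [two_smul]; nth_rewrite 1 [e1]; simp
    exact (smul_eq_zero.1 e2).resolve_left two_ne_zero
  · rw [codisjoint_iff, eq_top_iff]
    have hmono : ∀ {b c : ZMod 2} {u : Enveloping L} {v : V}, Enveloping.IsMonomial b u →
        v ∈ ρ.part c → ρ.indMk u v ∈ ρ.indPart 0 ⊔ ρ.indPart 1 := by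
      intro b c u v hu hv
      have hle : ρ.indPart (b + c) ≤ ρ.indPart 0 ⊔ ρ.indPart 1 := by
        generalize b + c = a
        fin_cases a
        · exact le_sup_left
        · exact le_sup_right
      exact hle (Submodule.subset_span ⟨b, c, u, v, hu, hv, rfl, rfl⟩)
    have hall : ∀ (u : Enveloping L) (v : V), ρ.indMk u v ∈ ρ.indPart 0 ⊔ ρ.indPart 1 := by
      intro u v
      have hu : u ∈ Submodule.span ℂ {u : Enveloping L | ∃ a, Enveloping.IsMonomial a u} := by
        rw [Enveloping.span_isMonomial]; trivial
      induction hu using Submodule.span_induction with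
      | mem u hu =>
        obtain ⟨b, hb⟩ := hu
        obtain ⟨v, hv, w, hw, rfl⟩ : ∃ v' ∈ ρ.part 0, ∃ w ∈ ρ.part 1, v' + w = v :=
          Submodule.mem_sup.1 (by rw [ρ.isCompl_part.sup_eq_top]; trivial)
        rw [indMk_add_right]
        exact Submodule.add_mem _ (hmono hb hv) (hmono hb hw)
      | zero => simp [indMk]
      | add u u' _ _ hu hu' => rw [indMk_add_left]; exact Submodule.add_mem _ hu hu'
      | smul c u _ hu => rw [indMk_smul_left]; exact Submodule.smul_mem _ c hu
    rintro z -
    obtain ⟨z, rfl⟩ := Submodule.Quotient.mk_surjective _ z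
    induction z using TensorProduct.induction_on with
    | zero => simp
    | tmul u v => exact hall u v
    | add x y hx hy => rw [Submodule.Quotient.mk_add]; exact Submodule.add_mem _ hx hy

/-- The induced module `Ind_h^L V = U(L) ⊗_{U(h)} V`, on which `x ∈ L` acts by
`x (u ⊗ v) = x u ⊗ v`. -/
noncomputable def ind (ρ : LieSupermodule h.carrier V) : LieSupermodule L ρ.IndSpace where
  part := ρ.indPart
  isCompl_part := ρ.isCompl_indPart
  act :=
    { toFun := fun x => ρ.indMul (Enveloping.ι x)
      map_add' := fun x y => ρ.ind_hom_ext fun u v => by simp [add_mul, indMk_add_left]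
      map_smul' := fun c x => ρ.ind_hom_ext fun u v => by simp [indMk_smul_left] }
  act_mem := by
    intro a b x z hx hz
    change ρ.indMul (Enveloping.ι x) z ∈ _
    induction hz using Submodule.span_induction with
    | mem z hz =>
      obtain ⟨b, c, u, v, hu, hv, rfl, rfl⟩ := hz
      rw [indMul_indMk]
      exact Submodule.subset_span ⟨a + b, c, _, v, .ι_mul hx hu, hv, add_assoc _ _ _, rfl⟩
    | zero => simp
    | add u v _ _ hu hv => rw [map_add]; exact Submodule.add_mem _ hu hv
    | smul c u _ hu => rw [map_smul]; exact Submodule.smul_mem _ c hu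
  act_bracket := by
    intro a b x y hx hy z
    have : ρ.indMul (Enveloping.ι (LieSuperalgebra.bracket x y)) =
        ρ.indMul (Enveloping.ι x) ∘ₗ ρ.indMul (Enveloping.ι y)
          - koszulSign a b • (ρ.indMul (Enveloping.ι y) ∘ₗ ρ.indMul (Enveloping.ι x)) :=
      ρ.ind_hom_ext fun u v => by
        simp [Enveloping.ι_bracket hx hy, sub_mul, indMk_sub_left, indMk_smul_left, mul_assoc]
    exact LinearMap.congr_fun this z

end LieSupermodule

/-! ### The N = 1 BMS superalgebra -/

/-- Labels of the standard basis of the N = 1 BMS superalgebra: `L n`, `M n` (`n ∈ ℤ`), `Q k`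
(`k ∈ ℤ`) standing for the odd generator `Q_{k - 1/2}`, and the central elements `c₁`, `c₂`. -/
inductive BMSIndex
  | L (n : ℤ)
  | M (n : ℤ)
  | Q (k : ℤ)
  | c₁
  | c₂

/-- The underlying space of the N = 1 BMS superalgebra. -/
abbrev BMS : Type := BMSIndex →₀ ℂ

namespace BMS

/-- The basis vector with a given label. -/
noncomputable def e (i : BMSIndex) : BMS := Finsupp.single i 1

/-- The parity of a basis vector. -/
def parity : BMSIndex → ZMod 2
  | .Q _ => 1
  | _ => 0

/-- `δ n` is `1` if `n = 0` and `0` otherwise. -/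
def δ (n : ℤ) : ℂ := if n = 0 then 1 else 0

/-- The brackets of basis vectors. With `r = k - 1/2` and `s = l - 1/2` the case of two `Q`s is
`[Q_r, Q_s] = 2 M_{r+s} + (1/3) δ_{r+s,0} (r² - 1/4) c₂`. -/
noncomputable def basisBracket : BMSIndex → BMSIndex → BMS
  | .L m, .L n => ((m : ℂ) - n) • e (.L (m + n)) + (δ (m + n) * ((m : ℂ) ^ 3 - m) / 12) • e .c₁
  | .L m, .M n => ((m : ℂ) - n) • e (.M (m + n)) + (δ (m + n) * ((m : ℂ) ^ 3 - m) / 12) • e .c₂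
  | .M m, .L n => ((m : ℂ) - n) • e (.M (m + n)) + (δ (m + n) * ((m : ℂ) ^ 3 - m) / 12) • e .c₂
  | .L m, .Q k => ((m : ℂ) / 2 - ((k : ℂ) - 1 / 2)) • e (.Q (m + k))
  | .Q k, .L m => (-((m : ℂ) / 2 - ((k : ℂ) - 1 / 2))) • e (.Q (m + k))
  | .Q k, .Q l => (2 : ℂ) • e (.M (k + l - 1))
      + (δ (k + l - 1) * (((k : ℂ) - 1 / 2) ^ 2 - 1 / 4) / 3) • e .c₂
  | _, _ => 0

/-- The bilinear extension of the bracket of basis vectors. -/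
noncomputable def bracketMap : BMS →ₗ[ℂ] BMS →ₗ[ℂ] BMS :=
  Finsupp.linearCombination ℂ fun i => Finsupp.linearCombination ℂ fun j => basisBracket i j

@[simp] theorem bracketMap_e (i j : BMSIndex) : bracketMap (e i) (e j) = basisBracket i j := by
  simp [bracketMap, e]

/-- The even part is spanned by all `L n`, `M n`, `c₁`, `c₂`, the odd part by all `Q k`. -/
noncomputable def gradedPart (a : ZMod 2) : Submodule ℂ BMS :=
  Finsupp.supported ℂ ℂ {i | parity i = a}

theorem e_mem_gradedPart (i : BMSIndex) {a : ZMod 2} (h : parity i = a) : e i ∈ gradedPart a :=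
  Finsupp.single_mem_supported ℂ 1 h

theorem gradedPart_induction {a : ZMod 2} {P : BMS → Prop} {x : BMS} (hx : x ∈ gradedPart a)
    (hb : ∀ i, parity i = a → P (e i)) (h0 : P 0) (ha : ∀ x y, P x → P y → P (x + y))
    (hs : ∀ (c : ℂ) x, P x → P (c • x)) : P x := by
  rw [gradedPart, Finsupp.supported_eq_span_single] at hx
  induction hx using Submodule.span_induction with
  | mem x hx => obtain ⟨i, hi, rfl⟩ := hx; exact hb i hi
  | zero => exact h0
  | add x y _ _ hx hy => exact ha x y hx hy
  | smul c x _ hx => exact hs c x hx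

theorem basisBracket_mem (i j : BMSIndex) :
    basisBracket i j ∈ gradedPart (parity i + parity j) := by
  have he : ∀ (c : ℂ) (i : BMSIndex) {a : ZMod 2}, parity i = a → c • e i ∈ gradedPart a :=
    fun c i a h => Submodule.smul_mem _ c (e_mem_gradedPart i h)
  rcases i with m | m | m | _ | _ <;> rcases j with n | n | n | _ | _
  case L.L => exact Submodule.add_mem _ (he _ _ rfl) (he _ _ rfl)
  case L.M => exact Submodule.add_mem _ (he _ _ rfl) (he _ _ rfl)
  case M.L => exact Submodule.add_mem _ (he _ _ rfl) (he _ _ rfl)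
  case Q.Q => exact Submodule.add_mem _ (he _ _ rfl) (he _ _ rfl)
  case L.Q => exact he _ _ rfl
  case Q.L => exact he _ _ rfl
  all_goals exact Submodule.zero_mem _

theorem basisBracket_skew (i j : BMSIndex) :
    basisBracket i j = -(koszulSign (parity i) (parity j) • basisBracket j i) := by
  rcases i with m | m | m | _ | _ <;> rcases j with n | n | n | _ | _ <;>
    simp only [basisBracket, koszulSign, parity, smul_zero, neg_zero, zero_ne_one,
      and_self, and_true, and_false, if_true, if_false, one_smul]
  case L.Q => module
  case Q.L => module
  all_goals
    rw [add_comm n m]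
    simp only [δ]
    split_ifs with hs
  all_goals
    first
    | module
    | (obtain rfl : n = -m := by omega
       push_cast
       module)
    | (obtain rfl : n = 1 - m := by omega
       push_cast
       module)

set_option maxHeartbeats 1000000 in
theorem basisBracket_jacobi (i j k : BMSIndex) :
    bracketMap (e i) (basisBracket j k) = bracketMap (basisBracket i j) (e k) +
      koszulSign (parity i) (parity j) • bracketMap (e j) (basisBracket i k) := by
  rcases i with m | m | m | _ | _ <;> rcases j with n | n | n | _ | _ <;>
    rcases k with k | k | k | _ | _ <;>
    simp only [basisBracket, koszulSign, parity, smul_zero, zero_ne_one,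
      and_self, and_true, and_false, if_true, if_false, one_smul, map_add,
      map_smul, map_zero, LinearMap.add_apply, LinearMap.smul_apply, LinearMap.zero_apply,
      bracketMap_e, add_zero]
  all_goals
    push_cast
    simp only [Int.sub_eq_add_neg, Int.add_assoc, Int.add_comm, Int.add_left_comm]
  case L.L.Q | L.Q.L | Q.L.L => module
  all_goals
    simp only [δ]
    split_ifs with hs
  all_goals
    first
    | module
    | (obtain rfl : k = -m - n := by omega
       push_cast
       module)
    | (obtain rfl : k = 1 - m - n := by omega
       push_cast
       module)

noncomputable instance instLieSuperalgebra : LieSuperalgebra BMS where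
  part := gradedPart
  isCompl_part := by
    constructor
    · refine Finsupp.disjoint_supported_supported (Set.disjoint_left.2 fun i h0 h1 => ?_)
      exact zero_ne_one (α := ZMod 2) (h0.symm.trans h1)
    · rw [codisjoint_iff, gradedPart, gradedPart, ← Finsupp.supported_union, eq_top_iff]
      intro x _
      refine (Finsupp.mem_supported _ _).2 fun i _ => ?_
      rcases i with m | m | m | _ | _ <;> simp [parity]
  bracket := bracketMap
  bracket_mem := by
    intro a b x y hx hy
    refine gradedPart_induction (P := fun x => bracketMap x y ∈ gradedPart (a + b)) hx
      (fun i hi => ?_) (by simp)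
      (fun x x' h h' => by simpa using Submodule.add_mem _ h h')
      (fun c x h => by simpa using Submodule.smul_mem _ c h)
    refine gradedPart_induction (P := fun y => bracketMap (e i) y ∈ gradedPart (a + b)) hy
      (fun j hj => ?_) (by simp)
      (fun x x' h h' => by simpa using Submodule.add_mem _ h h')
      (fun c x h => by simpa using Submodule.smul_mem _ c h)
    subst hi hj
    simpa using basisBracket_mem i j
  bracket_skew := by
    intro a b x y hx hy
    refine gradedPart_induction
      (P := fun x => bracketMap x y = -(koszulSign a b • bracketMap y x)) hx
      (fun i hi => ?_) (by simp)
      (fun x x' h h' => by simp only [map_add, LinearMap.add_apply, h, h']; module)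
      (fun c x h => by simp only [map_smul, LinearMap.smul_apply, h]; module)
    refine gradedPart_induction
      (P := fun y => bracketMap (e i) y = -(koszulSign a b • bracketMap y (e i))) hy
      (fun j hj => ?_) (by simp)
      (fun x x' h h' => by simp only [map_add, LinearMap.add_apply, h, h']; module)
      (fun c x h => by simp only [map_smul, LinearMap.smul_apply, h]; module)
    subst hi hj
    simpa using basisBracket_skew i j
  bracket_jacobi := by
    intro a b c x y z hx hy hz
    refine gradedPart_induction
      (P := fun x => bracketMap x (bracketMap y z) = bracketMap (bracketMap x y) z +
        koszulSign a b • bracketMap y (bracketMap x z)) hx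
      (fun i hi => ?_) (by simp)
      (fun x x' h h' => by simp only [map_add, LinearMap.add_apply, h, h']; module)
      (fun c x h => by simp only [map_smul, LinearMap.smul_apply, h]; module)
    refine gradedPart_induction
      (P := fun y => bracketMap (e i) (bracketMap y z) = bracketMap (bracketMap (e i) y) z +
        koszulSign a b • bracketMap y (bracketMap (e i) z)) hy
      (fun j hj => ?_) (by simp)
      (fun x x' h h' => by simp only [map_add, LinearMap.add_apply, h, h']; module)
      (fun c x h => by simp only [map_smul, LinearMap.smul_apply, h]; module)
    refine gradedPart_induction
      (P := fun z => bracketMap (e i) (bracketMap (e j) z) =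
        bracketMap (bracketMap (e i) (e j)) z +
          koszulSign a b • bracketMap (e j) (bracketMap (e i) z)) hz
      (fun k hk => ?_) (by simp)
      (fun x x' h h' => by simp only [map_add, h, h']; module)
      (fun c x h => by simp only [map_smul, h]; module)
    subst hi hj hk
    simpa using basisBracket_jacobi i j k

/-- The labels of the basis `L i` (`i ≥ 0`), `M j` (`j ≥ -q`), `Q_{k - 1/2}` (`k ≥ 1`), `c₁`, `c₂`
of the subalgebra `𝔤^{(0,-q)}`. -/
def subIndex (q : ℕ) : BMSIndex → Prop
  | .L i => 0 ≤ i
  | .M j => -(q : ℤ) ≤ j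
  | .Q k => 1 ≤ k
  | .c₁ => True
  | .c₂ => True

theorem basisBracket_mem_sub (q : ℕ) {i j : BMSIndex} (hi : subIndex q i) (hj : subIndex q j) :
    basisBracket i j ∈ Finsupp.supported ℂ ℂ {i | subIndex q i} := by
  have he : ∀ (c : ℂ) (i : BMSIndex), subIndex q i →
      c • e i ∈ Finsupp.supported ℂ ℂ {i | subIndex q i} :=
    fun c i h => Submodule.smul_mem _ c (Finsupp.single_mem_supported ℂ 1 h)
  rcases i with m | m | m | _ | _ <;> rcases j with n | n | n | _ | _
  all_goals simp only [subIndex] at hi hj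
  case L.L =>
    exact Submodule.add_mem _ (he _ _ (by simp only [subIndex]; omega)) (he _ _ trivial)
  case L.M =>
    exact Submodule.add_mem _ (he _ _ (by simp only [subIndex]; omega)) (he _ _ trivial)
  case M.L =>
    exact Submodule.add_mem _ (he _ _ (by simp only [subIndex]; omega)) (he _ _ trivial)
  case Q.Q =>
    exact Submodule.add_mem _ (he _ _ (by simp only [subIndex]; omega)) (he _ _ trivial)
  case L.Q => exact he _ _ (by simp only [subIndex]; omega)
  case Q.L => exact he _ _ (by simp only [subIndex]; omega)
  all_goals exact Submodule.zero_mem _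

theorem sub_induction {q : ℕ} {P : BMS → Prop} {x : BMS}
    (hx : x ∈ Finsupp.supported ℂ ℂ {i | subIndex q i})
    (hb : ∀ i, subIndex q i → P (e i)) (h0 : P 0) (ha : ∀ x y, P x → P y → P (x + y))
    (hs : ∀ (c : ℂ) x, P x → P (c • x)) : P x := by
  rw [Finsupp.supported_eq_span_single] at hx
  induction hx using Submodule.span_induction with
  | mem x hx => obtain ⟨i, hi, rfl⟩ := hx; exact hb i hi
  | zero => exact h0
  | add x y _ _ hx hy => exact ha x y hx hy
  | smul c x _ hx => exact hs c x hx

/-- The subalgebra `𝔤^{(0,-q)}` spanned by `L i` (`i ≥ 0`), `M j` (`j ≥ -q`), `Q_{k - 1/2}`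
(`k ≥ 1`), `c₁` and `c₂`. -/
noncomputable def sub (q : ℕ) : LieSuperSubalgebra BMS where
  carrier := Finsupp.supported ℂ ℂ {i | subIndex q i}
  graded := by
    intro x hx
    refine sub_induction hx (fun i hi => ?_) (Submodule.zero_mem _)
      (fun x y => Submodule.add_mem _) (fun c x => Submodule.smul_mem _ c)
    have hi' : e i ∈ Finsupp.supported ℂ ℂ {i | subIndex q i} :=
      Finsupp.single_mem_supported ℂ 1 hi
    have h' : ∀ c : ZMod 2, c = 0 ∨ c = 1 := by decide
    rcases h' (parity i) with h | h
    · exact Submodule.mem_sup_left ⟨hi', e_mem_gradedPart i h⟩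
    · exact Submodule.mem_sup_right ⟨hi', e_mem_gradedPart i h⟩
  bracket_mem := by
    intro x y hx hy
    refine sub_induction
      (P := fun x => bracketMap x y ∈ Finsupp.supported ℂ ℂ {i | subIndex q i}) hx
      (fun i hi => ?_) (by simp)
      (fun x x' h h' => by rw [map_add]; exact Submodule.add_mem _ h h')
      (fun c x h => by rw [map_smul]; exact Submodule.smul_mem _ c h)
    refine sub_induction
      (P := fun y => bracketMap (e i) y ∈ Finsupp.supported ℂ ℂ {i | subIndex q i}) hy
      (fun j hj => ?_) (by simp)
      (fun x x' h h' => by rw [map_add]; exact Submodule.add_mem _ h h')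
      (fun c x h => by rw [map_smul]; exact Submodule.smul_mem _ c h)
    rw [bracketMap_e]
    exact basisBracket_mem_sub q hi hj

/-- The basis vector of `𝔤^{(0,-q)}` with a given label. -/
noncomputable def subE (q : ℕ) (i : BMSIndex) (hi : subIndex q i) : (sub q).carrier :=
  ⟨e i, Finsupp.single_mem_supported ℂ 1 hi⟩

/-- `L_i ∈ 𝔤^{(0,-q)}` for `i ≥ 0`. -/
noncomputable def subL (q i : ℕ) : (sub q).carrier :=
  subE q (.L i) (Int.natCast_nonneg i)

/-- `M_j ∈ 𝔤^{(0,-q)}` for `j ≥ 0`. -/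
noncomputable def subM (q j : ℕ) : (sub q).carrier :=
  subE q (.M j) (show -(q : ℤ) ≤ j by omega)

/-- `Q_{k - 1/2} ∈ 𝔤^{(0,-q)}` for `k ≥ 1`. -/
noncomputable def subQ (q k : ℕ) (hk : 1 ≤ k) : (sub q).carrier :=
  subE q (.Q k) (show (1 : ℤ) ≤ k by omega)

/-- `c₁ ∈ 𝔤^{(0,-q)}`. -/
noncomputable def subC₁ (q : ℕ) : (sub q).carrier := subE q .c₁ trivial

/-- `c₂ ∈ 𝔤^{(0,-q)}`. -/
noncomputable def subC₂ (q : ℕ) : (sub q).carrier := subE q .c₂ trivial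

/-- A module over the N = 1 BMS superalgebra is smooth if every vector is killed by `L_i`, `M_i`
and `Q_{i - 1/2}` for all sufficiently large `i`. -/
def IsSmooth {W : Type*} [AddCommGroup W] [Module ℂ W] (ρ : LieSupermodule BMS W) : Prop :=
  ∀ w : W, ∃ N : ℤ, ∀ i : ℤ, N ≤ i →
    ρ.act (e (.L i)) w = 0 ∧ ρ.act (e (.M i)) w = 0 ∧ ρ.act (e (.Q i)) w = 0

/-- The module has central charge `(z₁, z₂)`: the elements `c₁`, `c₂` act as these scalars. -/
def HasCentralCharge {W : Type*} [AddCommGroup W] [Module ℂ W] (ρ : LieSupermodule BMS W)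
    (z₁ z₂ : ℂ) : Prop :=
  ∀ w : W, ρ.act (e .c₁) w = z₁ • w ∧ ρ.act (e .c₂) w = z₂ • w

/-- Central charge of a `𝔤^{(0,-q)}`-module. -/
def SubHasCentralCharge {q : ℕ} {V : Type*} [AddCommGroup V] [Module ℂ V]
    (ρ : LieSupermodule (sub q).carrier V) (z₁ z₂ : ℂ) : Prop :=
  ∀ v : V, ρ.act (subC₁ q) v = z₁ • v ∧ ρ.act (subC₂ q) v = z₂ • v

end BMS

/-! Write Z_n = M_t + δ_{t,0} (n² - 1)/24 · c₂. Hypothesis (a) makes Z_n injective on V for every n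
≠ 0, and the brackets of opposite generators reproduce these operators: [L_{t+n}, M_{-n}] = (t + 2n)
Z_n, [Q_{t+r}, Q_{-r}] = 2 Z_{2r}, [M_{t+n}, L_{-n}] = (t + 2n) Z_n for n, r > 0.

Part (i). For i > t + q + 2, the bracket [L_{i-1}, Q_{1/2}] is a nonzero multiple of Q_{i-1/2}, and
both products vanish because L_{i-1} kills V, so Q_{i-1/2} kills V. For i > t the operators
Q_{i-1/2} anticommute on V with every Q_{k-1/2}, k ≥ 1, and square to zero, since the brackets are
multiples of M's that kill V. Lowering the bound one step at a time therefore produces a nonzero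
vector killed by all of them. The set of such vectors is a graded submodule, hence all of V
(`kerQ_eq_top`).

Simplicity. It is enough that every nonzero submodule of the induced module meets 1 ⊗ V in a nonzero
vector and that v ↦ 1 ⊗ v is injective (`isSimple_ind`). For the first point, negative generators
are removed in three layers. Inside the space generated from V by the M's, L_{t+n} acts like Z_n
times differentiation in M_{-n} (`meets_fromM`). When the Q's are added, each new square is an M, so
a new Q occurs at most to the first power and Q_{t+r} removes it (`meets_fromQ`). An arbitrary
vector is a sum of words in negative L's applied to that space; a product of operators M_{t+n},
chosen to match an extremal leading word, removes all L's (`exists_mem_allMQ`). At every stage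
injectivity of Z_n passes from V to the larger space: its kernel there is stable under positive
generators, so if nonzero it would meet V (`zOp_injective`).

This argument uses only that words span, never that they are linearly independent. The independence
of a Poincaré–Birkhoff–Witt theorem is needed only for v ↦ 1 ⊗ v to be injective, and this is proved
by embedding V in some module over the whole algebra (`exists_embedding`). Such modules are built by
coinduction: if two subalgebras H and N have a subalgebra H + N as sum, an H-module V that maps
injectively to an N-module X, compatibly with H ∩ N, embeds in a space of X-valued functions on the
enveloping algebra of H + N (`exists_extension`). This is used twice: to adjoin the negative M's and
Q's, where X comes from a Clifford algebra, and to adjoin the negative L's, where X is a trivial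
module.

Central charge and smoothness hold on the generators 1 ⊗ V and are inherited by everything they
generate. -/

theorem koszulSign_comm (a b : ZMod 2) : koszulSign a b = koszulSign b a := by
  simp only [koszulSign, and_comm]

theorem koszulSign_mul_self (a b : ZMod 2) : koszulSign a b * koszulSign a b = 1 := by
  simp only [koszulSign]; split_ifs <;> norm_num

theorem koszulSign_add_left (a b c : ZMod 2) :
    koszulSign (a + b) c = koszulSign a c * koszulSign b c := by
  have h : (1 + 1 : ZMod 2) = 0 := rfl
  have h' : ∀ c : ZMod 2, c = 0 ∨ c = 1 := by decide
  rcases h' a with rfl | rfl <;> rcases h' b with rfl | rfl <;> rcases h' c with rfl | rfl <;>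
    simp [koszulSign, h]

theorem koszulSign_add_right (a b c : ZMod 2) :
    koszulSign c (a + b) = koszulSign c a * koszulSign c b := by
  rw [koszulSign_comm, koszulSign_add_left, koszulSign_comm a, koszulSign_comm b]

/-! ### Subalgebras spanned by basis vectors, and their representations by operators -/

namespace BMS

/-- The sign in the supercommutator of two basis vectors. -/
def sgn (i j : BMSIndex) : ℂ := koszulSign (parity i) (parity j)

theorem sgn_mul_self (i j : BMSIndex) : sgn i j * sgn i j = 1 := koszulSign_mul_self _ _

theorem sgn_comm (i j : BMSIndex) : sgn i j = sgn j i := koszulSign_comm _ _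

/-- The linear extension to `BMS` of a family indexed by the basis. -/
noncomputable abbrev lin {E : Type*} [AddCommGroup E] [Module ℂ E] (f : BMSIndex → E) :
    BMS →ₗ[ℂ] E :=
  Finsupp.linearCombination ℂ f

theorem lin_e {E : Type*} [AddCommGroup E] [Module ℂ E] (f : BMSIndex → E) (i : BMSIndex) :
    lin f (e i) = f i := by
  simp [lin, e]

theorem supported_induction {p : BMSIndex → Prop} {P : BMS → Prop} {x : BMS}
    (hx : x ∈ Finsupp.supported ℂ ℂ {i | p i})
    (hb : ∀ i, p i → P (e i)) (h0 : P 0) (ha : ∀ x y, P x → P y → P (x + y))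
    (hs : ∀ (c : ℂ) x, P x → P (c • x)) : P x := by
  rw [Finsupp.supported_eq_span_single] at hx
  induction hx using Submodule.span_induction with
  | mem x hx => obtain ⟨i, hi, rfl⟩ := hx; exact hb i hi
  | zero => exact h0
  | add x y _ _ hx hy => exact ha x y hx hy
  | smul c x _ hx => exact hs c x hx

theorem lin_congr {E : Type*} [AddCommGroup E] [Module ℂ E] {f g : BMSIndex → E}
    {p : BMSIndex → Prop} {x : BMS} (hx : x ∈ Finsupp.supported ℂ ℂ {i | p i})
    (h : ∀ i, p i → f i = g i) : lin f x = lin g x :=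
  supported_induction (P := fun x => lin f x = lin g x) hx
    (fun i hi => by rw [lin_e, lin_e, h i hi]) (by simp)
    (fun x y hx hy => by rw [map_add, map_add, hx, hy])
    (fun c x hx => by rw [map_smul, map_smul, hx])

theorem map_lin {E E' : Type*} [AddCommGroup E] [Module ℂ E] [AddCommGroup E'] [Module ℂ E']
    (T : E →ₗ[ℂ] E') (f : BMSIndex → E) (x : BMS) : T (lin f x) = lin (fun i => T (f i)) x := by
  simp only [lin, Finsupp.linearCombination_apply, Finsupp.sum, map_sum, map_smul]

theorem lin_add_fun {E : Type*} [AddCommGroup E] [Module ℂ E] (f g : BMSIndex → E) (x : BMS) :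
    lin (fun i => f i + g i) x = lin f x + lin g x := by
  simp only [lin, Finsupp.linearCombination_apply, Finsupp.sum, smul_add, Finset.sum_add_distrib]

theorem lin_smul_fun {E : Type*} [AddCommGroup E] [Module ℂ E] (c : ℂ) (f : BMSIndex → E)
    (x : BMS) : lin (fun i => c • f i) x = c • lin f x := by
  simp only [lin, Finsupp.linearCombination_apply, Finsupp.sum, Finset.smul_sum]
  exact Finset.sum_congr rfl fun k _ => smul_comm _ _ _

/-- The labels satisfying `G` span a subalgebra. -/
def Closed (G : BMSIndex → Prop) : Prop :=
  ∀ i j, G i → G j → basisBracket i j ∈ Finsupp.supported ℂ ℂ {k | G k}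

/-- The operators `A i`, for `i` in the subalgebra spanned by the labels satisfying `G`, form a
representation of this subalgebra. -/
def RepOn {N : Type*} [AddCommGroup N] [Module ℂ N] (G : BMSIndex → Prop)
    (A : BMSIndex → Module.End ℂ N) : Prop :=
  ∀ i j, G i → G j → A i * A j - sgn i j • (A j * A i) = lin A (basisBracket i j)

theorem basisBracket_mem_and {G : BMSIndex → Prop} (hG : Closed G) {i j : BMSIndex} (hi : G i)
    (hj : G j) : basisBracket i j ∈
      Finsupp.supported ℂ ℂ {k | parity k = parity i + parity j ∧ G k} := by
  rw [Set.ofPred_and, Finsupp.supported_inter]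
  exact ⟨basisBracket_mem i j, hG i j hi hj⟩

theorem closed_true : Closed fun _ => True := by
  intro i j _ _; simp

/-! ### Functions on words: moving a letter to the front of a word -/

section Words

variable {E : Type*} [AddCommGroup E] [Module ℂ E]

/-- Functions on words; the head of a list is the last letter of the word. -/
abbrev WordFun (E : Type*) : Type _ := List BMSIndex → E

/-- The shift `f ↦ (w ↦ f (w c))`. -/
def shift (E : Type*) [AddCommGroup E] [Module ℂ E] (c : BMSIndex) :
    Module.End ℂ (WordFun E) :=
  LinearMap.funLeft ℂ E (List.cons c)

@[simp] theorem shift_apply (c : BMSIndex) (f : WordFun E) (r : List BMSIndex) :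
    shift E c f r = f (c :: r) := rfl

theorem lin_shift_apply (x : BMS) (f : WordFun E) (r : List BMSIndex) :
    lin (shift E) x f r = lin (fun k => f (k :: r)) x :=
  map_lin ((LinearMap.proj r : WordFun E →ₗ[ℂ] E) ∘ₗ LinearMap.applyₗ f) (shift E) x

/-- The value at a word of `pull π x f`. -/
noncomputable def pullAux (π : BMSIndex → Module.End ℂ E) (x : BMSIndex) :
    List BMSIndex → (WordFun E →ₗ[ℂ] E)
  | [] => π x ∘ₗ LinearMap.proj []
  | c :: r => sgn c x • (pullAux π x r ∘ₗ shift E c)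
      + LinearMap.proj r ∘ₗ lin (shift E) (basisBracket c x)

/-- If `f (x w) = π x (f w)` then `pull π x f w` is the value that `f (w x)` has to take. -/
noncomputable def pull (π : BMSIndex → Module.End ℂ E) (x : BMSIndex) :
    Module.End ℂ (WordFun E) :=
  LinearMap.pi (pullAux π x)

variable (π : BMSIndex → Module.End ℂ E)

theorem pull_nil (x : BMSIndex) (f : WordFun E) : pull π x f [] = π x (f []) := rfl

theorem pull_cons (x c : BMSIndex) (f : WordFun E) (r : List BMSIndex) :
    pull π x f (c :: r) = sgn c x • pull π x (shift E c f) r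
      + lin (shift E) (basisBracket c x) f r := rfl

theorem lin_pull_nil (x : BMS) (f : WordFun E) : lin (pull π) x f [] = lin π x (f []) := by
  refine (map_lin ((LinearMap.proj [] : WordFun E →ₗ[ℂ] E) ∘ₗ LinearMap.applyₗ f)
    (pull π) x).trans ?_
  exact (map_lin (LinearMap.applyₗ (f [])) π x).symm

theorem shift_mul_pull (c x : BMSIndex) : shift E c * pull π x =
    sgn c x • (pull π x * shift E c) + lin (shift E) (basisBracket c x) := by
  ext f r
  exact pull_cons π x c f r

theorem lin_shift_mul_pull {a b : ZMod 2} {x y : BMS} (hx : x ∈ gradedPart a)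
    (hy : y ∈ gradedPart b) : lin (shift E) x * lin (pull π) y =
    koszulSign a b • (lin (pull π) y * lin (shift E) x) + lin (shift E) (bracketMap x y) := by
  refine gradedPart_induction (P := fun x => lin (shift E) x * lin (pull π) y =
    koszulSign a b • (lin (pull π) y * lin (shift E) x) + lin (shift E) (bracketMap x y)) hx
      (fun i hi => ?_) (by simp)
      (fun x x' h h' => by
        simp only [map_add, LinearMap.add_apply, add_mul, mul_add, h, h']; module)
      (fun c x h => by
        simp only [map_smul, LinearMap.smul_apply, smul_mul_assoc, mul_smul_comm, h]; module)
  refine gradedPart_induction (P := fun y => lin (shift E) (e i) * lin (pull π) y =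
    koszulSign a b • (lin (pull π) y * lin (shift E) (e i))
      + lin (shift E) (bracketMap (e i) y)) hy
      (fun j hj => ?_) (by simp)
      (fun x x' h h' => by
        simp only [map_add, add_mul, mul_add, h, h']; module)
      (fun c x h => by
        simp only [map_smul, smul_mul_assoc, mul_smul_comm, h]; module)
  subst hi hj
  rw [lin_e, lin_e, bracketMap_e]
  exact shift_mul_pull π i j

/-- The failure of `pull π` to respect the bracket of two basis vectors. -/
noncomputable def pullDefect (a b : BMSIndex) : Module.End ℂ (WordFun E) :=
  pull π a * pull π b - sgn a b • (pull π b * pull π a) - lin (pull π) (basisBracket a b)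

/-- The super Jacobi identity for c, a, b is what makes the extra terms cancel. Consequently the
defect at any word is determined by the defect at the empty word, whether or not π is a
representation. -/
theorem shift_mul_pullDefect (a b c : BMSIndex) : shift E c * pullDefect π a b =
    (sgn c a * sgn c b) • (pullDefect π a b * shift E c) := by
  have hm : ∀ i, e i ∈ gradedPart (parity i) := fun i => e_mem_gradedPart i rfl
  have h3 := lin_shift_mul_pull π (basisBracket_mem c a) (hm b)
  have h4 := lin_shift_mul_pull π (basisBracket_mem c b) (hm a)
  have h5 := lin_shift_mul_pull π (hm c) (basisBracket_mem a b)
  have j := congrArg (lin (shift E)) (basisBracket_jacobi c a b)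
  have sk : bracketMap (e a) (basisBracket c b) =
      -(koszulSign (parity a) (parity c + parity b) • bracketMap (basisBracket c b) (e a)) :=
    instLieSuperalgebra.bracket_skew (hm a) (basisBracket_mem c b)
  rw [sk] at j
  simp only [lin_e, map_add, map_neg, map_smul] at h3 h4 h5 j
  rw [j] at h5
  have key : ∀ x y, shift E c * (pull π x * pull π y) =
      (sgn c x * sgn c y) • (pull π x * pull π y * shift E c)
      + sgn c x • (pull π x * lin (shift E) (basisBracket c y))
      + lin (shift E) (basisBracket c x) * pull π y := by
    intro x y
    rw [← mul_assoc, shift_mul_pull, add_mul, smul_mul_assoc, mul_assoc, shift_mul_pull, mul_add,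
      mul_smul_comm, mul_assoc]
    module
  rw [pullDefect, mul_sub, mul_sub, mul_smul_comm, key, key, h3, h4, h5]
  simp only [sub_mul, smul_mul_assoc]
  simp only [sgn, koszulSign_add_left, koszulSign_add_right]
  have h' : ∀ c : ZMod 2, c = 0 ∨ c = 1 := by decide
  rcases h' (parity a) with h1 | h1 <;> rcases h' (parity b) with h2 | h2 <;>
    rcases h' (parity c) with h0 | h0 <;>
    simp only [h0, h1, h2, koszulSign, zero_ne_one, and_self, and_true, and_false, if_true,
      if_false] <;> module

theorem pullDefect_eq_zero {N : BMSIndex → Prop} (hπ : RepOn N π) {a b : BMSIndex} (ha : N a)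
    (hb : N b) : pullDefect π a b = 0 := by
  ext f r
  induction r generalizing f with
  | nil =>
    have := LinearMap.congr_fun (hπ a b ha hb) (f [])
    simp only [LinearMap.sub_apply, LinearMap.smul_apply, Module.End.mul_apply] at this
    simp only [pullDefect, LinearMap.sub_apply, LinearMap.smul_apply, Module.End.mul_apply,
      Pi.sub_apply, Pi.smul_apply, pull_nil, lin_pull_nil, this, sub_self, LinearMap.zero_apply,
      Pi.zero_apply]
  | cons c r ih =>
    have := congrFun (LinearMap.congr_fun (shift_mul_pullDefect π a b c) f) r
    simp only [Module.End.mul_apply, shift_apply, LinearMap.smul_apply, Pi.smul_apply, ih] at this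
    simpa using this

/-- Moving x through a word never changes the number of other letters, apart from absorbing x in a
bracket, so the value at r involves only words of the same length as r. This makes the recursion on
length that defines `proj` legitimate. -/
theorem pull_congr {G : BMSIndex → Prop} (hG : Closed G) {x : BMSIndex} (hx : G x)
    {r : List BMSIndex} (hr : ∀ c ∈ r, G c) {f g : WordFun E}
    (h : ∀ r' : List BMSIndex, (∀ c ∈ r', G c) → r'.length = r.length → f r' = g r') :
    pull π x f r = pull π x g r := by
  induction r generalizing f g with
  | nil => rw [pull_nil, pull_nil, h [] (by simp) rfl]
  | cons c r ih =>
    have hc : G c := hr c (by simp)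
    have hr' : ∀ c ∈ r, G c := fun d hd => hr d (by simp [hd])
    rw [pull_cons, pull_cons, lin_shift_apply, lin_shift_apply,
      ih hr' (f := shift E c f) (g := shift E c g)]
    · congr 1
      exact lin_congr (hG c x hc hx) fun k hk => h _ (by simpa using ⟨hk, hr'⟩) rfl
    · intro r' h1 h2
      exact h _ (by simpa using ⟨hc, h1⟩) (by simp [h2])

theorem pull_map {R : Module.End ℂ E} {x : BMSIndex} (h : R * π x = π x * R) (f : WordFun E)
    (r : List BMSIndex) : pull π x (fun s => R (f s)) r = R (pull π x f r) := by
  induction r generalizing f with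
  | nil => exact (LinearMap.congr_fun h (f [])).symm
  | cons c r ih =>
    rw [pull_cons, pull_cons, map_add, map_smul, ← ih, lin_shift_apply, lin_shift_apply, map_lin]
    rfl

/-- `f` vanishes on the relations `w (a b ± b a - [a, b]) w'` with `|w| + |w'| = n` and letters
in `G`. -/
def RelAt (G : BMSIndex → Prop) (f : WordFun E) (n : ℕ) : Prop :=
  ∀ s a b r, (∀ c ∈ s, G c) → G a → G b → (∀ c ∈ r, G c) → s.length + r.length = n →
    f (s ++ b :: a :: r) - sgn a b • f (s ++ a :: b :: r) =
      lin (fun k => f (s ++ k :: r)) (basisBracket a b)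

theorem RelAt.shift {G : BMSIndex → Prop} {f : WordFun E} {n : ℕ} (h : RelAt G f (n + 1))
    {c : BMSIndex} (hc : G c) : RelAt G (shift E c f) n := by
  intro s a b r hs ha hb hr hn
  exact h (c :: s) a b r (by simpa using ⟨hc, hs⟩) ha hb hr (by simp; omega)

theorem RelAt.lin_shift {G : BMSIndex → Prop} {f : WordFun E} {n : ℕ} (h : RelAt G f (n + 1))
    {x : BMS} (hx : x ∈ Finsupp.supported ℂ ℂ {k | G k}) : RelAt G (lin (BMS.shift E) x f) n := by
  refine supported_induction (P := fun x => RelAt G (lin (BMS.shift E) x f) n) hx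
    (fun i hi => by rw [lin_e]; exact h.shift hi) ?_ ?_ ?_
  · intro s a b r _ _ _ _ _
    simp [Finsupp.linearCombination_apply]
  · intro x y hx hy s a b r hs ha hb hr hn
    have h1 := hx s a b r hs ha hb hr hn
    have h2 := hy s a b r hs ha hb hr hn
    have : lin (fun k => lin (BMS.shift E) (x + y) f (s ++ k :: r)) (basisBracket a b) =
        lin (fun k => lin (BMS.shift E) x f (s ++ k :: r)) (basisBracket a b) +
        lin (fun k => lin (BMS.shift E) y f (s ++ k :: r)) (basisBracket a b) := by
      simp only [map_add, LinearMap.add_apply, Pi.add_apply]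
      exact lin_add_fun _ _ _
    rw [this, ← h1, ← h2]
    simp only [map_add, LinearMap.add_apply, Pi.add_apply]
    module
  · intro c x hx s a b r hs ha hb hr hn
    have h1 := hx s a b r hs ha hb hr hn
    have : lin (fun k => lin (BMS.shift E) (c • x) f (s ++ k :: r)) (basisBracket a b) =
        c • lin (fun k => lin (BMS.shift E) x f (s ++ k :: r)) (basisBracket a b) := by
      simp only [map_smul, LinearMap.smul_apply, Pi.smul_apply]
      exact lin_smul_fun _ _ _
    rw [this, ← h1]
    simp only [map_smul, LinearMap.smul_apply, Pi.smul_apply]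
    module

theorem RelAt.lin_left {G : BMSIndex → Prop} {f : WordFun E} {r : List BMSIndex}
    (h : RelAt G f r.length) (hr : ∀ c ∈ r, G c) {α : ZMod 2} {x : BMS}
    (hx : x ∈ Finsupp.supported ℂ ℂ {k | parity k = α ∧ G k}) {b : BMSIndex} (hb : G b) :
    BMS.lin (BMS.shift E) x (BMS.shift E b f) r
      - koszulSign α (parity b) • BMS.shift E b (BMS.lin (BMS.shift E) x f) r =
      BMS.lin (BMS.shift E) (bracketMap x (e b)) f r := by
  refine supported_induction (P := fun x => BMS.lin (BMS.shift E) x (BMS.shift E b f) r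
      - koszulSign α (parity b) • BMS.shift E b (BMS.lin (BMS.shift E) x f) r =
      BMS.lin (BMS.shift E) (bracketMap x (e b)) f r) hx ?_ (by simp)
    (fun x y hx hy => ?_) (fun c x hx => ?_)
  · rintro a ⟨rfl, ha⟩
    rw [lin_e, bracketMap_e, lin_shift_apply]
    exact h [] a b r (by simp) ha hb hr (by simp)
  · simp only [map_add, LinearMap.add_apply, Pi.add_apply] at hx hy ⊢
    rw [← hx, ← hy]; module
  · simp only [map_smul, LinearMap.smul_apply, Pi.smul_apply] at hx ⊢
    rw [← hx]; module

theorem RelAt.lin_right {G : BMSIndex → Prop} {f : WordFun E} {r : List BMSIndex}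
    (h : RelAt G f r.length) (hr : ∀ c ∈ r, G c) {α : ZMod 2} {x : BMS}
    (hx : x ∈ Finsupp.supported ℂ ℂ {k | parity k = α ∧ G k}) {a : BMSIndex} (ha : G a) :
    BMS.shift E a (BMS.lin (BMS.shift E) x f) r
      - koszulSign (parity a) α • BMS.lin (BMS.shift E) x (BMS.shift E a f) r =
      BMS.lin (BMS.shift E) (bracketMap (e a) x) f r := by
  have hx' : x ∈ gradedPart α := by
    refine Finsupp.supported_mono ?_ hx
    exact fun k hk => hk.1
  have sk : bracketMap (e a) x = -(koszulSign (parity a) α • bracketMap x (e a)) :=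
    instLieSuperalgebra.bracket_skew (e_mem_gradedPart a rfl) hx'
  rw [sk, map_neg, map_smul, LinearMap.neg_apply, LinearMap.smul_apply, Pi.neg_apply,
    Pi.smul_apply, ← h.lin_left hr hx ha, smul_sub, smul_smul, koszulSign_comm α,
    koszulSign_mul_self]
  module

/-- The consistency check for moving x through a relation. If the relation stands at the right end
of the word (`s = []`), x has to pass a and b in either order, and the results agree by super
skew-symmetry and Jacobi. Letters to the right of the relation are stripped by the recursion for
`pull`. -/
theorem RelAt.pull {G : BMSIndex → Prop} (hG : Closed G) {f : WordFun E} {n : ℕ}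
    (h : RelAt G f n) {x : BMSIndex} (hx : G x) : RelAt G (pull π x f) n := by
  intro s a b r hs ha hb hr hn
  induction s generalizing f n with
  | nil =>
    obtain rfl : n = r.length := by simpa using hn.symm
    have hm : ∀ i, e i ∈ gradedPart (parity i) := fun i => e_mem_gradedPart i rfl
    have e1 : BMS.pull π x (BMS.shift E a (BMS.shift E b f)
        - sgn a b • BMS.shift E b (BMS.shift E a f)) r =
        BMS.pull π x (lin (BMS.shift E) (basisBracket a b) f) r := by
      refine pull_congr π hG hx hr fun r' hr' hl => ?_
      rw [lin_shift_apply]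
      exact h [] a b r' (by simp) ha hb hr' (by simpa using hl)
    have e2 := h.lin_right hr (basisBracket_mem_and hG hb hx) ha
    have e3 := h.lin_left hr (basisBracket_mem_and hG ha hx) hb
    have e4 := congrFun (LinearMap.congr_fun
      (lin_shift_mul_pull π (basisBracket_mem a b) (hm x)) f) r
    have jac : lin (BMS.shift E) (bracketMap (e a) (basisBracket b x)) f r =
        lin (BMS.shift E) (bracketMap (basisBracket a b) (e x)) f r +
        sgn a b • lin (BMS.shift E) (bracketMap (e b) (basisBracket a x)) f r := by
      rw [basisBracket_jacobi a b x]; simp [sgn]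
    have sk : bracketMap (e b) (basisBracket a x) =
      -(koszulSign (parity b) (parity a + parity x) • bracketMap (basisBracket a x) (e b)) :=
      instLieSuperalgebra.bracket_skew (hm b) (basisBracket_mem a x)
    rw [sk, ← e2, map_neg, map_smul, LinearMap.neg_apply, LinearMap.smul_apply, Pi.neg_apply,
      Pi.smul_apply, ← e3] at jac
    have e5 := lin_shift_apply (basisBracket a b) (BMS.pull π x f) r
    simp only [Module.End.mul_apply, LinearMap.add_apply, LinearMap.smul_apply, Pi.add_apply,
      Pi.smul_apply, lin_e] at e4
    simp only [List.nil_append]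
    rw [← e5, e4, ← e1]
    simp only [pull_cons, map_sub, map_smul, Pi.sub_apply, Pi.smul_apply]
    have jac' := eq_sub_of_add_eq jac.symm
    rw [jac']
    simp only [shift_apply, sgn, koszulSign_add_left, koszulSign_add_right]
    have hs : ∀ y, BMS.lin (BMS.shift E) y f (a :: r) =
      BMS.shift E a (BMS.lin (BMS.shift E) y f) r := fun _ => rfl
    have h' : ∀ c : ZMod 2, c = 0 ∨ c = 1 := by decide
    rcases h' (parity a) with h1 | h1 <;> rcases h' (parity b) with h2 | h2 <;>
      rcases h' (parity x) with h0 | h0 <;>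
      simp only [h0, h1, h2, koszulSign, zero_ne_one, and_self, and_true, and_false, if_true,
        if_false] <;> module
  | cons c s ih =>
    have hc : G c := hs c (by simp)
    have hs' : ∀ c ∈ s, G c := fun d hd => hs d (by simp [hd])
    obtain ⟨m, rfl⟩ : ∃ m, n = m + 1 := ⟨s.length + r.length, by simp at hn; omega⟩
    have hm : s.length + r.length = m := by simp at hn; omega
    have i1 := ih (h.shift hc) hs' hm
    have i2 := h.lin_shift (hG c x hc hx) s a b r hs' ha hb hr hm
    have : lin (fun k => BMS.pull π x f (c :: s ++ k :: r)) (basisBracket a b) =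
        sgn c x • lin (fun k => BMS.pull π x (BMS.shift E c f) (s ++ k :: r)) (basisBracket a b)
        + lin (fun k => lin (BMS.shift E) (basisBracket c x) f (s ++ k :: r))
          (basisBracket a b) := by
      simp only [List.cons_append, pull_cons]
      rw [lin_add_fun, lin_smul_fun]
    rw [this, ← i1, ← i2]
    simp only [List.cons_append, pull_cons]
    module

end Words

/-! ### The bimodule map on words determined by a left and a right action -/

section Projection

open Classical in
/-- Auxiliary recursion for `proj`; only the values at words of length `n` matter. -/
noncomputable def projAux {E : Type*} [AddCommGroup E] [Module ℂ E] (H : BMSIndex → Prop)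
    (R π : BMSIndex → Module.End ℂ E) (j : E) : ℕ → WordFun E
  | 0, _ => j
  | _ + 1, [] => j
  | n + 1, x :: r => if H x then R x (projAux H R π j n r) else pull π x (projAux H R π j n) r

/-- The function `f` on words determined by `f 1 = j`, `f (w x) = R x (f w)` for `x` satisfying
`H`, and `f (w x) = pull π x f w` for all other `x`. -/
noncomputable def proj {E : Type*} [AddCommGroup E] [Module ℂ E] (H : BMSIndex → Prop)
    (R π : BMSIndex → Module.End ℂ E) (j : E) : WordFun E :=
  fun r => projAux H R π j r.length r

variable {E : Type*} [AddCommGroup E] [Module ℂ E] {H N : BMSIndex → Prop}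
  {R π : BMSIndex → Module.End ℂ E} {j : E}

theorem proj_nil : proj H R π j [] = j := rfl

theorem proj_cons_of {x : BMSIndex} (hx : H x) (r : List BMSIndex) :
    proj H R π j (x :: r) = R x (proj H R π j r) := by
  simp [proj, projAux, hx]

theorem proj_cons_of_not {x : BMSIndex} (hx : ¬ H x) (r : List BMSIndex) :
    proj H R π j (x :: r) = pull π x (proj H R π j) r := by
  have h : proj H R π j (x :: r) = pull π x (projAux H R π j r.length) r := by
    simp [proj, projAux, hx]
  rw [h]
  refine pull_congr π closed_true trivial (by simp) fun r' _ h => ?_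
  rw [proj, h]

/-- The data of a representation of the subalgebra `N` by operators `π` and of an
anti-representation of the subalgebra `H` by operators `R`, commuting with each other, together with
a vector on which they agree on the intersection. -/
structure ProjData (H N : BMSIndex → Prop) (R π : BMSIndex → Module.End ℂ E) (j : E) : Prop where
  closed_left : Closed H
  closed_right : Closed N
  closed : Closed fun i => H i ∨ N i
  rep : RepOn N π
  antirep : ∀ a b, H a → H b → R b * R a - sgn a b • (R a * R b) = lin R (basisBracket a b)
  comm : ∀ a b, H a → N b → R a * π b = π b * R a
  agree : ∀ x, H x → N x → R x j = π x j

namespace ProjData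

theorem lin_proj_cons (x : BMS) (hx : x ∈ Finsupp.supported ℂ ℂ {k | H k})
    (r : List BMSIndex) :
    lin (fun k => proj H R π j (k :: r)) x = lin R x (proj H R π j r) := by
  rw [lin_congr hx fun k hk => proj_cons_of hk r]
  exact (map_lin (LinearMap.applyₗ (proj H R π j r)) R x).symm

theorem lin_pull_apply (π : BMSIndex → Module.End ℂ E) (x : BMS) (f : WordFun E)
    (r : List BMSIndex) : lin (pull π) x f r = lin (fun k => pull π k f r) x :=
  map_lin ((LinearMap.proj r : WordFun E →ₗ[ℂ] E) ∘ₗ LinearMap.applyₗ f) (pull π) x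

variable (D : ProjData H N R π j)
include D

theorem pull_comm {a b : BMSIndex} (ha : N a) (hb : N b) (f : WordFun E) (r : List BMSIndex) :
    pull π a (pull π b f) r - sgn a b • pull π b (pull π a f) r
      = lin (fun k => pull π k f r) (basisBracket a b) := by
  have := congrFun (LinearMap.congr_fun (pullDefect_eq_zero π D.rep ha hb) f) r
  simp only [pullDefect, LinearMap.sub_apply, LinearMap.smul_apply, Module.End.mul_apply,
      Pi.sub_apply, Pi.smul_apply, LinearMap.zero_apply, Pi.zero_apply, lin_pull_apply] at this
  exact sub_eq_zero.1 this

theorem pull_shift_proj {a x : BMSIndex} (ha : H a) (hx : N x) (r : List BMSIndex) :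
    pull π x (shift E a (proj H R π j)) r = R a (pull π x (proj H R π j) r) := by
  have h : shift E a (proj H R π j) = fun s => R a (proj H R π j s) :=
    funext fun r' => proj_cons_of (R := R) (π := π) (j := j) ha r'
  rw [← pull_map π (D.comm a x ha hx), h]

/-- The two prescriptions for a last letter x in H ∩ N agree: on the empty word by `agree`, and on
longer words by moving x past the preceding letter a. If a lies in H this uses that R is an
anti-representation commuting with π; otherwise it uses that `pull` represents N. -/
theorem proj_cons {x : BMSIndex} (hx : N x) {r : List BMSIndex} (hr : ∀ c ∈ r, H c ∨ N c) :
    proj H R π j (x :: r) = pull π x (proj H R π j) r := by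
  induction hn : r.length using Nat.strong_induction_on generalizing x r with
  | _ n ih =>
  by_cases hH : H x
  swap
  · exact proj_cons_of_not hH r
  rw [proj_cons_of hH]
  match r, hn with
  | [], _ => rw [proj_nil, pull_nil, proj_nil, D.agree x hH hx]
  | a :: r, hn =>
    have hr' : ∀ c ∈ r, H c ∨ N c := fun d hd => hr d (by simp [hd])
    have hlt : r.length < n := by simp at hn; omega
    have ihx := ih _ hlt hx hr' rfl
    rw [proj_cons_of hH] at ihx
    by_cases ha : H a
    · have anti := LinearMap.congr_fun (D.antirep a x ha hH) (proj H R π j r)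
      simp only [LinearMap.sub_apply, LinearMap.smul_apply, Module.End.mul_apply] at anti
      rw [proj_cons_of ha, pull_cons, lin_shift_apply,
        lin_proj_cons _ (D.closed_left a x ha hH), ← anti, D.pull_shift_proj ha hx, ihx]
      module
    · have ha' : N a := (hr a (by simp)).resolve_left ha
      rw [proj_cons_of_not ha, ← pull_map π (D.comm x a hH ha'), pull_cons, lin_shift_apply,
        lin_congr (D.closed_right a x ha' hx) (fun k hk => ih _ hlt hk hr' rfl),
        ← D.pull_comm ha' hx]
      have e1 : pull π a (fun s => R x (proj H R π j s)) r
          = pull π a (pull π x (proj H R π j)) r := by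
        refine pull_congr π D.closed (Or.inr ha') hr' fun r' h1 h2 => ?_
        rw [← proj_cons_of hH, ih _ (h2 ▸ hlt) hx h1 rfl]
      have e2 : pull π x (shift E a (proj H R π j)) r
          = pull π x (pull π a (proj H R π j)) r := by
        refine pull_congr π D.closed (Or.inr hx) hr' fun r' h1 h2 => ?_
        exact proj_cons_of_not ha r'
      rw [e1, e2]
      module

/-- Words are stored with the last letter first, so a nonempty s starts with the last letter x, and
the relation is inherited from the shorter word through R x or through `RelAt.pull`. For empty s the
cases are: both letters in H (anti-representation), one in each (the recursion for `pull`), both in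
N (vanishing of the defect). -/
theorem relAt_proj (n : ℕ) : RelAt (fun i => H i ∨ N i) (proj H R π j) n := by
  induction n using Nat.strong_induction_on with
  | _ n ih =>
  intro s a b r hs ha hb hr hn
  match s, hn with
  | [], hn =>
    have hskew : ∀ a b, basisBracket b a = -(sgn a b • basisBracket a b) := fun a b => by
      rw [sgn_comm]; exact basisBracket_skew b a
    have mixed : ∀ a b, H a → N b →
        proj H R π j ([] ++ b :: a :: r) - sgn a b • proj H R π j ([] ++ a :: b :: r) =
          lin (fun k => proj H R π j ([] ++ k :: r)) (basisBracket a b) := by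
      intro a b ha hb
      simp only [List.nil_append]
      rw [D.proj_cons hb (r := a :: r) (by simpa using ⟨Or.inl ha, hr⟩), pull_cons,
        D.pull_shift_proj ha hb, lin_shift_apply, proj_cons_of ha, D.proj_cons hb hr]
      module
    rcases ha with ha | ha <;> rcases hb with hb | hb
    · have anti := LinearMap.congr_fun (D.antirep a b ha hb) (proj H R π j r)
      simp only [LinearMap.sub_apply, LinearMap.smul_apply, Module.End.mul_apply] at anti
      simp only [List.nil_append]
      rw [proj_cons_of ha, proj_cons_of hb, proj_cons_of hb, proj_cons_of ha, anti,
        lin_proj_cons _ (D.closed_left a b ha hb)]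
    · exact mixed a b ha hb
    · have := mixed b a hb ha
      rw [hskew, map_neg, map_smul, sgn_comm b a] at this
      have h2 := congrArg (fun z => sgn a b • z) this
      simp only [smul_sub, smul_neg, smul_smul, sgn_mul_self, one_smul] at h2
      rw [← neg_neg (lin _ _), ← h2]
      module
    · have key : ∀ a b, N a → N b → proj H R π j (b :: a :: r) =
          sgn a b • pull π b (pull π a (proj H R π j)) r
            + lin (fun k => proj H R π j (k :: r)) (basisBracket a b) := by
        intro a b ha hb
        rw [D.proj_cons hb (r := a :: r) (by simpa using ⟨Or.inr ha, hr⟩), pull_cons,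
          lin_shift_apply]
        congr 2
        refine pull_congr π D.closed (Or.inr hb) hr fun r' h1 h2 => ?_
        exact D.proj_cons ha h1
      have e := D.pull_comm ha hb (proj H R π j) r
      rw [← lin_congr (D.closed_right a b ha hb) (fun k hk => D.proj_cons hk hr)] at e
      simp only [List.nil_append]
      rw [key a b ha hb, key b a hb ha, hskew a b, map_neg, map_smul, sgn_comm b a, ← e]
      simp only [smul_add, smul_sub, smul_neg, smul_smul, sgn_mul_self, one_smul]
      abel
  | x :: s, hn =>
    have hs' : ∀ c ∈ s, H c ∨ N c := fun d hd => hs d (by simp [hd])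
    have hlt : s.length + r.length < n := by simp at hn; omega
    have ih' := ih _ hlt
    by_cases hx : H x
    · have h1 := congrArg (R x) (ih' s a b r hs' ha hb hr rfl)
      rw [map_sub, map_smul, map_lin] at h1
      simp only [← proj_cons_of hx] at h1
      exact h1
    · have hx' : N x := (hs x (by simp)).resolve_left hx
      have h1 := ih'.pull π D.closed (Or.inr hx') s a b r hs' ha hb hr rfl
      simp only [← proj_cons_of_not hx] at h1
      exact h1

end ProjData

end Projection

/-! ### Extending a module from a subalgebra by coinduction -/

/-- The functions on words that vanish on all relations between the labels satisfying `G` and on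
all words with another letter. -/
def relFun (G : BMSIndex → Prop) (X : Type*) [AddCommGroup X] [Module ℂ X] :
    Submodule ℂ (WordFun X) where
  carrier := {f | (∀ n, RelAt G f n) ∧ ∀ r, (¬ ∀ c ∈ r, G c) → f r = 0}
  zero_mem' := by
    refine ⟨fun n s a b r _ _ _ _ _ => ?_, fun _ _ => rfl⟩
    simp [Finsupp.linearCombination_apply]
  add_mem' := by
    rintro f g ⟨hf, hf'⟩ ⟨hg, hg'⟩
    refine ⟨fun n s a b r hs ha hb hr hn => ?_, fun r hr => ?_⟩
    · simp only [Pi.add_apply]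
      rw [lin_add_fun, ← hf n s a b r hs ha hb hr hn, ← hg n s a b r hs ha hb hr hn]
      module
    · rw [Pi.add_apply, hf' r hr, hg' r hr, add_zero]
  smul_mem' := by
    rintro c f ⟨hf, hf'⟩
    refine ⟨fun n s a b r hs ha hb hr hn => ?_, fun r hr => ?_⟩
    · simp only [Pi.smul_apply]
      rw [lin_smul_fun, ← hf n s a b r hs ha hb hr hn]
      module
    · rw [Pi.smul_apply, hf' r hr, smul_zero]

open Classical in
/-- The action of the subalgebra `G` on `relFun G X`. -/
noncomputable def relFunAct (G : BMSIndex → Prop) (X : Type*) [AddCommGroup X] [Module ℂ X]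
    (i : BMSIndex) : Module.End ℂ (relFun G X) :=
  if hi : G i then (shift X i).restrict (fun f hf => ⟨fun n => (hf.1 (n + 1)).shift hi,
    fun r hr => hf.2 (i :: r) (by simp [hi] at hr ⊢; exact hr)⟩) else 0

theorem relFunAct_apply {G : BMSIndex → Prop} {X : Type*} [AddCommGroup X] [Module ℂ X]
    {i : BMSIndex} (hi : G i) (f : relFun G X) (r : List BMSIndex) :
    (relFunAct G X i f).1 r = f.1 (i :: r) := by
  rw [relFunAct, dif_pos hi]
  rfl

theorem repOn_relFunAct {G : BMSIndex → Prop} (hG : Closed G) (X : Type*) [AddCommGroup X]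
    [Module ℂ X] : RepOn G (relFunAct G X) := by
  intro a b ha hb
  refine LinearMap.ext fun f => Subtype.ext (funext fun r => ?_)
  have e1 : (lin (relFunAct G X) (basisBracket a b) f).1 r =
      lin (fun k => f.1 (k :: r)) (basisBracket a b) := by
    rw [← lin_congr (hG a b ha hb) fun k hk => relFunAct_apply hk f r]
    exact map_lin ((LinearMap.proj r : WordFun X →ₗ[ℂ] X) ∘ₗ (relFun G X).subtype ∘ₗ
      LinearMap.applyₗ f) (relFunAct G X) _
  have e2 : ((relFunAct G X a * relFunAct G X b
      - sgn a b • (relFunAct G X b * relFunAct G X a)) f).1 r =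
      f.1 (b :: a :: r) - sgn a b • f.1 (a :: b :: r) := by
    change (relFunAct G X a (relFunAct G X b f)).1 r
      - sgn a b • (relFunAct G X b (relFunAct G X a f)).1 r = _
    rw [relFunAct_apply ha, relFunAct_apply hb, relFunAct_apply hb, relFunAct_apply ha]
  rw [e1, e2]
  by_cases hr : ∀ c ∈ r, G c
  · exact f.2.1 r.length [] a b r (by simp) ha hb hr (by simp)
  · have h0 : ∀ k, f.1 (k :: r) = 0 := fun k => f.2.2 _ fun h => hr fun c hc => h c (by simp [hc])
    rw [f.2.2, f.2.2]
    · simp [h0, Finsupp.linearCombination_apply]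
    · exact fun h => hr fun c hc => h c (by simp [hc])
    · exact fun h => hr fun c hc => h c (by simp [hc])

open Classical in
-- Functions on words respecting the relations form a module under (c f)(w) = f(w c). On Hom(V, X),
-- let N act by postcomposition with π and H on the right by precomposition with ρ; `proj` then
-- gives F with F(w h) = F(w) ∘ ρ(h) and F(1) = j. The embedding sends v to w ↦ F(w) v, and
-- evaluation at the empty word recovers j, whence injectivity.
theorem exists_extension {V : Type*} {X : Type u} [AddCommGroup V] [Module ℂ V] [AddCommGroup X]
    [Module ℂ X] {H N : BMSIndex → Prop} (hH : Closed H) (hN : Closed N)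
    (hG : Closed fun i => H i ∨ N i) {ρ : BMSIndex → Module.End ℂ V}
    {π : BMSIndex → Module.End ℂ X} (hρ : RepOn H ρ) (hπ : RepOn N π) (j : V →ₗ[ℂ] X)
    (hj : Function.Injective j) (hjH : ∀ i, H i → N i → ∀ v, j (ρ i v) = π i (j v)) :
    ∃ (W : Type u) (_ : AddCommGroup W) (_ : Module ℂ W) (A : BMSIndex → Module.End ℂ W)
      (φ : V →ₗ[ℂ] W), RepOn (fun i => H i ∨ N i) A ∧ Function.Injective φ ∧
      ∀ i, H i → ∀ v, A i (φ v) = φ (ρ i v) := by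
  let T : Module.End ℂ V →ₗ[ℂ] Module.End ℂ (V →ₗ[ℂ] X) :=
    LinearMap.mk₂ ℂ (fun f g => g ∘ₗ f) (fun _ _ _ => LinearMap.comp_add _ _ _)
      (fun _ _ _ => LinearMap.comp_smul _ _ _) (fun _ _ _ => LinearMap.add_comp _ _ _)
      (fun _ _ _ => LinearMap.smul_comp _ _ _)
  let R : BMSIndex → Module.End ℂ (V →ₗ[ℂ] X) := fun x => T (ρ x)
  let P : BMSIndex → Module.End ℂ (V →ₗ[ℂ] X) := fun x => LinearMap.llcomp ℂ V X X (π x)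
  have D : ProjData H N R P j := by
    refine ⟨hH, hN, hG, fun a b ha hb => ?_, fun a b ha hb => ?_, fun a b _ _ => rfl,
      fun x h1 h2 => LinearMap.ext (hjH x h1 h2)⟩
    · exact (congrArg (LinearMap.llcomp ℂ V X X) (hπ a b ha hb)).trans
        (map_lin (LinearMap.llcomp ℂ V X X) π _)
    · have := congrArg T (hρ a b ha hb)
      rw [map_lin, map_sub, map_smul] at this
      exact this
  let F := BMS.proj H R P j
  let G : BMSIndex → Prop := fun i => H i ∨ N i
  let φ : V →ₗ[ℂ] relFun G X :=
    { toFun := fun v => ⟨fun r => if ∀ c ∈ r, G c then F r v else 0, by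
        refine ⟨fun n s a b r hs ha hb hr hn => ?_, fun r hr => if_neg hr⟩
        have := congrArg (LinearMap.applyₗ v) (D.relAt_proj n s a b r hs ha hb hr hn)
        rw [map_lin] at this
        have hw : ∀ w, (∀ c ∈ w, G c) → ∀ c ∈ s ++ w, G c := by
          intro w hw c hc
          rcases List.mem_append.1 hc with h | h
          exacts [hs c h, hw c h]
        beta_reduce
        rw [if_pos (hw _ (by simpa using ⟨hb, ha, hr⟩)),
          if_pos (hw _ (by simpa using ⟨ha, hb, hr⟩)),
          lin_congr (hG a b ha hb) fun k hk => if_pos (hw _ (by simpa using ⟨hk, hr⟩))]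
        exact this⟩
      map_add' := fun v w => Subtype.ext (funext fun r => by
        change (if ∀ c ∈ r, G c then F r (v + w) else 0) =
          (if ∀ c ∈ r, G c then F r v else 0) + if ∀ c ∈ r, G c then F r w else 0
        split_ifs <;> simp)
      map_smul' := fun c v => Subtype.ext (funext fun r => by
        change (if ∀ c ∈ r, G c then F r (c • v) else 0) =
          c • if ∀ c ∈ r, G c then F r v else 0
        split_ifs <;> simp) }
  have hφ : ∀ v r, (φ v).1 r = if ∀ c ∈ r, G c then F r v else 0 := fun _ _ => rfl
  refine ⟨relFun G X, inferInstance, inferInstance, relFunAct _ X, φ,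
    repOn_relFunAct hG X, fun v w h => hj ?_, fun i hi v => ?_⟩
  · have := congrFun (congrArg Subtype.val h) []
    rw [hφ, hφ] at this
    exact (by simpa using this : F [] v = F [] w)
  · refine Subtype.ext (funext fun r => ?_)
    rw [relFunAct_apply (Or.inl hi)]
    rw [hφ, hφ]
    have hGi : G i := Or.inl hi
    by_cases hr : ∀ c ∈ r, G c
    · rw [if_pos hr, if_pos (by simpa using ⟨hGi, hr⟩)]
      exact LinearMap.congr_fun (proj_cons_of (R := R) hi r) v
    · rw [if_neg hr, if_neg (by simp [hGi] at hr ⊢; exact hr)]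

/-! ### The subalgebras of negative and nonnegative generators -/

/-- The labels of the basis `M n` (`n < 0`), `Q_{k - 1/2}` (`k ≤ 0`). -/
def negMQ : BMSIndex → Prop
  | .M n => n < 0
  | .Q k => k ≤ 0
  | _ => False

/-- The labels of the basis `L n` (`n < 0`). -/
def negL : BMSIndex → Prop
  | .L n => n < 0
  | _ => False

/-- The labels of the basis of the subalgebra spanned by `L n` (`n ≥ 0`) and all `M`, `Q`, `c`. -/
def nonnegL : BMSIndex → Prop
  | .L n => 0 ≤ n
  | _ => True

theorem smul_e_mem {p : BMSIndex → Prop} (c : ℂ) {i : BMSIndex} (h : p i) :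
    c • e i ∈ Finsupp.supported ℂ ℂ {i | p i} :=
  Submodule.smul_mem _ c (Finsupp.single_mem_supported ℂ 1 h)

theorem closed_subIndex (q : ℕ) : Closed (subIndex q) := fun _ _ => basisBracket_mem_sub q

theorem closed_nonnegL : Closed nonnegL := by
  intro i j hi hj
  rcases i with m | m | m | _ | _ <;> rcases j with n | n | n | _ | _
  all_goals simp only [nonnegL] at hi hj
  case L.L =>
    exact Submodule.add_mem _ (smul_e_mem _ (by simp only [nonnegL]; omega))
      (smul_e_mem _ trivial)
  case L.M => exact Submodule.add_mem _ (smul_e_mem _ trivial) (smul_e_mem _ trivial)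
  case M.L => exact Submodule.add_mem _ (smul_e_mem _ trivial) (smul_e_mem _ trivial)
  case Q.Q => exact Submodule.add_mem _ (smul_e_mem _ trivial) (smul_e_mem _ trivial)
  case L.Q => exact smul_e_mem _ trivial
  case Q.L => exact smul_e_mem _ trivial
  all_goals exact Submodule.zero_mem _

theorem closed_negL : Closed negL := by
  intro i j hi hj
  rcases i with m | m | m | _ | _ <;> rcases j with n | n | n | _ | _
  all_goals simp only [negL] at hi hj
  have : δ (m + n) = 0 := if_neg (by omega)
  simp only [basisBracket, this, zero_mul, zero_div, zero_smul, add_zero]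
  exact smul_e_mem _ (by simp only [negL]; omega)

theorem basisBracket_Q_Q {k l : ℤ} (hk : k ≤ 0) (hl : l ≤ 0) :
    basisBracket (.Q k) (.Q l) = (2 : ℂ) • e (.M (k + l - 1)) := by
  have : δ (k + l - 1) = 0 := if_neg (by omega)
  simp only [basisBracket, this, zero_mul, zero_div, zero_smul, add_zero]

theorem closed_negMQ : Closed negMQ := by
  intro i j hi hj
  rcases i with m | m | m | _ | _ <;> rcases j with n | n | n | _ | _
  all_goals simp only [negMQ] at hi hj
  all_goals try exact Submodule.zero_mem _
  rw [basisBracket_Q_Q hi hj]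
  exact smul_e_mem _ (by simp only [negMQ]; omega)

/-! ### A module over the negative M and Q from a Clifford algebra -/

section Clifford

/-- A quadratic form such that the generators of its Clifford algebra satisfy
`[Q_r, Q_s] = 2 M_{r + s}` for `r, s < 0`. -/
noncomputable def negForm {R : Type*} [CommRing R] (m : ℤ → R) : QuadraticForm R (ℕ →₀ R) :=
  LinearMap.BilinMap.toQuadraticMap
    (Finsupp.linearCombination R fun a : ℕ => Finsupp.linearCombination R fun b : ℕ =>
      m (-a - b - 1))

theorem negForm_anticomm {R : Type*} [CommRing R] (m : ℤ → R) (a b : ℕ) :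
    CliffordAlgebra.ι (negForm m) (Finsupp.single a 1) *
      CliffordAlgebra.ι (negForm m) (Finsupp.single b 1) +
    CliffordAlgebra.ι (negForm m) (Finsupp.single b 1) *
      CliffordAlgebra.ι (negForm m) (Finsupp.single a 1) =
    algebraMap R _ (2 * m (-a - b - 1)) := by
  rw [CliffordAlgebra.ι_mul_ι_add_swap, negForm, LinearMap.BilinMap.polar_toQuadraticMap]
  simp only [Finsupp.linearCombination_single, one_smul]
  rw [two_mul, sub_right_comm (-(b : ℤ)), show -(b : ℤ) - 1 - a = -a - b - 1 by ring]

/-- Y is the Clifford algebra tensored with V, on which the generators act by left multiplication.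
Since 2 is invertible the Clifford algebra is linearly isomorphic to the exterior algebra, and
projection to degree zero gives a retraction of v ↦ 1 ⊗ v. -/
theorem exists_clifford_operators {R V : Type u} [CommRing R] [Invertible (2 : R)]
    [AddCommGroup V] [Module R V] (m : ℤ → R) :
    ∃ (Y : Type u) (_ : AddCommGroup Y) (_ : Module R Y) (X : ℕ → Module.End R Y)
      (j : V →ₗ[R] Y), Function.Injective j ∧
      ∀ a b y, X a (X b y) + X b (X a y) = (2 * m (-a - b - 1)) • y := by
  let C := CliffordAlgebra (negForm m)
  let g : ℕ → C := fun a => CliffordAlgebra.ι (negForm m) (Finsupp.single a 1)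
  refine ⟨C ⊗[R] V, inferInstance, inferInstance,
    fun a => LinearMap.rTensor V (LinearMap.mulLeft R (g a)), TensorProduct.mk R C V 1, ?_,
    fun a b y => ?_⟩
  · let p : C →ₗ[R] R := (ExteriorAlgebra.algebraMapInv (R := R)).toLinearMap ∘ₗ
      (CliffordAlgebra.equivExterior (negForm m)).toLinearMap
    have hp : p 1 = 1 := by
      change ExteriorAlgebra.algebraMapInv 
        (CliffordAlgebra.changeForm CliffordAlgebra.changeForm.associated_neg_proof 1) = 1
      rw [CliffordAlgebra.changeForm_one, map_one]
    refine Function.LeftInverse.injective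
      (g := fun y => TensorProduct.lid R V (LinearMap.rTensor V p y)) fun v => ?_
    change TensorProduct.lid R V (p 1 ⊗ₜ[R] v) = v
    rw [hp, TensorProduct.lid_tmul, one_smul]
  · induction y using TensorProduct.induction_on with
    | zero => simp
    | tmul c v =>
      change (g a * (g b * c)) ⊗ₜ[R] v + (g b * (g a * c)) ⊗ₜ[R] v = _
      rw [← TensorProduct.add_tmul, ← mul_assoc, ← mul_assoc, ← add_mul, negForm_anticomm,
        TensorProduct.smul_tmul', Algebra.smul_def]
    | add y z hy hz =>
      rw [smul_add, ← hy, ← hz]; simp only [map_add]; abel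

/-- The M's commute with each other and with the Q's, so they can be treated as scalars from a
commutative ring R; the negative Q's then only have to satisfy Clifford relations over R. -/
theorem exists_clifford_module {R V : Type u} [CommRing R] [Algebra ℂ R] [AddCommGroup V]
    [Module ℂ V] [Module R V] [IsScalarTower ℂ R V] (m : ℤ → R) :
    ∃ (Y : Type u) (_ : AddCommGroup Y) (_ : Module ℂ Y) (π : BMSIndex → Module.End ℂ Y)
      (j : V →ₗ[ℂ] Y), RepOn negMQ π ∧ Function.Injective j ∧
      ∀ n v, j (m n • v) = π (.M n) (j v) := by
  have : Invertible (2 : R) := by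
    have h2 := (invertibleOfNonzero (two_ne_zero (α := ℂ))).map (algebraMap ℂ R)
    rwa [map_ofNat] at h2
  obtain ⟨Y, _, _, X, j, hj, hX⟩ := exists_clifford_operators (V := V) m
  let _ : Module ℂ Y := Module.compHom Y (algebraMap ℂ R)
  have smul_def : ∀ (c : ℂ) (y : Y), c • y = algebraMap ℂ R c • y := fun _ _ => rfl
  have _ : IsScalarTower ℂ R Y := ⟨fun c r y => by
    rw [smul_def, Algebra.smul_def, mul_smul]⟩
  let π : BMSIndex → Module.End ℂ Y
    | .M n => (LinearMap.lsmul R Y (m n)).restrictScalars ℂ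
    | .Q k => (X (-k).toNat).restrictScalars ℂ
    | _ => 0
  have hπM : ∀ n y, π (.M n) y = m n • y := fun _ _ => rfl
  have hπQ : ∀ k y, π (.Q k) y = X (-k).toNat y := fun _ _ => rfl
  refine ⟨Y, inferInstance, inferInstance, π, j.restrictScalars ℂ,
    fun a b ha hb => LinearMap.ext fun y => ?_, hj, fun n v => ?_⟩
  · rcases a with k | k | k | _ | _ <;> rcases b with l | l | l | _ | _
    all_goals simp only [negMQ] at ha hb
    all_goals simp only [sgn, parity, koszulSign, zero_ne_one, and_self, and_true,
      and_false, if_true, if_false, one_smul, LinearMap.sub_apply, Module.End.mul_apply, hπM, hπQ]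
    · rw [smul_smul, smul_smul, mul_comm, sub_self]; simp [basisBracket]
    · rw [map_smul, sub_self]; simp [basisBracket]
    · rw [map_smul, sub_self]; simp [basisBracket]
    · rw [basisBracket_Q_Q ha hb, map_smul, lin_e, neg_smul, one_smul]
      change _ - -(X (-l).toNat (X (-k).toNat y)) = (2 : ℂ) • (m (k + l - 1) • y)
      rw [sub_neg_eq_add, hX, smul_def, smul_smul, map_ofNat, Int.toNat_of_nonneg (by omega),
        Int.toNat_of_nonneg (by omega)]
      congr 3
      ring
  · exact map_smul j _ _

end Clifford

/-! ### Embedding V in a module over the whole algebra; injectivity of v ↦ 1 ⊗ v -/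

theorem RepOn.mono {N : Type*} [AddCommGroup N] [Module ℂ N] {G G' : BMSIndex → Prop}
    {A : BMSIndex → Module.End ℂ N} (h : RepOn G A) (hG : ∀ i, G' i → G i) : RepOn G' A :=
  fun i j hi hj => h i j (hG i hi) (hG j hj)

theorem RepOn.M_comm {N : Type*} [AddCommGroup N] [Module ℂ N] {G : BMSIndex → Prop}
    {A : BMSIndex → Module.End ℂ N} (h : RepOn G A) {m n : ℤ} (hm : G (.M m)) (hn : G (.M n)) :
    A (.M m) * A (.M n) = A (.M n) * A (.M m) := by
  have := h _ _ hm hn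
  simp only [sgn, parity, koszulSign, zero_ne_one, and_self, if_false, one_smul, basisBracket,
    map_zero] at this
  exact sub_eq_zero.1 this

theorem subIndex_or_negMQ (q : ℕ) (i : BMSIndex) :
    subIndex q i ∨ negMQ i ↔ nonnegL i := by
  rcases i with m | m | m | _ | _ <;> simp only [subIndex, negMQ, nonnegL] <;>
    first | trivial | (simp; done) | skip
  all_goals
    simp only [iff_true]
    omega

/-- Every module over `𝔤^{(0,-q)}` embeds into a module over the whole algebra. -/
theorem exists_embedding {V : Type u} [AddCommGroup V] [Module ℂ V] {q : ℕ}
    {ρ : BMSIndex → Module.End ℂ V} (hρ : RepOn (subIndex q) ρ) :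
    ∃ (W : Type u) (_ : AddCommGroup W) (_ : Module ℂ W) (A : BMSIndex → Module.End ℂ W)
      (φ : V →ₗ[ℂ] W), RepOn (fun _ => True) A ∧ Function.Injective φ ∧
      ∀ i, subIndex q i → ∀ v, A i (φ v) = φ (ρ i v) := by
  classical
  -- For n < -q the operator M_n is not given on V. On the auxiliary module any choice commuting
  -- with the others would do; zero is the simplest.
  let m₀ : ℤ → Module.End ℂ V := fun n => if -(q : ℤ) ≤ n then ρ (.M n) else 0
  have comm : ∀ a ∈ Set.range m₀, ∀ b ∈ Set.range m₀, a * b = b * a := by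
    rintro _ ⟨a, rfl⟩ _ ⟨b, rfl⟩
    by_cases ha : -(q : ℤ) ≤ a <;> by_cases hb : -(q : ℤ) ≤ b <;> simp only [m₀, ha, hb, if_true,
      if_false, mul_zero, zero_mul]
    exact hρ.M_comm ha hb
  let _ : CommRing (Algebra.adjoin ℂ (Set.range m₀)) :=
    { (inferInstance : Ring (Algebra.adjoin ℂ (Set.range m₀))) with
      mul_comm := (Algebra.isMulCommutative_adjoin ℂ comm).is_comm.comm }
  let m : ℤ → Algebra.adjoin ℂ (Set.range m₀) := fun n =>
    ⟨m₀ n, Algebra.subset_adjoin ⟨n, rfl⟩⟩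
  obtain ⟨Y, _, _, π, j, hπ, hj, hjM⟩ := exists_clifford_module (V := V) m
  have hcl : Closed fun i => subIndex q i ∨ negMQ i := by
    simp only [subIndex_or_negMQ]; exact closed_nonnegL
  -- The two subalgebras share only the M_n with -q ≤ n < 0, and on these `hjM` gives the required
  -- compatibility.
  obtain ⟨W₁, _, _, A₁, φ₁, hA₁, hφ₁, h₁⟩ := exists_extension (closed_subIndex q) closed_negMQ
    hcl hρ hπ j hj (by
      intro i hi hi' v
      rcases i with n | n | n | _ | _
      · exact hi'.elim
      · rw [← hjM]
        congr 1
        change ρ (.M n) v = m₀ n v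
        simp only [m₀, if_pos (show -(q : ℤ) ≤ n from hi)]
      · have h1 : 1 ≤ n := hi
        have h2 : n ≤ 0 := hi'
        omega
      · exact hi'.elim
      · exact hi'.elim)
  have hA₁' : RepOn nonnegL A₁ := hA₁.mono fun i hi => (subIndex_or_negMQ q i).2 hi
  have hall : ∀ i, nonnegL i ∨ negL i := by
    intro i
    rcases i with n | n | n | _ | _ <;> simp only [nonnegL, negL, true_or]
    exact le_or_gt _ _
  -- No basis vector is common to the two subalgebras, so there is no compatibility to check, and
  -- the trivial action of the negative L's with j the identity suffices.
  obtain ⟨W₂, _, _, A₂, φ₂, hA₂, hφ₂, h₂⟩ := exists_extension closed_nonnegL closed_negL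
    (by simp only [hall]; exact closed_true) hA₁' (π := fun _ => (0 : Module.End ℂ W₁))
    (fun i j _ _ => by simp [Finsupp.linearCombination_apply]) LinearMap.id
    Function.injective_id (by
      intro i hi hi'
      rcases i with n | n | n | _ | _
      · have h1 : 0 ≤ n := hi
        have h2 : n < 0 := hi'
        omega
      all_goals exact hi'.elim)
  refine ⟨W₂, inferInstance, inferInstance, A₂, φ₂ ∘ₗ φ₁, hA₂.mono fun i _ => hall i,
    hφ₂.comp hφ₁, fun i hi v => ?_⟩
  rw [LinearMap.comp_apply, h₂ i ((subIndex_or_negMQ q i).1 (Or.inl hi)), h₁ i hi]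
  rfl

open Classical in
/-- The action of the basis vectors on a `𝔤^{(0,-q)}`-module. -/
noncomputable def subAct {q : ℕ} {V : Type*} [AddCommGroup V] [Module ℂ V]
    (ρ : LieSupermodule (sub q).carrier V) (i : BMSIndex) : Module.End ℂ V :=
  if hi : subIndex q i then ρ.act (subE q i hi) else 0

section

variable {q : ℕ} {V : Type u} [AddCommGroup V] [Module ℂ V]
  (ρ : LieSupermodule (sub q).carrier V)

theorem subAct_of {i : BMSIndex} (hi : subIndex q i) : subAct ρ i = ρ.act (subE q i hi) :=
  dif_pos hi

theorem lin_subAct (x : (sub q).carrier) : lin (subAct ρ) x.1 = ρ.act x := by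
  have key : ∀ y : BMS, y ∈ Finsupp.supported ℂ ℂ {i | subIndex q i} →
      ∀ h : y ∈ (sub q).carrier, lin (subAct ρ) y = ρ.act ⟨y, h⟩ := by
    intro y hy
    refine supported_induction (P := fun y => y ∈ (sub q).carrier ∧ ∀ h : y ∈ (sub q).carrier,
      lin (subAct ρ) y = ρ.act ⟨y, h⟩) hy ?_ ?_ ?_ ?_ |>.2
    · intro i hi
      exact ⟨(subE q i hi).2, fun h => by rw [lin_e, subAct_of ρ hi]; rfl⟩
    · refine ⟨Submodule.zero_mem _, fun h => ?_⟩
      rw [map_zero]; exact (map_zero ρ.act).symm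
    · rintro x y ⟨hx, hx'⟩ ⟨hy, hy'⟩
      refine ⟨Submodule.add_mem _ hx hy, fun h => ?_⟩
      rw [map_add, hx' hx, hy' hy, ← map_add]; rfl
    · rintro c x ⟨hx, hx'⟩
      refine ⟨Submodule.smul_mem _ c hx, fun h => ?_⟩
      rw [map_smul, hx' hx, ← map_smul]; rfl
  exact key x.1 x.2 x.2

theorem repOn_subAct : RepOn (subIndex q) (subAct ρ) := by
  intro i j hi hj
  have hm : ∀ i (hi : subIndex q i),
      subE q i hi ∈ (LieSuperSubalgebra.instLieSuperalgebra (sub q)).part (parity i) :=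
    fun i hi => e_mem_gradedPart i rfl
  have hb : (LieSuperSubalgebra.instLieSuperalgebra (sub q)).bracket (subE q i hi) (subE q j hj) =
      ⟨basisBracket i j, closed_subIndex q i j hi hj⟩ :=
    Subtype.ext (bracketMap_e i j)
  have h := lin_subAct ρ ⟨basisBracket i j, closed_subIndex q i j hi hj⟩
  rw [h, subAct_of ρ hi, subAct_of ρ hj, ← hb]
  exact LinearMap.ext fun v => (ρ.act_bracket (hm i hi) (hm j hj) v).symm

/-- A representation of the whole algebra gives a representation of the enveloping algebra. -/
theorem exists_enveloping_hom {W : Type*} [AddCommGroup W] [Module ℂ W]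
    {A : BMSIndex → Module.End ℂ W} (hA : RepOn (fun _ => True) A) :
    ∃ U : Enveloping BMS →ₐ[ℂ] Module.End ℂ W, ∀ x, U (Enveloping.ι x) = lin A x := by
  have hrel : ∀ ⦃x y : TensorAlgebra ℂ BMS⦄, EnvelopingRel BMS x y →
      TensorAlgebra.lift ℂ (lin A) x = TensorAlgebra.lift ℂ (lin A) y := by
    rintro _ _ ⟨hx, hy⟩
    rename_i a b x y
    simp only [map_sub, map_mul, map_smul, TensorAlgebra.lift_ι_apply]
    change _ = lin A (bracketMap x y)
    refine gradedPart_induction (P := fun x => lin A x * lin A y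
      - koszulSign a b • (lin A y * lin A x) = lin A (bracketMap x y)) hx
      (fun i hi => ?_) (by simp)
      (fun x x' h h' => by
        simp only [map_add, LinearMap.add_apply, add_mul, mul_add, ← h, ← h']; module)
      (fun c x h => by
        simp only [map_smul, LinearMap.smul_apply, smul_mul_assoc, mul_smul_comm, ← h]; module)
    refine gradedPart_induction (P := fun y => lin A (e i) * lin A y
      - koszulSign a b • (lin A y * lin A (e i)) = lin A (bracketMap (e i) y)) hy
      (fun j hj => ?_) (by simp)
      (fun x x' h h' => by
        simp only [map_add, add_mul, mul_add, ← h, ← h']; module)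
      (fun c x h => by
        simp only [map_smul, smul_mul_assoc, mul_smul_comm, ← h]; module)
    subst hi hj
    rw [lin_e, lin_e, bracketMap_e]
    exact hA i j trivial trivial
  refine ⟨RingQuot.liftAlgHom ℂ ⟨TensorAlgebra.lift ℂ (lin A), hrel⟩, fun x => ?_⟩
  have h := RingQuot.liftAlgHom_mkAlgHom_apply ℂ (A := TensorAlgebra ℂ BMS)
    (s := EnvelopingRel BMS) (B := Module.End ℂ W)
  refine (h _ _ _).trans ?_
  simp

/-- The embedding φ of V into a module W over the whole algebra extends to the map u ⊗ v ↦ u φ(v) on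
the induced module; its restriction to 1 ⊗ V is the injective φ. -/
theorem indMk_one_injective : Function.Injective (ρ.indMk 1) := by
  obtain ⟨W, _, _, A, φ, hA, hφ, h⟩ := exists_embedding (repOn_subAct ρ)
  obtain ⟨U, hU⟩ := exists_enveloping_hom hA
  have hx : ∀ (x : (sub q).carrier) v, lin A x.1 (φ v) = φ (ρ.act x v) := by
    intro x v
    have h1 : lin (fun i => A i (φ v)) x.1 = lin (fun i => φ (subAct ρ i v)) x.1 :=
      lin_congr x.2 fun i hi => h i hi v
    have h2 := map_lin (LinearMap.applyₗ (φ v)) A x.1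
    have h3 := map_lin (φ ∘ₗ LinearMap.applyₗ v) (subAct ρ) x.1
    rw [lin_subAct] at h3
    exact h2.trans (h1.trans h3.symm)
  let Ψ : Enveloping BMS ⊗[ℂ] V →ₗ[ℂ] W :=
    TensorProduct.lift (U.toLinearMap.compl₂ φ)
  have hΨ : ∀ u v, Ψ (u ⊗ₜ v) = U u (φ v) := fun _ _ => rfl
  have hle : ρ.indRel ≤ LinearMap.ker Ψ := by
    rw [LieSupermodule.indRel, Submodule.span_le]
    rintro _ ⟨u, x, v, rfl⟩
    rw [SetLike.mem_coe, LinearMap.mem_ker, map_sub, hΨ, hΨ, map_mul, hU, Module.End.mul_apply,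
      hx, sub_self]
  intro v w hvw
  apply hφ
  have := congrArg (ρ.indRel.liftQ Ψ hle) hvw
  simpa [LieSupermodule.indMk, hΨ] using this

end

/-! ### Subspaces generated by a set of operators -/

section Closure

variable {N : Type*} [AddCommGroup N] [Module ℂ N] (A : BMSIndex → Module.End ℂ N)
  (V₀ : Submodule ℂ N)

/-- The smallest subspace that contains `V₀` and is stable under `A i` for `i` satisfying `S`. -/
def cl (S : BMSIndex → Prop) : Submodule ℂ N :=
  sInf {U | V₀ ≤ U ∧ ∀ i, S i → ∀ u ∈ U, A i u ∈ U}

variable {A V₀} {S S' : BMSIndex → Prop}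

theorem le_cl : V₀ ≤ cl A V₀ S := le_sInf fun _ hU => hU.1

theorem cl_stable {i : BMSIndex} (hi : S i) {u : N} (hu : u ∈ cl A V₀ S) :
    A i u ∈ cl A V₀ S := by
  rw [cl, Submodule.mem_sInf] at hu ⊢
  exact fun U hU => hU.2 i hi u (hu U hU)

/-- Induction principle: in the inductive step the vector may also be assumed to lie in the
generated subspace. -/
theorem cl_le {U : Submodule ℂ N} (h₀ : V₀ ≤ U)
    (h : ∀ i, S i → ∀ u ∈ cl A V₀ S, u ∈ U → A i u ∈ U) : cl A V₀ S ≤ U := by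
  have : cl A V₀ S ≤ cl A V₀ S ⊓ U :=
    sInf_le ⟨le_inf le_cl h₀, fun i hi u hu => ⟨cl_stable hi hu.1, h i hi u hu.1 hu.2⟩⟩
  exact this.trans inf_le_right

theorem cl_mono (h : ∀ i, S i → S' i) : cl A V₀ S ≤ cl A V₀ S' :=
  cl_le le_cl fun i hi _ _ hu => cl_stable (h i hi) hu

/-- The subspaces for an increasing sequence of label sets form a chain, so their union is a
subspace stable under S. -/
theorem exists_mem_cl {F : ℕ → BMSIndex → Prop} (hF : ∀ m n, m ≤ n → ∀ i, F m i → F n i)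
    (hS : ∀ i, S i → ∃ m, F m i) {u : N} (hu : u ∈ cl A V₀ S) : ∃ m, u ∈ cl A V₀ (F m) := by
  let U : ℕ → Submodule ℂ N := fun m => cl A V₀ (F m)
  have hmono : Monotone U := fun m n h => cl_mono (hF m n h)
  have hdir : Directed (· ≤ ·) U := hmono.directed_le
  have hle : cl A V₀ S ≤ ⨆ m, U m := by
    refine cl_le (le_trans le_cl (le_iSup U 0)) fun i hi u _ hu => ?_
    obtain ⟨m, hm⟩ := hS i hi
    obtain ⟨n, hn⟩ := (Submodule.mem_iSup_of_directed U hdir).1 hu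
    have h2 : u ∈ cl A V₀ (F (max m n)) := hmono (le_max_right m n) hn
    exact (Submodule.mem_iSup_of_directed U hdir).2
      ⟨max m n, cl_stable (hF m _ (le_max_left _ _) i hm) h2⟩
  exact (Submodule.mem_iSup_of_directed U hdir).1 (hle hu)

theorem lin_apply_mem {U : Submodule ℂ N} {w : N} {p : BMSIndex → Prop} {x : BMS}
    (hx : x ∈ Finsupp.supported ℂ ℂ {i | p i}) (h : ∀ i, p i → A i w ∈ U) : lin A x w ∈ U :=
  supported_induction (P := fun x => lin A x w ∈ U) hx (fun i hi => by rw [lin_e]; exact h i hi)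
    (by simp) (fun x y hx hy => by rw [map_add]; exact U.add_mem hx hy)
    (fun c x hx => by rw [map_smul]; exact U.smul_mem c hx)

end Closure

/-! ### Modules generated by a subspace satisfying the hypotheses -/

/-- The operator `M_t + δ_{t,0} (n² - 1) / 24 c₂`. -/
noncomputable def zOp {N : Type*} [AddCommGroup N] [Module ℂ N] (A : BMSIndex → Module.End ℂ N)
    (t : ℕ) (z : ℂ) (n : ℤ) : Module.End ℂ N :=
  A (.M t) + (δ t * ((n : ℂ) ^ 2 - 1) / 24 * z) • 1

/-- A module over the whole algebra generated by a subspace `V₀` with the properties assumed of a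
`𝔤^{(0,-q)}`-module in the simplicity criterion for induced modules. -/
structure Generated {N : Type*} [AddCommGroup N] [Module ℂ N] (A : BMSIndex → Module.End ℂ N)
    (V₀ : Submodule ℂ N) (q t : ℕ) (z₁ z : ℂ) : Prop where
  rep : RepOn (fun _ => True) A
  c₁_apply : ∀ w, A .c₁ w = z₁ • w
  c₂_apply : ∀ w, A .c₂ w = z • w
  stable : ∀ i, subIndex q i → ∀ v ∈ V₀, A i v ∈ V₀
  M_apply : ∀ i : ℤ, t < i → ∀ v ∈ V₀, A (.M i) v = 0
  L_apply : ∀ i : ℤ, t + q < i → ∀ v ∈ V₀, A (.L i) v = 0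
  Q_apply : ∀ i : ℤ, t < i → ∀ v ∈ V₀, A (.Q i) v = 0
  injective : ∀ n : ℤ, n ≠ 0 → ∀ v ∈ V₀, zOp A t z n v = 0 → v = 0
  generates : cl A V₀ (fun _ => True) = ⊤

namespace Generated

variable {N : Type*} [AddCommGroup N] [Module ℂ N] {A : BMSIndex → Module.End ℂ N}
  {V₀ : Submodule ℂ N} {q t : ℕ} {z₁ z : ℂ} (D : Generated A V₀ q t z₁ z)
include D

theorem apply_apply (i j : BMSIndex) (w : N) :
    A i (A j w) = sgn i j • A j (A i w) + lin A (basisBracket i j) w := by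
  rw [← D.rep i j trivial trivial]
  simp

theorem L_L (m n : ℤ) (w : N) : A (.L m) (A (.L n) w) = A (.L n) (A (.L m) w)
    + ((m : ℂ) - n) • A (.L (m + n)) w + (δ (m + n) * ((m : ℂ) ^ 3 - m) / 12 * z₁) • w := by
  rw [D.apply_apply]
  simp [sgn, parity, koszulSign, basisBracket, lin_e, D.c₁_apply, smul_smul, add_assoc]

theorem L_M (m n : ℤ) (w : N) : A (.L m) (A (.M n) w) = A (.M n) (A (.L m) w)
    + ((m : ℂ) - n) • A (.M (m + n)) w + (δ (m + n) * ((m : ℂ) ^ 3 - m) / 12 * z) • w := by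
  rw [D.apply_apply]
  simp [sgn, parity, koszulSign, basisBracket, lin_e, D.c₂_apply, smul_smul, add_assoc]

theorem L_Q (m k : ℤ) (w : N) : A (.L m) (A (.Q k) w) = A (.Q k) (A (.L m) w)
    + ((m : ℂ) / 2 - ((k : ℂ) - 1 / 2)) • A (.Q (m + k)) w := by
  rw [D.apply_apply]
  simp [sgn, parity, koszulSign, basisBracket, lin_e]

theorem M_M (m n : ℤ) (w : N) : A (.M m) (A (.M n) w) = A (.M n) (A (.M m) w) := by
  rw [D.apply_apply]
  simp [sgn, parity, koszulSign, basisBracket]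

theorem M_Q (m k : ℤ) (w : N) : A (.M m) (A (.Q k) w) = A (.Q k) (A (.M m) w) := by
  rw [D.apply_apply]
  simp [sgn, parity, koszulSign, basisBracket]

theorem Q_Q (k l : ℤ) (w : N) : A (.Q k) (A (.Q l) w) = -A (.Q l) (A (.Q k) w)
    + (2 : ℂ) • A (.M (k + l - 1)) w
    + (δ (k + l - 1) * (((k : ℂ) - 1 / 2) ^ 2 - 1 / 4) / 3 * z) • w := by
  rw [D.apply_apply]
  simp [sgn, parity, koszulSign, basisBracket, lin_e, D.c₂_apply, smul_smul, add_assoc]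

end Generated

/-- The labels of the basis vectors `M n` with `n ≥ -q - m`. -/
def fromM (q m : ℕ) : BMSIndex → Prop
  | .M n => -(q : ℤ) - m ≤ n
  | _ => False

/-- The labels of all `M n`. -/
def allM : BMSIndex → Prop
  | .M _ => True
  | _ => False

/-- The labels of all `M n` and of `Q_{k - 1/2}` with `k ≥ 1 - m`. -/
def fromQ (m : ℕ) : BMSIndex → Prop
  | .M _ => True
  | .Q k => 1 - (m : ℤ) ≤ k
  | _ => False

/-- The labels of all `M n` and `Q_{k - 1/2}`. -/
def allMQ : BMSIndex → Prop
  | .M _ => True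
  | .Q _ => True
  | _ => False

/-- The labels of `L j` with `j > 0` and `Q_{k - 1/2}` with `k ≥ 1`. -/
def pos : BMSIndex → Prop
  | .L j => 0 < j
  | .Q k => 1 ≤ k
  | _ => False

/-- The properties of a set of labels of basis vectors `M n` and `Q_{k - 1/2}` needed below. -/
structure IsUpper (t : ℕ) (S : BMSIndex → Prop) : Prop where
  le : ∀ i, S i → allMQ i
  M_t : S (.M t)
  M : ∀ m n, m ≤ n → S (.M m) → S (.M n)
  Q : ∀ k l, k ≤ l → S (.Q k) → S (.Q l)
  M_of_Q : ∀ k n, S (.Q k) → S (.M n)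

theorem isUpper_fromM (q m t : ℕ) : IsUpper t (fromM q m) := by
  refine ⟨?_, ?_, fun a b hab h => ?_, fun a b hab h => h.elim, fun k n h => h.elim⟩
  · rintro (n | n | n | _ | _) h <;> first | exact h.elim | trivial
  · simp only [fromM]; omega
  · simp only [fromM] at h ⊢; omega

theorem isUpper_fromQ (m t : ℕ) : IsUpper t (fromQ m) := by
  refine ⟨?_, trivial, fun a b hab h => trivial, fun a b hab h => ?_, fun k n h => trivial⟩
  · rintro (n | n | n | _ | _) h <;> first | exact h.elim | trivial
  · simp only [fromQ] at h ⊢; omega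

theorem isUpper_allM (t : ℕ) : IsUpper t allM := by
  refine ⟨?_, trivial, fun a b hab h => trivial, fun a b hab h => h, fun k n h => trivial⟩
  rintro (n | n | n | _ | _) h <;> first | exact h.elim | trivial

theorem isUpper_allMQ (t : ℕ) : IsUpper t allMQ :=
  ⟨fun _ h => h, trivial, fun _ _ _ _ => trivial, fun _ _ _ _ => trivial, fun _ _ _ => trivial⟩

namespace Generated

variable {N : Type*} [AddCommGroup N] [Module ℂ N] {A : BMSIndex → Module.End ℂ N}
  {V₀ : Submodule ℂ N} {q t : ℕ} {z₁ z : ℂ} (D : Generated A V₀ q t z₁ z)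
include D

/-- M_i is central among the M's and Q's, so it vanishes on everything they generate from V₀. -/
theorem M_apply_cl {i : ℤ} (hi : t < i) {u : N} (hu : u ∈ cl A V₀ allMQ) : A (.M i) u = 0 := by
  have : cl A V₀ allMQ ≤ LinearMap.ker (A (.M i)) := by
    refine cl_le (fun v hv => D.M_apply i hi v hv) fun j hj u _ hu => ?_
    rw [LinearMap.mem_ker] at hu ⊢
    rcases j with n | n | n | _ | _
    · exact hj.elim
    · rw [D.M_M, hu, map_zero]
    · rw [D.M_Q, hu, map_zero]
    · exact hj.elim
    · exact hj.elim
  exact this hu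

/-- Commuting L_j, j ≥ 0, past an M or a Q can only raise the index, and label sets of this kind are
closed under raising indices. -/
theorem L_mem_cl {S : BMSIndex → Prop} (hS : IsUpper t S) {j : ℤ} (hj : 0 ≤ j) {u : N}
    (hu : u ∈ cl A V₀ S) : A (.L j) u ∈ cl A V₀ S := by
  suffices cl A V₀ S ≤ (cl A V₀ S).comap (A (.L j)) from this hu
  refine cl_le (fun v hv => le_cl (D.stable (.L j) hj v hv)) fun i hi u hu hL => ?_
  rw [Submodule.mem_comap] at hL ⊢
  rcases i with n | n | n | _ | _
  · exact (hS.le _ hi).elim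
  · rw [D.L_M]
    exact Submodule.add_mem _ (Submodule.add_mem _ (cl_stable hi hL)
      (Submodule.smul_mem _ _ (cl_stable (hS.M _ _ (by omega) hi) hu)))
      (Submodule.smul_mem _ _ hu)
  · rw [D.L_Q]
    exact Submodule.add_mem _ (cl_stable hi hL)
      (Submodule.smul_mem _ _ (cl_stable (hS.Q _ _ (by omega) hi) hu))
  · exact (hS.le _ hi).elim
  · exact (hS.le _ hi).elim

theorem Q_mem_cl {S : BMSIndex → Prop} (hS : IsUpper t S) {k : ℤ} (hk : 1 ≤ k) {u : N}
    (hu : u ∈ cl A V₀ S) : A (.Q k) u ∈ cl A V₀ S := by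
  suffices cl A V₀ S ≤ (cl A V₀ S).comap (A (.Q k)) from this hu
  refine cl_le (fun v hv => le_cl (D.stable (.Q k) hk v hv)) fun i hi u hu hL => ?_
  rw [Submodule.mem_comap] at hL ⊢
  rcases i with n | n | n | _ | _
  · exact (hS.le _ hi).elim
  · rw [← D.M_Q]
    exact cl_stable hi hL
  · rw [D.Q_Q]
    exact Submodule.add_mem _ (Submodule.add_mem _ (Submodule.neg_mem _ (cl_stable hi hL))
      (Submodule.smul_mem _ _ (cl_stable (hS.M_of_Q _ _ hi) hu)))
      (Submodule.smul_mem _ _ hu)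
  · exact (hS.le _ hi).elim
  · exact (hS.le _ hi).elim

theorem pos_mem_cl {S : BMSIndex → Prop} (hS : IsUpper t S) {i : BMSIndex} (hi : pos i) {u : N}
    (hu : u ∈ cl A V₀ S) : A i u ∈ cl A V₀ S := by
  rcases i with n | n | n | _ | _
  · exact D.L_mem_cl hS (le_of_lt hi) hu
  · exact hi.elim
  · exact D.Q_mem_cl hS hi hu
  · exact hi.elim
  · exact hi.elim

omit D in
theorem zOp_apply (n : ℤ) (w : N) :
    zOp A t z n w = A (.M t) w + (δ t * ((n : ℂ) ^ 2 - 1) / 24 * z) • w := rfl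

omit D in
theorem zOp_mem_cl {S : BMSIndex → Prop} (hS : IsUpper t S) (n : ℤ) {u : N}
    (hu : u ∈ cl A V₀ S) : zOp A t z n u ∈ cl A V₀ S :=
  Submodule.add_mem _ (cl_stable hS.M_t hu) (Submodule.smul_mem _ _ hu)

/-- The only obstruction is [L_j, M_t], a multiple of M_{t+j}, which vanishes on this subspace
because j > 0; the central term is absent since j + t ≠ 0. -/
theorem pos_zOp {i : BMSIndex} (hi : pos i) (n : ℤ) {u : N} (hu : u ∈ cl A V₀ allMQ) :
    A i (zOp A t z n u) = zOp A t z n (A i u) := by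
  rcases i with j | j | j | _ | _
  · have hj : 0 < j := hi
    have h0 : δ (j + t) = 0 := if_neg (by omega)
    rw [zOp_apply, zOp_apply, map_add, map_smul, D.L_M, D.M_apply_cl (by omega) hu, h0]
    simp
  · exact hi.elim
  · rw [zOp_apply, zOp_apply, map_add, map_smul, D.M_Q]
  · exact hi.elim
  · exact hi.elim

omit D in
/-- Every nonzero subspace of `U` that is stable under positive basis vectors meets `V₀`. -/
def Meets (A : BMSIndex → Module.End ℂ N) (V₀ U : Submodule ℂ N) : Prop :=
  ∀ W : Submodule ℂ N, W ≤ U → (∀ i, pos i → ∀ w ∈ W, A i w ∈ W) → ∀ w ∈ W, w ≠ 0 →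
    ∃ v ∈ W, v ∈ V₀ ∧ v ≠ 0

/-- The kernel within the generated subspace is stable under the positive generators, so if it were
nonzero it would contain a nonzero vector of V₀, where the operator is injective. This carries
hypothesis (a) from one layer to the next. -/
theorem zOp_injective {S : BMSIndex → Prop} (hS : IsUpper t S) (hm : Meets A V₀ (cl A V₀ S))
    {n : ℤ} (hn : n ≠ 0) {u : N} (hu : u ∈ cl A V₀ S) (h : zOp A t z n u = 0) : u = 0 := by
  by_contra h0
  obtain ⟨v, hv, hv0, hne⟩ := hm (cl A V₀ S ⊓ LinearMap.ker (zOp A t z n)) inf_le_left (by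
    rintro i hi w ⟨hw, hw'⟩
    refine ⟨D.pos_mem_cl hS hi hw, ?_⟩
    have hw0 : zOp A t z n w = 0 := hw'
    change zOp A t z n (A i w) = 0
    rw [← D.pos_zOp hi n (cl_mono hS.le hw), hw0, map_zero]) u ⟨hu, h⟩ h0
  exact hne (D.injective n hn v hv0 hv.2)

/-! #### The generators `M n` -/

/-- Commuting L_j past M_n with n ≥ -q - m leaves a multiple of M_{j+n} with j + n > t, which is
zero here, and no central term. -/
theorem L_apply_fromM (m : ℕ) {j : ℤ} (hj : t + q + m < j) {u : N}
    (hu : u ∈ cl A V₀ (fromM q m)) : A (.L j) u = 0 := by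
  have hS := isUpper_fromM q m t
  suffices cl A V₀ (fromM q m) ≤ LinearMap.ker (A (.L j)) from this hu
  refine cl_le (fun v hv => D.L_apply j (by omega) v hv) fun i hi u hu hL => ?_
  rw [LinearMap.mem_ker] at hL ⊢
  rcases i with n | n | n | _ | _
  · exact hi.elim
  · have hn : -(q : ℤ) - m ≤ n := hi
    have h0 : δ (j + n) = 0 := if_neg (by omega)
    rw [D.L_M, hL, D.M_apply_cl (by omega) (cl_mono hS.le hu), h0]
    simp
  · exact hi.elim
  · exact hi.elim
  · exact hi.elim

omit D in
/-- The sums of powers of `y` applied to elements of `U`. -/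
noncomputable def powSpan (U : Submodule ℂ N) (y : Module.End ℂ N) : Submodule ℂ N :=
  ⨆ k : ℕ, U.map (y ^ k)

omit D in
theorem pow_mem_powSpan {U : Submodule ℂ N} {y : Module.End ℂ N} {u : N} (hu : u ∈ U) (k : ℕ) :
    (y ^ k) u ∈ powSpan U y :=
  le_iSup (fun k : ℕ => U.map (y ^ k)) k ⟨u, hu, rfl⟩

omit D in
theorem powSpan_stable {U : Submodule ℂ N} {y T : Module.End ℂ N} (hT : Commute T y)
    (h : ∀ u ∈ U, T u ∈ U) {w : N} (hw : w ∈ powSpan U y) : T w ∈ powSpan U y := by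
  suffices powSpan U y ≤ (powSpan U y).comap T from this hw
  refine iSup_le fun k => ?_
  rintro _ ⟨u, hu, rfl⟩
  rw [Submodule.mem_comap, ← Module.End.mul_apply, (hT.pow_right k).eq]
  exact pow_mem_powSpan (h u hu) k

omit D in
theorem powSpan_self {U : Submodule ℂ N} {y : Module.End ℂ N} {w : N} (hw : w ∈ powSpan U y) :
    y w ∈ powSpan U y := by
  suffices powSpan U y ≤ (powSpan U y).comap y from this hw
  refine iSup_le fun k => ?_
  rintro _ ⟨u, hu, rfl⟩
  rw [Submodule.mem_comap, ← Module.End.mul_apply, ← pow_succ']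
  exact pow_mem_powSpan hu _

omit D in
/-- If `[x, y] = Z` commutes with `y` and is injective on `U`, and `x U = 0`, then every nonzero
`x`-stable subspace of `powSpan U y` meets `U`. -/
theorem exists_mem_of_powSpan {U W : Submodule ℂ N} {x y Z : Module.End ℂ N}
    (hxU : ∀ u ∈ U, x u = 0) (hxy : ∀ w ∈ powSpan U y, x (y w) = y (x w) + Z w)
    (hZy : Commute Z y) (hZU : ∀ u ∈ U, Z u ∈ U)
    (hZ : ∀ u ∈ U, Z u = 0 → u = 0) (hW : ∀ w ∈ W, x w ∈ W) {w : N} (hw : w ∈ W)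
    (hwU : w ∈ powSpan U y) (h0 : w ≠ 0) : ∃ u ∈ W, u ∈ U ∧ u ≠ 0 := by
  have hpow : ∀ k : ℕ, ∀ u ∈ U, x ((y ^ (k + 1)) u) = ((k : ℂ) + 1) • (y ^ k) (Z u) := by
    intro k u hu
    have hZk : ∀ k : ℕ, Z ((y ^ k) u) = (y ^ k) (Z u) := fun k => by
      rw [← Module.End.mul_apply, (hZy.pow_right k).eq]; rfl
    induction k with
    | zero => simpa [hxU u hu] using hxy u (by simpa using pow_mem_powSpan (y := y) hu 0)
    | succ k ih =>
      rw [pow_succ', Module.End.mul_apply, hxy _ (pow_mem_powSpan hu _), ih, hZk, map_smul,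
        ← Module.End.mul_apply, ← pow_succ']
      push_cast
      module
  -- Applying x differentiates a polynomial in y: the degree drops by one and the top coefficient is
  -- multiplied by a positive integer and by the injective Z. Repetition leaves a nonzero constant
  -- term in W, and no uniqueness of coefficients is needed.
  have key : ∀ (K : ℕ) (g : ℕ → N), (∀ k, g k ∈ U) → g K ≠ 0 →
      ∑ k ∈ Finset.range (K + 1), (y ^ k) (g k) ∈ W → ∃ u ∈ W, u ∈ U ∧ u ≠ 0 := by
    intro K
    induction K with
    | zero =>
      intro g hg h0 h
      exact ⟨g 0, by simpa using h, hg 0, h0⟩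
    | succ K ih =>
      intro g hg h0 h
      refine ih (fun k => ((k : ℂ) + 1) • Z (g (k + 1)))
        (fun k => U.smul_mem _ (hZU _ (hg _))) ?_ ?_
      · exact smul_ne_zero (Nat.cast_add_one_ne_zero K) fun h => h0 (hZ _ (hg _) h)
      · have := hW _ h
        rw [Finset.sum_range_succ', map_add, map_sum, pow_zero, Module.End.one_apply,
          hxU _ (hg 0), add_zero] at this
        simpa only [hpow _ _ (hg _), map_smul] using this
  obtain ⟨f, hf, hfw⟩ := (Submodule.mem_iSup_iff_exists_finsupp _ _).1 hwU
  choose g hg hgf using hf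
  have hfne : f.support.Nonempty := by
    rw [Finsupp.support_nonempty_iff]
    rintro rfl
    exact h0 (by simpa using hfw.symm)
  refine key (f.support.max' hfne) g hg (fun h => ?_) ?_
  · have h1 := f.support.max'_mem hfne
    rw [Finsupp.mem_support_iff, ← hgf, h, map_zero] at h1
    exact h1 rfl
  · simp only [hgf]
    have : ∑ k ∈ Finset.range (f.support.max' hfne + 1), f k = f.sum fun _ x => x := by
      refine (Finsupp.sum_of_support_subset f (fun k hk => ?_) (fun _ x => x)
        fun _ _ => rfl).symm
      rw [Finset.mem_range]
      exact Nat.lt_succ_of_le (f.support.le_max' k hk)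
    rw [this, hfw]
    exact hw

/-- Each step adjoins y = M_{-q-m-1} and uses x = L_{t+q+m+1}, which kills the space already built
and has commutator a nonzero multiple of Z_n with y. So W meets the smaller space, and the induction
hypothesis applies there. -/
theorem meets_fromM (m : ℕ) : Meets A V₀ (cl A V₀ (fromM q m)) := by
  induction m with
  | zero =>
    intro W hWU _ w hw h0
    have : cl A V₀ (fromM q 0) ≤ V₀ := cl_le le_rfl fun i hi u _ hu => D.stable i (by
      rcases i with n | n | n | _ | _ <;> first | exact hi.elim | skip
      simpa [fromM, subIndex] using hi) u hu
    exact ⟨w, hw, this (hWU hw), h0⟩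
  | succ m ih =>
    intro W hWU hW w hw h0
    set U := cl A V₀ (fromM q m) with hU
    set y := A (.M (-(q : ℤ) - m - 1)) with hy
    have hS := isUpper_fromM q m t
    have hMy : ∀ n, Commute (A (.M n)) y := fun n => LinearMap.ext fun w => D.M_M _ _ _
    have hle : cl A V₀ (fromM q (m + 1)) ≤ powSpan U y := by
      refine cl_le (le_cl.trans fun u hu => by simpa using pow_mem_powSpan (y := y) hu 0)
        fun i hi u _ hu => ?_
      rcases i with n | n | n | _ | _ <;> first | exact hi.elim | skip
      have hn : -(q : ℤ) - (m + 1 : ℕ) ≤ n := hi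
      rcases hn.eq_or_lt with h | h
      · have : n = -(q : ℤ) - m - 1 := by push_cast at h; omega
        rw [this]
        exact powSpan_self hu
      · exact powSpan_stable (hMy n) (fun u hu => cl_stable (by
          simp only [fromM]; push_cast at h; omega) hu) hu
    have hle' : powSpan U y ≤ cl A V₀ allMQ := by
      refine iSup_le fun k => ?_
      rintro _ ⟨u, hu, rfl⟩
      induction k with
      | zero => exact cl_mono hS.le hu
      | succ k ih =>
        rw [pow_succ']
        exact cl_stable (S := allMQ) (i := .M _) trivial ih
    let n : ℤ := q + m + 1
    have hn : n ≠ 0 := by omega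
    -- This is the coefficient in [L_{t+n}, M_{-n}] = (t + 2n) M_t + central term. For t = 0 the
    -- central term (n³ - n)/12 equals 2n (n² - 1)/24, so the whole bracket is c times `zOp`.
    let c : ℂ := t + 2 * n
    have hc : c ≠ 0 := by
      have : ((t + 2 * n : ℤ) : ℂ) ≠ 0 := Int.cast_ne_zero.2 (by omega)
      simpa [c] using this
    obtain ⟨u, huW, huU, hu0⟩ := exists_mem_of_powSpan (U := U) (W := W)
      (x := A (.L (t + q + m + 1))) (y := y) (Z := c • zOp A t z n)
      (fun u hu => D.L_apply_fromM m (by omega) hu)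
      (fun w hw => by
        have hidx : (t + q + m + 1 : ℤ) + (-(q : ℤ) - m - 1) = t := by ring
        rw [hy, D.L_M, hidx, add_assoc]
        congr 1
        rw [LinearMap.smul_apply, zOp_apply, smul_add, smul_smul]
        congr 2
        · simp only [c, n]; push_cast; ring
        · by_cases ht : t = 0
          · subst ht
            simp only [c, n, δ, Nat.cast_zero, if_true]; push_cast; ring
          · rw [δ, if_neg (by omega)]; simp)
      (((hMy t).add_left ((Commute.one_left y).smul_left _)).smul_left c)
      (fun u hu => U.smul_mem _ (zOp_mem_cl hS n hu))
      (fun u hu h => D.zOp_injective hS ih hn hu ((smul_eq_zero.1 h).resolve_left hc))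
      (hW _ (show (0 : ℤ) < t + q + m + 1 by omega)) hw (hle (hWU hw)) h0
    obtain ⟨v, hv, hv0, hne⟩ := ih (W ⊓ U) inf_le_right
      (fun i hi w hw => ⟨hW i hi w hw.1, D.pos_mem_cl hS hi hw.2⟩) u ⟨huW, huU⟩ hu0
    exact ⟨v, hv.1, hv0, hne⟩

theorem meets_allM : Meets A V₀ (cl A V₀ allM) := by
  intro W hWU hW w hw h0
  obtain ⟨m, hm⟩ := exists_mem_cl (F := fromM q) (fun m n hmn i hi => by
      rcases i with k | k | k | _ | _ <;> first | exact hi.elim | skip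
      simp only [fromM] at hi ⊢; omega)
    (fun i hi => by
      rcases i with k | k | k | _ | _ <;> first | exact hi.elim | skip
      exact ⟨(-k).toNat, by simp only [fromM]; omega⟩) (hWU hw)
  obtain ⟨v, hv, hv0, hne⟩ := D.meets_fromM m (W ⊓ cl A V₀ (fromM q m)) inf_le_right
    (fun i hi w hw => ⟨hW i hi w hw.1, D.pos_mem_cl (isUpper_fromM q m t) hi hw.2⟩) w ⟨hw, hm⟩ h0
  exact ⟨v, hv.1, hv0, hne⟩

/-! #### The generators `Q_{k - 1/2}` -/

theorem Q_apply_fromQ (m : ℕ) {j : ℤ} (hj : t + m < j) {u : N}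
    (hu : u ∈ cl A V₀ (fromQ m)) : A (.Q j) u = 0 := by
  have hS := isUpper_fromQ m t
  suffices cl A V₀ (fromQ m) ≤ LinearMap.ker (A (.Q j)) from this hu
  refine cl_le (fun v hv => D.Q_apply j (by omega) v hv) fun i hi u hu hL => ?_
  rw [LinearMap.mem_ker] at hL ⊢
  rcases i with n | n | n | _ | _
  · exact hi.elim
  · rw [← D.M_Q, hL, map_zero]
  · have hn : 1 - (m : ℤ) ≤ n := hi
    have h0 : δ (j + n - 1) = 0 := if_neg (by omega)
    rw [D.Q_Q, hL, D.M_apply_cl (by omega) (cl_mono hS.le hu), h0]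
    simp
  · exact hi.elim
  · exact hi.elim

/-- Each step adjoins y = Q_{-m-1/2}. As y² is an M already present, every vector is a + y b with a,
b in the smaller space U, and Q_{t+m+1/2}, which kills U, sends it to 2 Z_{2m+1} b. So W meets U
either in a (when b = 0) or in this nonzero vector. -/
theorem meets_fromQ (m : ℕ) : Meets A V₀ (cl A V₀ (fromQ m)) := by
  induction m with
  | zero =>
    intro W hWU hW w hw h0
    refine D.meets_allM W (hWU.trans (cl_le le_cl fun i hi u _ hu => ?_)) hW w hw h0
    rcases i with n | n | n | _ | _ <;> first | exact hi.elim | skip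
    · exact cl_stable (S := allM) (i := .M _) trivial hu
    · exact D.Q_mem_cl (isUpper_allM t) (by simpa [fromQ] using hi) hu
  | succ m ih =>
    intro W hWU hW w hw h0
    set U := cl A V₀ (fromQ m) with hU
    set y := A (.Q (-(m : ℤ))) with hy
    have hS := isUpper_fromQ m t
    have hyy : ∀ u, y (y u) = A (.M (-(m : ℤ) - m - 1)) u := by
      intro u
      have h := D.Q_Q (-m) (-m) u
      have h0 : δ (-(m : ℤ) + -m - 1) = 0 := if_neg (by omega)
      rw [← sub_eq_add_neg] at h h0
      rw [h0, ← hy] at h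
      simp only [zero_mul, zero_div, zero_smul, add_zero] at h
      have h2 : (2 : ℂ) • y (y u) = (2 : ℂ) • A (.M (-(m : ℤ) - m - 1)) u := by
        rw [two_smul]; nth_rewrite 1 [h]; abel
      exact smul_right_injective N (two_ne_zero (α := ℂ)) h2
    have hle : cl A V₀ (fromQ (m + 1)) ≤ U ⊔ U.map y := by
      refine cl_le (le_cl.trans le_sup_left) fun i hi u _ hu => ?_
      obtain ⟨a, ha, _, ⟨b, hb, rfl⟩, rfl⟩ := Submodule.mem_sup.1 hu
      rcases i with n | n | n | _ | _ <;> first | exact hi.elim | skip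
      · rw [map_add, hy, D.M_Q]
        exact Submodule.add_mem_sup (cl_stable (S := fromQ m) (i := .M _) trivial ha)
          ⟨_, cl_stable (S := fromQ m) (i := .M _) trivial hb, rfl⟩
      · have hn : 1 - ((m + 1 : ℕ) : ℤ) ≤ n := hi
        rcases hn.eq_or_lt with h | h
        · have : n = -(m : ℤ) := by push_cast at h; omega
          rw [this, ← hy, map_add, hyy, add_comm]
          exact Submodule.add_mem_sup (cl_stable (S := fromQ m) (i := .M _) trivial hb) ⟨a, ha, rfl⟩
        · have hn' : fromQ m (.Q n) := by simp only [fromQ]; push_cast at h; omega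
          rw [map_add, hy, D.Q_Q]
          refine Submodule.add_mem _ (Submodule.mem_sup_left (cl_stable hn' ha))
            (Submodule.add_mem _ (Submodule.add_mem _ (Submodule.neg_mem _
              (Submodule.mem_sup_right ⟨_, cl_stable hn' hb, rfl⟩)) (Submodule.smul_mem _ _
              (Submodule.mem_sup_left (cl_stable (S := fromQ m) (i := .M _) trivial hb))))
              (Submodule.smul_mem _ _ (Submodule.mem_sup_left hb)))
    have descend : ∀ u ∈ W, u ∈ U → u ≠ 0 → ∃ v ∈ W, v ∈ V₀ ∧ v ≠ 0 := by
      intro u huW huU hu0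
      obtain ⟨v, hv, hv0, hne⟩ := ih (W ⊓ U) inf_le_right
        (fun i hi w hw => ⟨hW i hi w hw.1, D.pos_mem_cl hS hi hw.2⟩) u ⟨huW, huU⟩ hu0
      exact ⟨v, hv.1, hv0, hne⟩
    obtain ⟨a, ha, _, ⟨b, hb, rfl⟩, rfl⟩ := Submodule.mem_sup.1 (hle (hWU hw))
    by_cases hb0 : b = 0
    · subst hb0
      rw [map_zero, add_zero] at hw h0
      exact descend a hw ha h0
    · have hx : A (.Q (t + m + 1)) (a + y b) = (2 : ℂ) • zOp A t z (2 * m + 1) b := by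
        have hidx : (t + m + 1 : ℤ) + -m - 1 = t := by ring
        rw [map_add, D.Q_apply_fromQ m (by omega) ha, hy, D.Q_Q, hidx,
          D.Q_apply_fromQ m (by omega) hb, map_zero, neg_zero, zero_add, zero_add, zOp_apply,
          smul_add, smul_smul]
        congr 2
        by_cases ht : t = 0
        · subst ht
          simp only [δ, Nat.cast_zero, if_true]; push_cast; ring
        · rw [δ, if_neg (by omega)]; simp
      have hxW := hW (.Q (t + m + 1)) (show (1 : ℤ) ≤ t + m + 1 by omega) _ hw
      rw [hx] at hxW
      refine descend _ hxW (U.smul_mem _ (zOp_mem_cl hS _ hb)) (smul_ne_zero two_ne_zero fun h => ?_)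
      exact hb0 (D.zOp_injective hS ih (by omega) hb h)

theorem meets_allMQ : Meets A V₀ (cl A V₀ allMQ) := by
  intro W hWU hW w hw h0
  obtain ⟨m, hm⟩ := exists_mem_cl (F := fromQ) (fun m n hmn i hi => by
      rcases i with k | k | k | _ | _ <;> first | exact hi.elim | trivial | skip
      simp only [fromQ] at hi ⊢; omega)
    (fun i hi => by
      rcases i with k | k | k | _ | _ <;> first | exact hi.elim | exact ⟨0, trivial⟩ | skip
      exact ⟨(1 - k).toNat, by simp only [fromQ]; omega⟩) (hWU hw)
  obtain ⟨v, hv, hv0, hne⟩ := D.meets_fromQ m (W ⊓ cl A V₀ (fromQ m)) inf_le_right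
    (fun i hi w hw => ⟨hW i hi w hw.1, D.pos_mem_cl (isUpper_fromQ m t) hi hw.2⟩) w ⟨hw, hm⟩ h0
  exact ⟨v, hv.1, hv0, hne⟩

end Generated

/-! ### Removing words in the negative L by products of high M -/

section LoweringOps

variable {N : Type*} [AddCommGroup N] [Module ℂ N] (A : BMSIndex → Module.End ℂ N) (t : ℕ)

/-- The operator `L_{-n-1}`. -/
def lowL (n : ℕ) : Module.End ℂ N := A (.L (-(n : ℤ) - 1))

/-- The operator `M_{t+n+1}`. -/
def highM (n : ℕ) : Module.End ℂ N := A (.M (t + n + 1))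

/-- A product of operators `L_{-n-1}`. -/
def lowWord (b : List ℕ) : Module.End ℂ N := (b.map (lowL A)).prod

/-- A product of operators `M_{t+n+1}`. -/
def highWord (a : List ℕ) : Module.End ℂ N := (a.map (highM A t)).prod

/-- The commutator of `M_{t+j+1}` and `L_{-n-1}`. -/
def highLow (j n : ℕ) : Module.End ℂ N := highM A t j * lowL A n - lowL A n * highM A t j

/-- The product of the commutators of `M_{t+n+1}` and `L_{-n-1}` for `n` in a list. -/
def highLowWord (b : List ℕ) : Module.End ℂ N := (b.map fun n => highLow A t n n).prod

theorem lowWord_cons (n : ℕ) (b : List ℕ) (w : N) :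
    lowWord A (n :: b) w = lowL A n (lowWord A b w) := by simp [lowWord]

theorem highWord_cons (n : ℕ) (b : List ℕ) (w : N) :
    highWord A t (n :: b) w = highM A t n (highWord A t b w) := by simp [highWord]

theorem highLowWord_cons (n : ℕ) (b : List ℕ) (w : N) :
    highLowWord A t (n :: b) w = highLow A t n n (highLowWord A t b w) := by simp [highLowWord]

end LoweringOps

namespace Generated

variable {N : Type*} [AddCommGroup N] [Module ℂ N] {A : BMSIndex → Module.End ℂ N}
  {V₀ : Submodule ℂ N} {q t : ℕ} {z₁ z : ℂ} (D : Generated A V₀ q t z₁ z)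
include D

theorem highLow_apply (j n : ℕ) (w : N) : highLow A t j n w =
    ((t : ℂ) + j + n + 2) • A (.M (t + j - n)) w
      + (δ (t + j - n) * (((n : ℂ) + 1) ^ 3 - (n + 1)) / 12 * z) • w := by
  have h := D.L_M (-(n : ℤ) - 1) (t + j + 1) w
  have e : -(n : ℤ) - 1 + (t + j + 1) = t + j - n := by ring
  rw [e] at h
  change A (.M (t + j + 1)) (A (.L (-(n : ℤ) - 1)) w) - A (.L (-(n : ℤ) - 1)) (A (.M (t + j + 1)) w)
    = _
  rw [h]
  push_cast
  module

/-- The commutator is a multiple of M_{t+j-n}, whose index exceeds t, and the central term is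
absent. -/
theorem highLow_eq_zero {j n : ℕ} (h : n < j) {u : N} (hu : u ∈ cl A V₀ allMQ) :
    highLow A t j n u = 0 := by
  have h0 : δ (t + j - n) = 0 := if_neg (by omega)
  rw [D.highLow_apply, D.M_apply_cl (by omega) hu, h0]
  simp

theorem highLow_self (n : ℕ) (w : N) : highLow A t n n w =
    ((t : ℂ) + 2 * (n + 1)) • zOp A t z (n + 1) w := by
  have e : (t : ℤ) + n - n = t := by ring
  rw [D.highLow_apply, e, zOp_apply, smul_add, smul_smul]
  congr 2
  · ring
  · by_cases ht : t = 0
    · subst ht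
      simp only [δ, Nat.cast_zero, if_true]; push_cast; ring
    · rw [δ, if_neg (by omega)]; simp

theorem highLow_mem (j n : ℕ) {u : N} (hu : u ∈ cl A V₀ allMQ) :
    highLow A t j n u ∈ cl A V₀ allMQ := by
  rw [D.highLow_apply]
  exact Submodule.add_mem _ (Submodule.smul_mem _ _ (cl_stable (i := .M _) trivial hu))
    (Submodule.smul_mem _ _ hu)

theorem highLow_self_injective (n : ℕ) {u : N} (hu : u ∈ cl A V₀ allMQ)
    (h : highLow A t n n u = 0) : u = 0 := by
  rw [D.highLow_self] at h
  refine D.zOp_injective (isUpper_allMQ t) D.meets_allMQ (by omega) hu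
    ((smul_eq_zero.1 h).resolve_left ?_)
  exact_mod_cast (show t + 2 * (n + 1) ≠ 0 by omega)

theorem highM_highLow (i j n : ℕ) (w : N) :
    highM A t i (highLow A t j n w) = highLow A t j n (highM A t i w) := by
  rw [D.highLow_apply, D.highLow_apply, map_add, map_smul, map_smul]
  congr 2
  exact D.M_M _ _ _

/-- Leibniz rule: commutation with L_{-n-1} acts as a derivation on a product of M's. The
commutators are combinations of M's and scalars, hence commute with the remaining factors and can be
moved to the front. -/
theorem highWord_lowL (a : List ℕ) (n : ℕ) (w : N) :
    highWord A t a (lowL A n w) = lowL A n (highWord A t a w) +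
      ∑ i ∈ Finset.range a.length,
        highLow A t (a.getD i 0) n (highWord A t (a.eraseIdx i) w) := by
  induction a with
  | nil => simp [highWord]
  | cons j a ih =>
    rw [List.length_cons, Finset.sum_range_succ', highWord_cons, ih, map_add, map_sum]
    simp only [List.getD_cons_succ, List.eraseIdx_cons_succ, List.getD_cons_zero,
      List.eraseIdx_cons_zero, highWord_cons, D.highM_highLow]
    have : highM A t j (lowL A n (highWord A t a w)) = lowL A n (highM A t j (highWord A t a w))
        + highLow A t j n (highWord A t a w) := by
      simp [highLow]
    rw [this]
    abel

theorem highWord_eq_zero {a : List ℕ} (ha : a ≠ []) {u : N} (hu : u ∈ cl A V₀ allMQ) :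
    highWord A t a u = 0 := by
  induction a with
  | nil => exact absurd rfl ha
  | cons j a ih =>
    rw [highWord_cons]
    by_cases h : a = []
    · subst h
      exact D.M_apply_cl (by omega) hu
    · rw [ih h, map_zero]

/-- Each L can absorb only one M, so some M_{t+j+1} survives to act on a vector that it kills. -/
theorem highWord_lowWord_eq_zero {a b : List ℕ} (hab : b.length < a.length) {u : N}
    (hu : u ∈ cl A V₀ allMQ) : highWord A t a (lowWord A b u) = 0 := by
  induction b generalizing a with
  | nil =>
    refine D.highWord_eq_zero (fun h => ?_) hu
    simp [h] at hab
  | cons n b ih =>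
    rw [List.length_cons] at hab
    rw [lowWord_cons, D.highWord_lowL, ih (by omega), map_zero, zero_add]
    refine Finset.sum_eq_zero fun i hi => ?_
    rw [ih, map_zero]
    rw [List.length_eraseIdx_of_lt (Finset.mem_range.1 hi)]
    omega

theorem highWord_lowWord_mem {a b : List ℕ} (hab : a.length = b.length) {u : N}
    (hu : u ∈ cl A V₀ allMQ) : highWord A t a (lowWord A b u) ∈ cl A V₀ allMQ := by
  induction b generalizing a with
  | nil =>
    rw [List.length_nil, List.length_eq_zero_iff] at hab
    subst hab
    simpa [highWord, lowWord] using hu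
  | cons n b ih =>
    rw [List.length_cons] at hab
    rw [lowWord_cons, D.highWord_lowL, D.highWord_lowWord_eq_zero (by omega) hu, map_zero,
      zero_add]
    refine Submodule.sum_mem _ fun i hi => D.highLow_mem _ _ (ih ?_)
    rw [List.length_eraseIdx_of_lt (Finset.mem_range.1 hi)]
    omega

theorem highLowWord_mem (b : List ℕ) {u : N} (hu : u ∈ cl A V₀ allMQ) :
    highLowWord A t b u ∈ cl A V₀ allMQ := by
  induction b with
  | nil => simpa [highLowWord] using hu
  | cons n b ih =>
    rw [highLowWord_cons]
    exact D.highLow_mem _ _ ih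

theorem highLowWord_injective (b : List ℕ) {u : N} (hu : u ∈ cl A V₀ allMQ)
    (h : highLowWord A t b u = 0) : u = 0 := by
  induction b with
  | nil => simpa [highLowWord] using h
  | cons n b ih =>
    rw [highLowWord_cons] at h
    exact ih (D.highLow_self_injective n (D.highLowWord_mem b hu) h)

/-- Expanding by the Leibniz rule pairs the letters of a with those of b. A pair (j, n) contributes
zero if j > n, so a surviving pairing has j ≤ n throughout, and the inequality of sums forces
equality in every pair. Thus k counts the pairings of equal letters, and it is nonzero exactly when
a and b are permutations of each other. -/
theorem highWord_lowWord {a b : List ℕ} (hab : a.length = b.length) (hs : b.sum ≤ a.sum) {u : N}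
    (hu : u ∈ cl A V₀ allMQ) : ∃ k : ℕ, highWord A t a (lowWord A b u) = k • highLowWord A t b u ∧
      (k ≠ 0 ↔ a.Perm b) := by
  induction b generalizing a with
  | nil =>
    rw [List.length_nil, List.length_eq_zero_iff] at hab
    subst hab
    exact ⟨1, by simp [highWord, lowWord, highLowWord], by simp⟩
  | cons n b ih =>
    rw [List.length_cons] at hab
    have hterm : ∀ i ∈ Finset.range a.length, ∃ k : ℕ,
        highLow A t (a.getD i 0) n (highWord A t (a.eraseIdx i) (lowWord A b u)) =
          k • highLowWord A t (n :: b) u ∧ (k ≠ 0 ↔ a.getD i 0 = n ∧ a.Perm (n :: b)) := by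
      intro i hi
      have hi' := Finset.mem_range.1 hi
      have hl : (a.eraseIdx i).length = b.length := by
        rw [List.length_eraseIdx_of_lt hi']; omega
      have hp : (a.getD i 0 :: a.eraseIdx i).Perm a := by
        rw [List.getD_eq_getElem _ _ hi']
        exact List.getElem_cons_eraseIdx_perm hi'
      have hsum := hp.sum_eq
      rw [List.sum_cons] at hsum hs
      rcases lt_trichotomy n (a.getD i 0) with h | h | h
      · refine ⟨0, ?_, by simp only [ne_eq, not_true, false_iff]; omega⟩
        rw [D.highLow_eq_zero h (D.highWord_lowWord_mem hl hu), zero_smul]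
      · obtain ⟨k, hk, hk'⟩ := ih hl (by omega)
        refine ⟨k, ?_, ?_⟩
        · rw [hk, ← h, map_nsmul, highLowWord_cons]
        · rw [hk', ← h]
          rw [← h] at hp
          simp only [true_and]
          exact ⟨fun h2 => hp.symm.trans (h2.cons n), fun h2 => (hp.trans h2).cons_inv⟩
      -- Here the removed letter of a is smaller than n, so the rest of a has strictly larger sum
      -- than b; they cannot be permutations and the induction hypothesis gives coefficient zero.
      · obtain ⟨k, hk, hk'⟩ := ih hl (by omega)
        have hk0 : k = 0 := by
          by_contra hk0
          have := (hk'.1 hk0).sum_eq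
          omega
        refine ⟨0, ?_, by simp only [ne_eq, not_true, false_iff]; omega⟩
        rw [hk, hk0, zero_smul, map_zero, zero_smul]
    choose! k hk hk' using hterm
    refine ⟨∑ i ∈ Finset.range a.length, k i, ?_, ?_⟩
    · rw [lowWord_cons, D.highWord_lowL, D.highWord_lowWord_eq_zero (by omega) hu, map_zero,
        zero_add, Finset.sum_smul]
      exact Finset.sum_congr rfl hk
    · rw [ne_eq, Finset.sum_eq_zero_iff]
      constructor
      · intro h
        push Not at h
        obtain ⟨i, hi, hi'⟩ := h
        exact ((hk' i hi).1 hi').2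
      · intro h h0
        obtain ⟨i, hi, hin⟩ := List.getElem_of_mem (h.symm.subset (List.mem_cons_self (a := n)))
        have hi' := Finset.mem_range.2 hi
        exact (hk' i hi').2 ⟨by rw [List.getD_eq_getElem _ _ hi, hin], h⟩ (h0 i hi')

/-! #### The filtration by the number of factors `L_{-n}` -/

omit D in
/-- The span of words with less than `d` factors `L_{-n-1}` applied to the subspace generated by
`V₀` under `M` and `Q`. -/
def filt (A : BMSIndex → Module.End ℂ N) (V₀ : Submodule ℂ N) (d : ℕ) : Submodule ℂ N :=
  Submodule.span ℂ {w | ∃ b : List ℕ, b.length < d ∧ ∃ u ∈ cl A V₀ allMQ, lowWord A b u = w}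

omit D in
theorem lowWord_mem_filt {b : List ℕ} {d : ℕ} (hb : b.length < d) {u : N}
    (hu : u ∈ cl A V₀ allMQ) : lowWord A b u ∈ filt A V₀ d :=
  Submodule.subset_span ⟨b, hb, u, hu, rfl⟩

omit D in
theorem filt_le {d : ℕ} {U : Submodule ℂ N} (h : ∀ b : List ℕ, b.length < d →
    ∀ u ∈ cl A V₀ allMQ, lowWord A b u ∈ U) : filt A V₀ d ≤ U := by
  rw [filt, Submodule.span_le]
  rintro _ ⟨b, hb, u, hu, rfl⟩
  exact h b hb u hu

omit D in
theorem filt_mono {d d' : ℕ} (h : d ≤ d') : filt A V₀ d ≤ filt A V₀ d' :=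
  filt_le fun _ hb _ hu => lowWord_mem_filt (by omega) hu

omit D in
theorem lowL_mem_filt (n : ℕ) {d : ℕ} {w : N} (hw : w ∈ filt A V₀ d) :
    lowL A n w ∈ filt A V₀ (d + 1) := by
  suffices filt A V₀ d ≤ (filt A V₀ (d + 1)).comap (lowL A n) from this hw
  refine filt_le fun b hb u hu => ?_
  rw [Submodule.mem_comap, ← lowWord_cons]
  exact lowWord_mem_filt (by simpa using hb) hu

omit D in
theorem exists_lowL {i : BMSIndex} (hi : negL i) : ∃ n, A i = lowL A n := by
  rcases i with n | n | n | _ | _ <;> first | exact hi.elim | skip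
  have hn : n < 0 := hi
  refine ⟨(-n - 1).toNat, ?_⟩
  rw [lowL, Int.toNat_of_nonneg (by omega)]
  congr 2
  ring

/-- A generator other than a negative L can be moved to the right through the word: each commutator
either shortens the word or replaces a letter by another negative L, so the number of L factors does
not grow. -/
theorem apply_lowWord_mem (b : List ℕ) {i : BMSIndex} (hi : ¬ negL i) {u : N}
    (hu : u ∈ cl A V₀ allMQ) : A i (lowWord A b u) ∈ filt A V₀ (b.length + 1) := by
  induction b generalizing i with
  | nil =>
    have : A i u ∈ cl A V₀ allMQ := by
      rcases i with n | n | n | _ | _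
      · exact D.L_mem_cl (isUpper_allMQ t) (not_lt.1 hi) hu
      · exact cl_stable (i := .M _) trivial hu
      · exact cl_stable (i := .Q _) trivial hu
      · rw [D.c₁_apply]; exact Submodule.smul_mem _ _ hu
      · rw [D.c₂_apply]; exact Submodule.smul_mem _ _ hu
    exact lowWord_mem_filt (b := []) (by simp) this
  | cons n b ih =>
    rw [lowWord_cons, lowL, D.apply_apply]
    refine Submodule.add_mem _ (Submodule.smul_mem _ _ (lowL_mem_filt n (ih hi)))
      (lin_apply_mem (p := fun _ => True) (by simp) fun k _ => ?_)
    by_cases hk : negL k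
    · obtain ⟨m, hm⟩ := exists_lowL (A := A) hk
      rw [hm, ← lowWord_cons]
      exact lowWord_mem_filt (by simp) hu
    · exact filt_mono (by simp) (ih hk)

theorem exists_mem_filt (w : N) : ∃ d, w ∈ filt A V₀ d := by
  have hdir : Directed (· ≤ ·) (filt A V₀) := Monotone.directed_le fun _ _ => filt_mono
  rw [← Submodule.mem_iSup_of_directed _ hdir]
  have hw : w ∈ cl A V₀ fun _ => True := by rw [D.generates]; trivial
  refine cl_le ?_ (fun i _ u _ hu => ?_) hw
  · exact fun v hv => Submodule.mem_iSup_of_mem 1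
      (lowWord_mem_filt (b := []) (by simp) (le_cl hv))
  · rw [Submodule.mem_iSup_of_directed _ hdir] at hu ⊢
    obtain ⟨d, hd⟩ := hu
    refine ⟨d + 1, ?_⟩
    by_cases hi : negL i
    · obtain ⟨m, hm⟩ := exists_lowL (A := A) hi
      rw [hm]
      exact lowL_mem_filt m hd
    · suffices filt A V₀ d ≤ (filt A V₀ (d + 1)).comap (A i) from this hd
      exact filt_le fun b hb u hu => filt_mono (by omega) (D.apply_lowWord_mem b hi hu)

/-- Swapping two neighbours costs one factor L_{-n-m-2}, so the word becomes shorter; the indices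
are both negative, hence no central term. -/
theorem lowWord_sub_mem_filt {b b' : List ℕ} (h : b.Perm b') {u : N}
    (hu : u ∈ cl A V₀ allMQ) : lowWord A b u - lowWord A b' u ∈ filt A V₀ b.length := by
  induction h with
  | nil => simp
  | cons n _ ih =>
    rw [lowWord_cons, lowWord_cons, ← map_sub]
    exact lowL_mem_filt n ih
  | swap m n b =>
    have h0 : δ (-(n : ℤ) - 1 + (-(m : ℤ) - 1)) = 0 := if_neg (by omega)
    have e : -(n : ℤ) - 1 + (-(m : ℤ) - 1) = -((n + m + 1 : ℕ) : ℤ) - 1 := by push_cast; ring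
    simp only [lowWord_cons]
    rw [lowL, lowL, D.L_L, h0, e]
    simp only [zero_mul, zero_div, zero_smul, add_zero, add_sub_cancel_left]
    refine Submodule.smul_mem _ _ ?_
    exact lowWord_mem_filt (b := (n + m + 1) :: b) (by simp) hu
  | trans h₁ _ ih₁ ih₂ =>
    have := Submodule.add_mem _ ih₁ (h₁.length_eq ▸ ih₂)
    rwa [sub_add_sub_cancel] at this

/-- Modulo shorter words the order of the factors is irrelevant, so leading terms can be indexed by
multisets. -/
theorem filt_succ_le (d : ℕ) : filt A V₀ (d + 1) ≤
    (Finsupp.submodule fun s : Multiset ℕ =>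
      if s.card = d then cl A V₀ allMQ else ⊥).map
      (Finsupp.lsum ℂ fun s : Multiset ℕ => lowWord A s.toList) ⊔ filt A V₀ d := by
  refine filt_le fun b hb u hu => ?_
  rcases (Nat.lt_succ_iff.1 hb).lt_or_eq with h | h
  · exact Submodule.mem_sup_right (lowWord_mem_filt h hu)
  · have hp : b.Perm (b : Multiset ℕ).toList := by
      rw [← Multiset.coe_eq_coe, Multiset.coe_toList]
    rw [← sub_add_cancel (lowWord A b u) (lowWord A (b : Multiset ℕ).toList u), add_comm]
    refine Submodule.add_mem_sup ⟨Finsupp.single (b : Multiset ℕ) u, fun s => ?_, by simp⟩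
      (h ▸ D.lowWord_sub_mem_filt hp hu)
    by_cases hs : (b : Multiset ℕ) = s
    · subst hs
      simpa [h] using hu
    · rw [Finsupp.single_eq_of_ne (Ne.symm hs)]
      exact Submodule.zero_mem _

/-- Write w with the least possible number e of L factors and choose a leading multiset s of maximal
sum. The product of M's attached to s kills all shorter words and all other leading words, by
maximality, and turns the s-term into a nonzero multiple of injective operators applied to its
coefficient. -/
theorem exists_mem_allMQ {W : Submodule ℂ N} (hW : ∀ i, ∀ w ∈ W, A i w ∈ W) {w : N} (hw : w ∈ W)
    (h0 : w ≠ 0) : ∃ u ∈ W, u ∈ cl A V₀ allMQ ∧ u ≠ 0 := by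
  classical
  have hex := D.exists_mem_filt w
  obtain ⟨e, he⟩ : ∃ e, Nat.find hex = e + 1 := by
    refine Nat.exists_eq_succ_of_ne_zero fun h => h0 ?_
    have := Nat.find_spec hex
    rw [h] at this
    simpa [filt] using this
  have hmem := Nat.find_spec hex
  have hmin := Nat.find_min hex (m := e) (by omega)
  rw [he] at hmem
  obtain ⟨_, ⟨f, hf, rfl⟩, g, hg, rfl⟩ := Submodule.mem_sup.1 (D.filt_succ_le e hmem)
  have hfU : ∀ s, f s ∈ cl A V₀ allMQ := fun s => by
    have h : f s ∈ if s.card = e then cl A V₀ allMQ else ⊥ := hf s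
    split_ifs at h with hs
    · exact h
    · rw [(Submodule.mem_bot ℂ).1 h]; exact Submodule.zero_mem _
  have hfc : ∀ s ∈ f.support, s.card = e := fun s hs => by
    by_contra hne
    have h : f s ∈ if s.card = e then cl A V₀ allMQ else ⊥ := hf s
    rw [if_neg hne, Submodule.mem_bot] at h
    exact Finsupp.mem_support_iff.1 hs h
  have hne : f.support.Nonempty := by
    rw [Finsupp.support_nonempty_iff]
    rintro rfl
    rw [map_zero, zero_add] at hmin
    exact hmin hg
  -- Maximality of the sum supplies the hypothesis on sums in `highWord_lowWord` for every other
  -- leading term.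
  obtain ⟨s, hs, hmax⟩ := Finset.exists_max_image f.support Multiset.sum hne
  have hgz : highWord A t s.toList g = 0 := by
    suffices filt A V₀ e ≤ LinearMap.ker (highWord A t s.toList) from this hg
    exact filt_le fun b hb u hu => D.highWord_lowWord_eq_zero (by simpa [hfc s hs] using hb) hu
  have hval : ∀ s' ∈ f.support, ∃ k : ℕ, highWord A t s.toList (lowWord A s'.toList (f s')) =
      k • highLowWord A t s'.toList (f s') ∧ (k ≠ 0 ↔ s.toList.Perm s'.toList) := fun s' hs' =>
    D.highWord_lowWord (by simp [hfc s hs, hfc s' hs']) (by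
      simpa [← Multiset.sum_coe] using hmax s' hs') (hfU s')
  have hperm : ∀ s', s.toList.Perm s'.toList ↔ s = s' := fun s' => by
    rw [← Multiset.coe_eq_coe, Multiset.coe_toList, Multiset.coe_toList]
  obtain ⟨k, hk, hk'⟩ := hval s hs
  have hX : highWord A t s.toList (Finsupp.lsum ℂ (fun s : Multiset ℕ => lowWord A s.toList) f
      + g) = k • highLowWord A t s.toList (f s) := by
    rw [map_add, hgz, add_zero, Finsupp.lsum_apply, Finsupp.sum, map_sum,
      Finset.sum_eq_single s, hk]
    · intro s' hs' hss
      obtain ⟨k', h1, h2⟩ := hval s' hs'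
      have : k' = 0 := by
        by_contra h
        exact hss ((hperm s').1 (h2.1 h)).symm
      rw [h1, this, zero_smul]
    · exact fun h => absurd hs h
  have hWX : ∀ (a : List ℕ) (w : N), w ∈ W → highWord A t a w ∈ W := by
    intro a
    induction a with
    | nil => intro w hw; simpa [highWord] using hw
    | cons j a ih => intro w hw; rw [highWord_cons]; exact hW _ _ (ih w hw)
  have hfin := hWX s.toList _ hw
  rw [hX] at hfin
  rw [← Nat.cast_smul_eq_nsmul ℂ] at hfin
  refine ⟨_, hfin, Submodule.smul_mem _ _ (D.highLowWord_mem _ (hfU s)), ?_⟩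
  refine smul_ne_zero (Nat.cast_ne_zero.2 (hk'.2 (List.Perm.refl _))) fun h => ?_
  exact Finsupp.mem_support_iff.1 hs (D.highLowWord_injective _ (hfU s) h)

/-- Every nonzero submodule meets the generating subspace. -/
theorem exists_mem_of_stable {W : Submodule ℂ N} (hW : ∀ i, ∀ w ∈ W, A i w ∈ W) {w : N}
    (hw : w ∈ W) (h0 : w ≠ 0) : ∃ v ∈ W, v ∈ V₀ ∧ v ≠ 0 := by
  obtain ⟨u, huW, hu, hu0⟩ := D.exists_mem_allMQ hW hw h0
  obtain ⟨v, hv, hv0, hne⟩ := D.meets_allMQ (W ⊓ cl A V₀ allMQ) inf_le_right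
    (fun i hi w hw => ⟨hW i w hw.1, D.pos_mem_cl (isUpper_allMQ t) hi hw.2⟩) u ⟨huW, hu⟩ hu0
  exact ⟨v, hv.1, hv0, hne⟩

end Generated

/-! ### Vanishing of the high Q on V, and reduction of simplicity to meeting 1 ⊗ V -/

section Final

variable {q : ℕ} {V : Type u} [AddCommGroup V] [Module ℂ V]
  (ρ : LieSupermodule (sub q).carrier V)

theorem sub_act_mem {W : Submodule ℂ V} (h : ∀ i, subIndex q i → ∀ w ∈ W, subAct ρ i w ∈ W)
    (x : (sub q).carrier) {w : V} (hw : w ∈ W) : ρ.act x w ∈ W := by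
  rw [← lin_subAct]
  exact lin_apply_mem x.2 fun i hi => h i hi w hw

theorem subAct_subAct {i j : BMSIndex} (hi : subIndex q i) (hj : subIndex q j) (v : V) :
    subAct ρ i (subAct ρ j v) = sgn i j • subAct ρ j (subAct ρ i v)
      + lin (subAct ρ) (basisBracket i j) v := by
  rw [← repOn_subAct ρ i j hi hj]
  simp

theorem subAct_M {n : ℕ} : subAct ρ (.M n) = ρ.act (subM q n) :=
  subAct_of ρ _

theorem subAct_L {n : ℕ} : subAct ρ (.L n) = ρ.act (subL q n) :=
  subAct_of ρ _

/-- The vectors killed by `Q_{i - 1/2}` for all `i > s`. -/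
noncomputable def kerQ (s : ℕ) : Submodule ℂ V :=
  ⨅ i : ℤ, ⨅ _ : (s : ℤ) < i, LinearMap.ker (subAct ρ (.Q i))

theorem mem_kerQ {s : ℕ} {v : V} :
    v ∈ kerQ ρ s ↔ ∀ i : ℤ, (s : ℤ) < i → subAct ρ (.Q i) v = 0 := by
  simp [kerQ]

variable {t : ℕ} (hM : ∀ i : ℤ, t < i → ∀ v, subAct ρ (.M i) v = 0)
  (hL : ∀ i : ℤ, t + q < i → ∀ v, subAct ρ (.L i) v = 0)
include hM

theorem subAct_Q_Q {i k : ℤ} (hi : 1 ≤ i) (hk : 1 ≤ k) (hik : t < i + k - 1) (v : V) :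
    subAct ρ (.Q i) (subAct ρ (.Q k) v) = -subAct ρ (.Q k) (subAct ρ (.Q i) v) := by
  have h0 : δ (i + k - 1) = 0 := if_neg (by omega)
  rw [subAct_subAct ρ (i := .Q i) (j := .Q k) hi hk]
  simp [sgn, parity, koszulSign, basisBracket, h0, lin_e, hM _ hik]

/-- Gradedness: an odd operator sends the two homogeneous components of a vector to different
parities, so both images vanish. Stability: commuting Q_{i-1/2} past L_n, n ≥ 0, keeps the index
above t; past another positive Q it leaves an M that vanishes on V. -/
theorem isSubmodule_kerQ : ρ.IsSubmodule (kerQ ρ t) := by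
  constructor
  · intro v hv
    rw [mem_kerQ] at hv
    obtain ⟨a, ha, b, hb, rfl⟩ : ∃ a ∈ ρ.part 0, ∃ b ∈ ρ.part 1, a + b = v :=
      Submodule.mem_sup.1 (by rw [ρ.isCompl_part.sup_eq_top]; trivial)
    have hab : ∀ i : ℤ, (t : ℤ) < i → subAct ρ (.Q i) a = 0 ∧ subAct ρ (.Q i) b = 0 := by
      intro i hi
      have hsub : subIndex q (.Q i) := show (1 : ℤ) ≤ i by omega
      have hodd : subE q (.Q i) hsub ∈
          (LieSuperSubalgebra.instLieSuperalgebra (sub q)).part 1 := e_mem_gradedPart _ rfl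
      have h := hv i hi
      rw [subAct_of ρ hsub] at h ⊢
      have h1 := ρ.act_mem hodd ha
      have h0 := ρ.act_mem hodd hb
      rw [show (1 + 0 : ZMod 2) = 1 from rfl] at h1
      rw [show (1 + 1 : ZMod 2) = 0 from rfl] at h0
      rw [map_add] at h
      have hz := Submodule.disjoint_def.1 ρ.isCompl_part.disjoint _ h0
        (by rw [← neg_eq_of_add_eq_zero_right h]; exact Submodule.neg_mem _ h1)
      rw [hz, add_zero] at h
      exact ⟨h, hz⟩
    exact Submodule.add_mem_sup ⟨(mem_kerQ ρ).2 fun i hi => (hab i hi).1, ha⟩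
      ⟨(mem_kerQ ρ).2 fun i hi => (hab i hi).2, hb⟩
  · intro x w hw
    refine sub_act_mem ρ (fun j hj w hw => ?_) x hw
    rw [mem_kerQ] at hw ⊢
    intro i hi
    have hsub : subIndex q (.Q i) := show (1 : ℤ) ≤ i by omega
    rcases j with n | n | n | _ | _
    · have hn : 0 ≤ n := hj
      rw [subAct_subAct ρ hsub hj, hw i hi]
      simp [basisBracket, lin_e, hw (n + i) (by omega)]
    · rw [subAct_subAct ρ hsub hj, hw i hi]
      simp [basisBracket]
    · have hn : 1 ≤ n := hj
      rw [subAct_Q_Q ρ hM (by omega) hn (by omega), hw i hi, map_zero, neg_zero]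
    · rw [subAct_subAct ρ hsub hj, hw i hi]
      simp [basisBracket]
    · rw [subAct_subAct ρ hsub hj, hw i hi]
      simp [basisBracket]

include hL

omit hM in
-- [L_{i-1}, Q_{1/2}] = ((i - 2)/2) Q_{i-1/2}. The bound makes L_{i-1} vanish on V and also keeps i
-- away from 2.
theorem subAct_Q_eq_zero {i : ℤ} (hi : t + q + 2 < i) (v : V) : subAct ρ (.Q i) v = 0 := by
  have h1 : subIndex q (.L (i - 1)) := show (0 : ℤ) ≤ i - 1 by omega
  have h2 : subIndex q (.Q 1) := show (1 : ℤ) ≤ 1 by omega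
  have h := subAct_subAct ρ h1 h2 v
  rw [hL _ (by omega), hL _ (by omega), map_zero, smul_zero, zero_add] at h
  simp only [basisBracket, map_smul, lin_e, LinearMap.smul_apply, sub_add_cancel] at h
  refine (smul_eq_zero.1 h.symm).resolve_left fun hc => ?_
  have h3 : ((i - 2 : ℤ) : ℂ) = 0 := by
    push_cast at hc ⊢
    linear_combination 2 * hc
  rw [Int.cast_eq_zero] at h3
  omega

/-- Given v killed by all Q_{i-1/2} with i > s + 1, either v or Q_{s+1/2} v also works for the bound
s: these operators anticommute, and Q_{s+1/2} squares to M_{2s+1}, which is zero on V because s ≥ t.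
After q + 2 steps the bound is t. -/
theorem exists_mem_kerQ [Nontrivial V] (n : ℕ) : ∃ v ∈ kerQ ρ (t + (q + 2 - n)), v ≠ 0 := by
  induction n with
  | zero =>
    obtain ⟨v, hv⟩ := exists_ne (0 : V)
    exact ⟨v, (mem_kerQ ρ).2 fun i hi => subAct_Q_eq_zero ρ hL (by push_cast at hi; omega) v,
      hv⟩
  | succ n ih =>
    obtain ⟨v, hv, hv0⟩ := ih
    by_cases hn : q + 2 ≤ n
    · rw [Nat.sub_eq_zero_of_le hn] at hv
      rw [Nat.sub_eq_zero_of_le (hn.trans n.le_succ)]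
      exact ⟨v, hv, hv0⟩
    obtain ⟨s, hs⟩ : ∃ s : ℕ, t + (q + 2 - n) = s + 1 ∧ t + (q + 2 - (n + 1)) = s ∧ t ≤ s :=
      ⟨t + (q + 2 - (n + 1)), by omega, rfl, by omega⟩
    rw [hs.1] at hv
    rw [hs.2.1]
    rw [mem_kerQ] at hv
    have hts := hs.2.2
    by_cases h0 : subAct ρ (.Q (s + 1)) v = 0
    · refine ⟨v, (mem_kerQ ρ).2 fun i hi => ?_, hv0⟩
      rcases (show (s : ℤ) + 1 ≤ i by omega).eq_or_lt with h | h
      · rw [← h, h0]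
      · exact hv i (by push_cast; omega)
    · refine ⟨_, (mem_kerQ ρ).2 fun i hi => ?_, h0⟩
      rcases (show (s : ℤ) + 1 ≤ i by omega).eq_or_lt with h | h
      · subst h
        have := subAct_Q_Q ρ hM (i := s + 1) (k := s + 1) (by omega) (by omega) (by omega) v
        refine (smul_eq_zero.1 ?_).resolve_left (two_ne_zero (α := ℂ))
        rw [two_smul]
        exact eq_neg_iff_add_eq_zero.1 this
      · rw [subAct_Q_Q ρ hM (by omega) (by omega) (by omega), hv i (by push_cast; omega), map_zero,
          neg_zero]

theorem kerQ_eq_top (hV : ρ.IsSimple) : kerQ ρ t = ⊤ := by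
  have := hV.nontrivial
  obtain ⟨v, hv, hv0⟩ := exists_mem_kerQ ρ hM hL (q + 2)
  rw [Nat.sub_self, add_zero] at hv
  refine (hV.eq_bot_or_eq_top _ (isSubmodule_kerQ ρ hM)).resolve_left fun h => hv0 ?_
  rwa [h, Submodule.mem_bot] at hv

omit hM hL in
theorem lin_ind_act (x : BMS) : lin (fun i => ρ.ind.act (e i)) x = ρ.ind.act x := by
  refine supported_induction (p := fun _ => True)
    (P := fun x => lin (fun i => ρ.ind.act (e i)) x = ρ.ind.act x) (by simp)
    (fun i _ => by rw [lin_e]) (by simp) (fun x y hx hy => by rw [map_add, map_add, hx, hy])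
    (fun c x hx => by rw [map_smul, map_smul, hx])

omit hM hL in
theorem repOn_ind : RepOn (fun _ => True) fun i => ρ.ind.act (e i) := by
  intro i j _ _
  have hb : (instLieSuperalgebra).bracket (e i) (e j) = basisBracket i j := bracketMap_e i j
  rw [lin_ind_act, ← hb]
  exact LinearMap.ext fun v =>
    (ρ.ind.act_bracket (e_mem_gradedPart i rfl) (e_mem_gradedPart j rfl) v).symm

/-- The map `v ↦ 1 ⊗ v` into the induced module. -/
noncomputable def toInd : V →ₗ[ℂ] ρ.IndSpace where
  toFun := ρ.indMk 1
  map_add' := ρ.indMk_add_right 1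
  map_smul' c := ρ.indMk_smul_right c 1

omit hM hL in
theorem toInd_injective : Function.Injective (toInd ρ) := indMk_one_injective ρ

omit hM hL in
theorem ind_act_indMk (x : BMS) (u : Enveloping BMS) (v : V) :
    ρ.ind.act x (ρ.indMk u v) = ρ.indMk (Enveloping.ι x * u) v :=
  ρ.indMul_indMk _ _ _

omit hM hL in
theorem ind_act_toInd (x : (sub q).carrier) (v : V) :
    ρ.ind.act x.1 (toInd ρ v) = toInd ρ (ρ.act x v) := by
  refine (ind_act_indMk ρ _ _ _).trans ?_
  rw [mul_one]
  refine (Submodule.Quotient.eq _).2 (Submodule.subset_span ⟨1, x, v, ?_⟩)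
  rw [one_mul]

omit hM hL in
theorem ind_act_toInd_of {i : BMSIndex} (hi : subIndex q i) (v : V) :
    ρ.ind.act (e i) (toInd ρ v) = toInd ρ (subAct ρ i v) := by
  rw [subAct_of ρ hi]
  exact ind_act_toInd ρ (subE q i hi) v

omit hM hL in
-- The induced module is generated by 1 ⊗ V, since monomials span the enveloping algebra.
theorem eq_top_of_stable {W : Submodule ℂ ρ.IndSpace} (h₀ : LinearMap.range (toInd ρ) ≤ W)
    (hW : ∀ i, ∀ w ∈ W, ρ.ind.act (e i) w ∈ W) : W = ⊤ := by
  have hact : ∀ x, ∀ w ∈ W, ρ.ind.act x w ∈ W := by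
    intro x w hw
    rw [← lin_ind_act]
    exact lin_apply_mem (p := fun _ => True) (by simp) fun i _ => hW i w hw
  have hmk : ∀ u v, ρ.indMk u v ∈ W := by
    intro u v
    have hu : u ∈ Submodule.span ℂ {u : Enveloping BMS | ∃ a, Enveloping.IsMonomial a u} := by
      rw [Enveloping.span_isMonomial]; trivial
    induction hu using Submodule.span_induction with
    | mem u hu =>
      obtain ⟨a, ha⟩ := hu
      induction ha with
      | one => exact h₀ ⟨v, rfl⟩
      | ι_mul _ _ ih =>
        rw [← ind_act_indMk]
        exact hact _ _ ih
    | zero => simp [LieSupermodule.indMk]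
    | add u u' _ _ hu hu' => rw [ρ.indMk_add_left]; exact W.add_mem hu hu'
    | smul c u _ hu => rw [ρ.indMk_smul_left]; exact W.smul_mem c hu
  rw [eq_top_iff]
  rintro w -
  obtain ⟨w, rfl⟩ := Submodule.Quotient.mk_surjective _ w
  induction w using TensorProduct.induction_on with
  | zero => exact W.zero_mem
  | tmul u v => exact hmk u v
  | add x y hx hy => rw [Submodule.Quotient.mk_add]; exact W.add_mem hx hy

omit hM hL in
-- The eigenspace for the scalar a is stable under the whole algebra and contains the generators 1 ⊗
-- V.
theorem central_ind {c : BMSIndex} (hcent : ∀ i, basisBracket c i = 0) (hc : subIndex q c)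
    (hp : parity c = 0) {a : ℂ} (ha : ∀ v, subAct ρ c v = a • v) (w : ρ.IndSpace) :
    ρ.ind.act (e c) w = a • w := by
  have h : LinearMap.ker (ρ.ind.act (e c) - a • LinearMap.id) = ⊤ := by
    refine eq_top_of_stable ρ ?_ fun i w hw => ?_
    · rintro _ ⟨v, rfl⟩
      rw [LinearMap.mem_ker, LinearMap.sub_apply, ind_act_toInd_of ρ hc, ha]
      simp
    · rw [LinearMap.mem_ker, LinearMap.sub_apply, sub_eq_zero] at hw ⊢
      have := LinearMap.congr_fun (repOn_ind ρ c i trivial trivial) w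
      rw [hcent] at this
      simp only [sgn, hp, koszulSign, zero_ne_one, false_and, if_false, one_smul, map_zero,
        LinearMap.sub_apply, Module.End.mul_apply, LinearMap.zero_apply, sub_eq_zero] at this
      rw [this, hw]
      simp
  have hw : w ∈ LinearMap.ker (ρ.ind.act (e c) - a • LinearMap.id) := by rw [h]; trivial
  rw [LinearMap.mem_ker, LinearMap.sub_apply, sub_eq_zero] at hw
  simpa using hw

omit hM hL in
-- The preimage in V of a nonzero submodule W is a nonzero submodule, hence V itself, so W contains
-- the generators. The preimage is graded because v ↦ 1 ⊗ v preserves parity and homogeneous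
-- decompositions in the induced module are unique.
theorem isSimple_ind (hV : ρ.IsSimple) (hmeet : ∀ W : Submodule ℂ ρ.IndSpace,
      (∀ i, ∀ w ∈ W, ρ.ind.act (e i) w ∈ W) → ∀ w ∈ W, w ≠ 0 →
        ∃ v ∈ W, v ∈ LinearMap.range (toInd ρ) ∧ v ≠ 0) : ρ.ind.IsSimple := by
  have hnt := hV.nontrivial
  refine ⟨(toInd_injective ρ).nontrivial, fun W hW => ?_⟩
  by_cases hbot : W = ⊥
  · exact Or.inl hbot
  right
  obtain ⟨w, hw, h0⟩ := Submodule.exists_mem_ne_zero_of_ne_bot hbot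
  obtain ⟨_, hvW, ⟨v, rfl⟩, hv0⟩ := hmeet W (fun i w hw => hW.act_mem (e i) hw) w hw h0
  have hpart : ∀ {a : ZMod 2} {v : V}, v ∈ ρ.part a → toInd ρ v ∈ ρ.ind.part a :=
    fun {a v} hv => Submodule.subset_span ⟨0, a, 1, v, .one, hv, zero_add a, rfl⟩
  have hsub : ρ.IsSubmodule (W.comap (toInd ρ)) := by
    refine ⟨fun v hv => ?_, fun x v hv => ?_⟩
    · obtain ⟨a, ha, b, hb, rfl⟩ : ∃ a ∈ ρ.part 0, ∃ b ∈ ρ.part 1, a + b = v :=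
        Submodule.mem_sup.1 (by rw [ρ.isCompl_part.sup_eq_top]; trivial)
      obtain ⟨a', ⟨haW, ha'⟩, b', ⟨hbW, hb'⟩, hab⟩ := Submodule.mem_sup.1 (hW.graded hv)
      rw [map_add] at hab
      have hz : a' - toInd ρ a = toInd ρ b - b' := by
        rw [sub_eq_sub_iff_add_eq_add, hab, add_comm]
      have h1 := Submodule.disjoint_def.1 ρ.ind.isCompl_part.disjoint _
        (Submodule.sub_mem _ ha' (hpart ha))
        (by rw [hz]; exact Submodule.sub_mem _ (hpart hb) hb')
      have h2 := h1
      rw [hz] at h2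
      refine Submodule.add_mem_sup ⟨?_, ha⟩ ⟨?_, hb⟩
      · rw [SetLike.mem_coe, Submodule.mem_comap, ← sub_eq_zero.1 h1]; exact haW
      · rw [SetLike.mem_coe, Submodule.mem_comap, sub_eq_zero.1 h2]; exact hbW
    · rw [Submodule.mem_comap, ← ind_act_toInd]
      exact hW.act_mem _ hv
  have htop : W.comap (toInd ρ) = ⊤ := (hV.eq_bot_or_eq_top _ hsub).resolve_left fun h => hv0 (by
    have : v ∈ W.comap (toInd ρ) := hvW
    rw [h, Submodule.mem_bot] at this
    rw [this, map_zero])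
  refine eq_top_of_stable ρ ?_ fun i w hw => hW.act_mem (e i) hw
  rintro _ ⟨v, rfl⟩
  have : v ∈ W.comap (toInd ρ) := by rw [htop]; trivial
  exact this

end Final

/-! ### Smoothness, and verification of the hypotheses for the induced module -/

/-- The vectors killed by `L_i`, `M_i`, `Q_{i - 1/2}` for all sufficiently large `i`. -/
def smoothPart {N : Type*} [AddCommGroup N] [Module ℂ N] (A : BMSIndex → Module.End ℂ N) :
    Submodule ℂ N where
  carrier := {w | ∃ B : ℤ, ∀ i : ℤ, B ≤ i →
    A (.L i) w = 0 ∧ A (.M i) w = 0 ∧ A (.Q i) w = 0}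
  zero_mem' := ⟨0, fun i _ => by simp⟩
  add_mem' := by
    rintro v w ⟨B, hB⟩ ⟨B', hB'⟩
    refine ⟨max B B', fun i hi => ?_⟩
    obtain ⟨h1, h2, h3⟩ := hB i (le_of_max_le_left hi)
    obtain ⟨h1', h2', h3'⟩ := hB' i (le_of_max_le_right hi)
    simp [*]
  smul_mem' := by
    rintro c w ⟨B, hB⟩
    refine ⟨B, fun i hi => ?_⟩
    obtain ⟨h1, h2, h3⟩ := hB i hi
    simp [*]

namespace Generated

variable {N : Type*} [AddCommGroup N] [Module ℂ N] {A : BMSIndex → Module.End ℂ N}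
  {V₀ : Submodule ℂ N} {q t : ℕ} {z₁ z : ℂ} (D : Generated A V₀ q t z₁ z)
include D

/-- Commuting a fixed generator past one of large index shifts that index by a bounded amount, so
enlarging the bound by the absolute value of the generator's index is enough. -/
theorem smoothPart_stable (j : BMSIndex) {w : N} (hw : w ∈ smoothPart A) :
    A j w ∈ smoothPart A := by
  obtain ⟨B, hB⟩ := hw
  rcases j with n | n | n | _ | _
  · refine ⟨|B| + |n| + 1, fun i hi => ?_⟩
    have e1 := le_abs_self B
    have e2 := le_abs_self n
    have e3 := neg_le_abs n
    have e4 := abs_nonneg B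
    obtain ⟨h1, h2, h3⟩ := hB i (by omega)
    obtain ⟨h1', h2', h3'⟩ := hB (i + n) (by omega)
    obtain ⟨h1'', h2'', h3''⟩ := hB (n + i) (by omega)
    have h0 : δ (i + n) = 0 := if_neg (by omega)
    refine ⟨?_, ?_, ?_⟩ <;> rw [D.apply_apply] <;> simp [basisBracket, lin_e, *]
  · refine ⟨|B| + |n| + 1, fun i hi => ?_⟩
    have e1 := le_abs_self B
    have e2 := le_abs_self n
    have e3 := neg_le_abs n
    have e4 := abs_nonneg B
    obtain ⟨h1, h2, h3⟩ := hB i (by omega)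
    obtain ⟨h1', h2', h3'⟩ := hB (i + n) (by omega)
    have h0 : δ (i + n) = 0 := if_neg (by omega)
    refine ⟨?_, ?_, ?_⟩ <;> rw [D.apply_apply] <;> simp [basisBracket, lin_e, *]
  · refine ⟨|B| + |n| + 2, fun i hi => ?_⟩
    have e1 := le_abs_self B
    have e2 := le_abs_self n
    have e3 := neg_le_abs n
    have e4 := abs_nonneg B
    obtain ⟨h1, h2, h3⟩ := hB i (by omega)
    obtain ⟨h1', h2', h3'⟩ := hB (i + n) (by omega)
    obtain ⟨h1'', h2'', h3''⟩ := hB (i + n - 1) (by omega)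
    have h0 : δ (i + n - 1) = 0 := if_neg (by omega)
    refine ⟨?_, ?_, ?_⟩ <;> rw [D.apply_apply] <;> simp [basisBracket, lin_e, *]
  · rw [D.c₁_apply]; exact Submodule.smul_mem _ _ ⟨B, hB⟩
  · rw [D.c₂_apply]; exact Submodule.smul_mem _ _ ⟨B, hB⟩

theorem smoothPart_eq_top : smoothPart A = ⊤ := by
  rw [eq_top_iff, ← D.generates]
  refine cl_le (fun v hv => ⟨t + q + 1, fun i hi => ⟨D.L_apply i (by omega) v hv,
    D.M_apply i (by omega) v hv, D.Q_apply i (by omega) v hv⟩⟩)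
    fun i _ _ _ hu => D.smoothPart_stable i hu

end Generated

theorem generated_ind {q : ℕ} {z₁ z₂ : ℂ} {V : Type u} [AddCommGroup V] [Module ℂ V]
    (ρ : LieSupermodule (sub q).carrier V) (hc : SubHasCentralCharge ρ z₁ z₂) (t : ℕ)
    (ha : (0 < t → Function.Injective (ρ.act (subM q t))) ∧
      (t = 0 → ∀ n : ℤ, n ≠ 0 → Function.Injective
        (ρ.act (subM q 0 + (((n : ℂ) ^ 2 - 1) / 24) • subC₂ q))))
    (hM : ∀ i : ℤ, t < i → ∀ v, subAct ρ (.M i) v = 0)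
    (hL : ∀ i : ℤ, t + q < i → ∀ v, subAct ρ (.L i) v = 0)
    (hQ : ∀ i : ℤ, t < i → ∀ v, subAct ρ (.Q i) v = 0) :
    Generated (fun i => ρ.ind.act (e i)) (LinearMap.range (toInd ρ)) q t z₁ z₂ := by
  have hc₁ : ∀ v, subAct ρ .c₁ v = z₁ • v := fun v => by
    rw [subAct_of ρ (i := .c₁) trivial]; exact (hc v).1
  have hc₂ : ∀ v, subAct ρ .c₂ v = z₂ • v := fun v => by
    rw [subAct_of ρ (i := .c₂) trivial]; exact (hc v).2
  have hsM : ∀ i : ℤ, 0 ≤ i → subIndex q (.M i) := fun i hi => show -(q : ℤ) ≤ i by omega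
  refine ⟨repOn_ind ρ, central_ind ρ (c := .c₁) (fun i => by cases i <;> rfl) trivial rfl hc₁,
    central_ind ρ (c := .c₂) (fun i => by cases i <;> rfl) trivial rfl hc₂, ?_, ?_, ?_, ?_, ?_,
    eq_top_of_stable ρ le_cl fun i w hw => cl_stable (i := i) trivial hw⟩
  · rintro i hi _ ⟨v, rfl⟩
    exact ⟨_, (ind_act_toInd_of ρ hi v).symm⟩
  · rintro i hi _ ⟨v, rfl⟩
    exact (ind_act_toInd_of ρ (hsM i (by omega)) v).trans (by rw [hM i hi, map_zero])
  · rintro i hi _ ⟨v, rfl⟩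
    exact (ind_act_toInd_of ρ (i := .L i) (show (0 : ℤ) ≤ i by omega) v).trans
      (by rw [hL i hi, map_zero])
  · rintro i hi _ ⟨v, rfl⟩
    exact (ind_act_toInd_of ρ (i := .Q i) (show (1 : ℤ) ≤ i by omega) v).trans
      (by rw [hQ i hi, map_zero])
  · rintro n hn _ ⟨v, rfl⟩ h
    rw [Generated.zOp_apply, ind_act_toInd_of ρ (hsM t (by omega)), ← map_smul, ← map_add,
      ← map_zero (toInd ρ)] at h
    have h' := toInd_injective ρ h
    rw [subAct_M] at h'
    suffices v = 0 by rw [this, map_zero]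
    -- The two halves of hypothesis (a): for t > 0 the central correction in `zOp` vanishes and it
    -- is just M_t; for t = 0 it is M_0 + (n² - 1)/24 · c₂.
    by_cases ht : t = 0
    · refine ha.2 ht n hn ?_
      subst ht
      rw [map_zero, map_add, map_smul, LinearMap.add_apply, LinearMap.smul_apply, (hc v).2,
        smul_smul, ← h']
      simp [δ]
    · refine ha.1 (Nat.pos_of_ne_zero ht) ?_
      rw [map_zero, ← h', δ, if_neg (by omega)]
      simp

end BMS

theorem theorem4p1 (q : ℕ) (z₁ z₂ : ℂ) {V : Type*} [AddCommGroup V] [Module ℂ V]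
    (ρ : LieSupermodule (BMS.sub q).carrier V) (hV : ρ.IsSimple)
    (hc : BMS.SubHasCentralCharge ρ z₁ z₂) (t : ℕ)
    (ha : (0 < t → Function.Injective (ρ.act (BMS.subM q t))) ∧
      (t = 0 → ∀ n : ℤ, n ≠ 0 → Function.Injective
        (ρ.act (BMS.subM q 0 + (((n : ℂ) ^ 2 - 1) / 24) • BMS.subC₂ q))))
    (hb : (∀ i : ℕ, t < i → ∀ v : V, ρ.act (BMS.subM q i) v = 0) ∧
      (∀ j : ℕ, t + q < j → ∀ v : V, ρ.act (BMS.subL q j) v = 0)) :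
    (∀ (i : ℕ) (hi : t < i), ∀ v : V, ρ.act (BMS.subQ q i (Nat.one_le_of_lt hi)) v = 0) ∧
      ρ.ind.IsSimple ∧ BMS.IsSmooth ρ.ind ∧ BMS.HasCentralCharge ρ.ind z₁ z₂ := by
  have hM : ∀ i : ℤ, t < i → ∀ v, BMS.subAct ρ (.M i) v = 0 := by
    intro i hi v
    lift i to ℕ using by omega
    rw [BMS.subAct_M]
    exact hb.1 i (by omega) v
  have hL : ∀ i : ℤ, t + q < i → ∀ v, BMS.subAct ρ (.L i) v = 0 := by
    intro i hi v
    lift i to ℕ using by omega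
    rw [BMS.subAct_L]
    exact hb.2 i (by omega) v
  have hQ : ∀ i : ℤ, t < i → ∀ v, BMS.subAct ρ (.Q i) v = 0 := by
    intro i hi v
    have hv : v ∈ BMS.kerQ ρ t := by rw [BMS.kerQ_eq_top ρ hM hL hV]; trivial
    exact (BMS.mem_kerQ ρ).1 hv i hi
  have D := BMS.generated_ind ρ hc t ha hM hL hQ
  refine ⟨fun i hi v => ?_, BMS.isSimple_ind ρ hV fun W hW w hw h0 =>
    D.exists_mem_of_stable hW hw h0, fun w => ?_, fun w => ⟨D.c₁_apply w, D.c₂_apply w⟩⟩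
  · have h := hQ i (by omega) v
    rwa [BMS.subAct_of ρ (i := .Q i) (show (1 : ℤ) ≤ i by omega)] at h
  · have hw : w ∈ BMS.smoothPart fun i => ρ.ind.act (BMS.e i) := by
      rw [D.smoothPart_eq_top]; trivial
    exact hw
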